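/- Work over the field $\mathbb{C}(q)$ of rational functions in an indeterminate $q$; put $\xi=q-q^{-1}$. All tensor products of superalgebras are taken with the usual sign rule. For $n\ge 0$ let $I_{n|n}=\{-n,\dots,-1,1,\dots,n\}$, with $|i|=\bar 0$ for $i>0$ and $|i|=\bar 1$ for $i<0$; the matrix unit $E_{ij}$ has parity $|i|+|j|$. Let $\varphi(i,j)=(-1)^{|j|}(\delta_{ij}+\delta_{i,-j})$ and $$S=\sum_{i,j\in I_{n|n}}q^{\varphi(i,j)}E_{ii}\otimes E_{jj}+\xi\sum_{i<j}(-1)^{|i|}(E_{ji}+E_{-j,-i})\otimes E_{ij}.$$ Superscripts give the positions of the tensor factors in which a matrix or (in brackets) its algebra entries stand. The quantum queer superalgebra $\mathrm{U}_q(\mathfrak q_n)$ is the unital associative superalgebra generated by $L_{ij}$ of parity $|i|+|j|$ ($i\le j$ in $I_{n|n}$), with relations $L_{ii}L_{-i,-i}=1=L_{-i,-i}L_{ii}$ and $L^{[1]2}L^{[1]3}S^{23}=S^{23}L^{[1]3}L^{[1]2}$, where $L=\sum_{i\le j}L_{ij}\otimes E_{ij}$. Its comultiplication and counit are given by $\Delta(L)=L\otimes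 L$, i.e. $\Delta(L_{ij})=\sum_k(-1)^{(|i|+|k|)(|k|+|j|)}L_{ik}\otimes L_{kj}$, and $\varepsilon(L_{ij})=\delta_{ij}$. A $\mathrm{U}_q(\mathfrak q_n)$-supermodule superalgebra is a unital associative superalgebra $B$ that is a $\mathrm{U}_q(\mathfrak q_n)$-supermodule with $u.(ab)=\sum_{(u)}(-1)^{|u_{(2)}||a|}(u_{(1)}.a)(u_{(2)}.b)$ and $u.1=\varepsilon(u)1$. On a tensor product of supermodules, $u.(x\otimes y)=\sum_{(u)}(-1)^{|u_{(2)}||x|}u_{(1)}.x\otimes u_{(2)}.y$. For $r\ge 0$ the quantum coordinate superalgebra $\mathsf A_{r,n}$ is the unital associative superalgebra generated by $t_{ia}$ of parity $|i|+|a|$ ($i\in I_{r|r}$, $a\in I_{n|n}$), with relations $t_{ia}=t_{-i,-a}$ and $S^{12}T^{1[3]}T^{2[3]}=T^{2[3]}T^{1[3]}S^{12}$, where $T=\sum_{i,a}E_{ia}\otimes t_{ia}$ (the left $S$ being indexed by $I_{r|r}$, the right one by $I_{n|n}$). For $p+r\le m$ let $\iota_p:\mathsf A_{r,n}\to\mathsf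 A_{m,n}$ be the superalgebra homomorphism with $t_{ia}\mapsto t_{p+i,a}$ for $i=1,\dots,r$ and $a\in I_{n|n}$. Theorem. Let $n,r,k\ge 0$. (a) For every $m\ge0$ there is exactly one action $\Phi$ of $\mathrm{U}_q(\mathfrak q_n)$ on $\mathsf A_{m,n}$ that makes it a $\mathrm{U}_q(\mathfrak q_n)$-supermodule superalgebra and satisfies $$\sum_{a,b,c\in I_{n|n}}\sum_{i\in I_{m|m}}(-1)^{(|a|+|b|)(|i|+|c|)}E_{ic}\otimes\Phi_{L_{ab}}(t_{ic})\otimes E_{ab}=T^{1[2]}S^{13}$$ (with $L_{ab}=0$ for $a>b$). (b) With these actions there is exactly one homomorphism of $\mathrm{U}_q(\mathfrak q_n)$-supermodules $\Theta:\mathsf A_{k,n}\otimes\mathsf A_{r,n}\to\mathsf A_{r,n}\otimes\mathsf A_{k,n}$ such that $\Theta(1\otimes x)=x\otimes 1$, $\Theta(y\otimes1)=1\otimes y$, $$\Theta(1\otimes\mathrm{mul})=(\mathrm{mul}\otimes1)(1\otimes\Theta)(\Theta\otimes1),\qquad \Theta(\mathrm{mul}\otimes1)=(1\otimes\mathrm{mul})(\Theta\otimes1)(1\otimes\Theta),$$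 and $\Theta(T_k^{1[3]}T_r^{2[4]})=T_r^{2[3]}T_k^{1[4]}S^{12}$, where $T_r=\sum_{i=1}^r\sum_{a\in I_{n|n}}E_{ia}\otimes t_{ia}$ and $T_k=\sum_{j=1}^k\sum_{b\in I_{n|n}}E_{jb}\otimes t_{jb}$. (c) With the braided multiplication $(\mathrm{mul}\otimes\mathrm{mul})(1\otimes\Theta\otimes1)$, the unit $1\otimes 1$ and the tensor product action, $\mathsf A_{r,n}\otimes\mathsf A_{k,n}$ is a $\mathrm{U}_q(\mathfrak q_n)$-supermodule superalgebra, and the $\mathbb C(q)$-linear map $$\sigma:\mathsf A_{r,n}\otimes\mathsf A_{k,n}\to\mathsf A_{r+k,n},\qquad x\otimes y\mapsto\iota_k(x)\,\iota_0(y),$$ is an isomorphism of $\mathrm{U}_q(\mathfrak q_n)$-supermodule superalgebras (bijective, parity preserving, multiplicative, unital and $\mathrm{U}_q(\mathfrak q_n)$-equivariant). -/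

import Mathlib

open scoped TensorProduct DirectSum

namespace QueerBraided

/-! ### The base field, the index sets and the matrix `S` -/

/-- The base field `ℂ(q)`. -/
def Kq : Type := RatFunc ℂ

noncomputable instance : Field Kq := inferInstanceAs (Field (RatFunc ℂ))

/-- The indeterminate `q`. -/
noncomputable def q : Kq := (RatFunc.X : RatFunc ℂ)

/-- `ξ = q - q⁻¹`. -/
noncomputable def xi : Kq := q - q⁻¹

/-- The sign `(-1)^d` for `d ∈ ℤ/2ℤ`. -/
noncomputable def sgn (d : ZMod 2) : Kq := (-1) ^ d.val

/-- `I_{n|n} = {-n, …, -1, 1, …, n}`, with its order as a subset of `ℤ`. -/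
abbrev Idx (n : ℕ) : Type := {i : ℤ // i ∈ (Finset.Icc (-(n : ℤ)) n).erase 0}

instance (n : ℕ) : Neg (Idx n) where
  neg i := ⟨-i.1, by
    have h := i.2
    simp only [Finset.mem_erase, Finset.mem_Icc] at h ⊢
    omega⟩

/-- The parity `|i|`: even for `i > 0` and odd for `i < 0`. -/
def par {n : ℕ} (i : Idx n) : ZMod 2 := if 0 < i.1 then 0 else 1

/-- `φ(i,j) = (-1)^{|j|} (δ_{ij} + δ_{i,-j})`. -/
def phi {n : ℕ} (i j : Idx n) : ℤ :=
  (if 0 < j.1 then 1 else -1) * ((if i = j then 1 else 0) + (if i = -j then 1 else 0))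

/-- `Smat i i' j j'` is the coefficient of `E_{i i'} ⊗ E_{j j'}` in
`S = ∑_{i,j} q^{φ(i,j)} E_{ii} ⊗ E_{jj} + ξ ∑_{i<j} (-1)^{|i|} (E_{ji} + E_{-j,-i}) ⊗ E_{ij}`. -/
noncomputable def Smat {n : ℕ} (i i' j j' : Idx n) : Kq :=
  (if i = i' ∧ j = j' then q ^ phi i j else 0) +
  (if j < j' then
    xi * sgn (par j) *
      ((if i = j' ∧ i' = j then 1 else 0) + (if i = -j' ∧ i' = -j then 1 else 0))
  else 0)

/-! ### Superalgebras given by homogeneous generators and relations -/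

section Presented

variable {X : Type} (p : X → ZMod 2)

/-- The parity `d` part of the free superalgebra on generators `x` of parity `p x`:
the span of all words whose letters have parities adding up to `d`. -/
noncomputable def freeGrading (d : ZMod 2) : Submodule Kq (FreeAlgebra Kq X) :=
  Submodule.span Kq {w | ∃ l : List X, (l.map p).sum = d ∧ w = (l.map (FreeAlgebra.ι Kq)).prod}

variable (rel : FreeAlgebra Kq X → FreeAlgebra Kq X → Prop)

/-- The induced parity on the quotient of the free superalgebra by relations. -/
noncomputable def presGrading (d : ZMod 2) : Submodule Kq (RingQuot rel) :=
  (freeGrading p d).map (RingQuot.mkAlgHom Kq rel).toLinearMap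

variable {p}

theorem ι_mem_freeGrading (x : X) : FreeAlgebra.ι Kq x ∈ freeGrading p (p x) :=
  Submodule.subset_span ⟨[x], by simp, by simp⟩

theorem one_mem_freeGrading : (1 : FreeAlgebra Kq X) ∈ freeGrading p 0 :=
  Submodule.subset_span ⟨[], by simp, by simp⟩

theorem mul_mem_freeGrading {d e : ZMod 2} {x y : FreeAlgebra Kq X}
    (hx : x ∈ freeGrading p d) (hy : y ∈ freeGrading p e) : x * y ∈ freeGrading p (d + e) := by
  induction hx using Submodule.span_induction with
  | zero => simp
  | add a b _ _ ha hb => rw [add_mul]; exact add_mem ha hb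
  | smul c a _ ha => rw [smul_mul_assoc]; exact Submodule.smul_mem _ _ ha
  | mem a ha =>
    obtain ⟨l, hl, rfl⟩ := ha
    induction hy using Submodule.span_induction with
    | zero => simp
    | add a b _ _ ha hb => rw [mul_add]; exact add_mem ha hb
    | smul c a _ ha => rw [mul_smul_comm]; exact Submodule.smul_mem _ _ ha
    | mem b hb =>
      obtain ⟨l', hl', rfl⟩ := hb
      exact Submodule.subset_span ⟨l ++ l', by simp [hl, hl'], by simp⟩

instance : SetLike.GradedMonoid (presGrading p rel) where
  one_mem := ⟨1, one_mem_freeGrading, by simp⟩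
  mul_mem := by
    rintro i j _ _ ⟨x, hx, rfl⟩ ⟨y, hy, rfl⟩
    exact ⟨x * y, mul_mem_freeGrading hx hy, by simp⟩

theorem ι_mem_presGrading (x : X) :
    RingQuot.mkAlgHom Kq rel (FreeAlgebra.ι Kq x) ∈ presGrading p rel (p x) :=
  ⟨_, ι_mem_freeGrading x, rfl⟩

/-- Auxiliary: the decomposition map on the free superalgebra. -/
noncomputable def preDecompose :
    FreeAlgebra Kq X →ₐ[Kq] ⨁ d, presGrading p rel d :=
  FreeAlgebra.lift Kq fun x =>
    DirectSum.of (fun d => presGrading p rel d) (p x) ⟨_, ι_mem_presGrading rel x⟩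

theorem preDecompose_of_mem {d : ZMod 2} {x : FreeAlgebra Kq X} (hx : x ∈ freeGrading p d) :
    preDecompose rel x =
      DirectSum.of (fun d => presGrading p rel d) d ⟨RingQuot.mkAlgHom Kq rel x, x, hx, rfl⟩ := by
  change _ = DirectSum.lof Kq _ (fun d => presGrading p rel d) d _
  induction hx using Submodule.span_induction with
  | zero =>
    rw [map_zero]; symm
    convert map_zero (DirectSum.lof Kq _ (fun d => presGrading p rel d) d)
    simp
  | add a b ha hb iha ihb =>
    rw [map_add, iha, ihb, ← map_add]
    congr 1; ext; simp
  | smul c a ha iha =>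
    rw [map_smul, iha, ← map_smul]
    congr 1; ext; simp
  | mem a ha =>
    obtain ⟨l, hl, rfl⟩ := ha
    subst hl
    change _ = DirectSum.of (fun d => presGrading p rel d) _ _
    induction l with
    | nil => simp only [List.map_nil, List.prod_nil, map_one]; rfl
    | cons x l ih =>
      simp only [List.map_cons, List.prod_cons, map_mul]
      rw [ih, preDecompose, FreeAlgebra.lift_ι_apply,
        DirectSum.of_mul_of]
      rfl

/-- If all relations are homogeneous, the quotient is a superalgebra. -/
noncomputable abbrev presGradedAlgebra
    (h : ∀ x y, rel x y → ∃ d, x ∈ freeGrading p d ∧ y ∈ freeGrading p d) :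
    GradedAlgebra (presGrading p rel) :=
  GradedAlgebra.ofAlgHom (presGrading p rel)
    (RingQuot.liftAlgHom Kq ⟨preDecompose rel, by
      intro x y hxy
      obtain ⟨d, hx, hy⟩ := h x y hxy
      rw [preDecompose_of_mem rel hx, preDecompose_of_mem rel hy]
      congr 2
      exact RingQuot.mkAlgHom_rel Kq hxy⟩)
    (by
      apply RingQuot.ringQuot_ext'
      ext x
      simp [preDecompose])
    (by
      rintro d ⟨_, x, hx, rfl⟩
      simp only [AlgHom.toLinearMap_apply, RingQuot.liftAlgHom_mkAlgHom_apply]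
      exact preDecompose_of_mem rel hx)

end Presented

/-! ### Elementary facts on signs and on `S` -/

theorem sgn_add (d e : ZMod 2) : sgn (d + e) = sgn d * sgn e := by
  unfold sgn
  rw [ZMod.val_add, ← neg_one_pow_eq_pow_mod_two, pow_add]

@[simp] theorem sgn_zero : sgn 0 = 1 := by simp [sgn]

theorem sgn_eq_zsmul (d : ZMod 2) : sgn d = ((((-1 : ℤˣ) ^ d : ℤˣ) : ℤ) : Kq) := by
  change _ = ((((-1 : ℤˣ) ^ d.val : ℤˣ) : ℤ) : Kq)
  simp [sgn]

@[simp] theorem neg_val {n : ℕ} (i : Idx n) : (-i).1 = -i.1 := rfl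

@[simp] theorem neg_neg' {n : ℕ} (i : Idx n) : -(-i) = i := by
  apply Subtype.ext; simp

theorem par_neg {n : ℕ} (i : Idx n) : par (-i) = par i + 1 := by
  have h := i.2
  simp only [Finset.mem_erase] at h
  unfold par
  rcases lt_or_gt_of_ne h.1 with h' | h'
  · rw [if_pos (by simp; omega), if_neg (by omega)]; decide
  · rw [if_neg (by simp; omega), if_pos (by omega)]; decide

/-- `S` is even. -/
theorem Smat_parity {n : ℕ} {i i' j j' : Idx n} (h : Smat i i' j j' ≠ 0) :
    par i + par i' + par j + par j' = 0 := by
  unfold Smat at h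
  by_cases h1 : i = i' ∧ j = j'
  · obtain ⟨rfl, rfl⟩ := h1
    generalize par i = x; generalize par j = y; revert x y; decide
  · rw [if_neg h1, zero_add] at h
    by_cases h2 : i = j' ∧ i' = j
    · obtain ⟨rfl, rfl⟩ := h2
      generalize par i = x; generalize par i' = y; revert x y; decide
    · by_cases h3 : i = -j' ∧ i' = -j
      · obtain ⟨rfl, rfl⟩ := h3
        rw [par_neg, par_neg]
        generalize par j = x; generalize par j' = y; revert x y; decide
      · simp [h2, h3] at h

/-! ### The quantum queer superalgebra -/

/-- The coefficient of `E_{ij} ⊗ E_{kl}` in `L^{[1]2} L^{[1]3} S^{23}`, computed in the tensor product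
of superalgebras `B ⊗ End V ⊗ End V`, for a matrix `L` over a superalgebra `B` with entries `L i j`
of parity `|i| + |j|`. The signs come from
* `(L_{ij'} ⊗ E_{ij'} ⊗ 1)(L_{kl'} ⊗ 1 ⊗ E_{kl'})
    = (-1)^{(|i|+|j'|)(|k|+|l'|)} L_{ij'} L_{kl'} ⊗ E_{ij'} ⊗ E_{kl'}`,
* `(E_{ij'} ⊗ E_{kl'})(E_{j'j} ⊗ E_{l'l}) = (-1)^{(|k|+|l'|)(|j'|+|j|)} E_{ij} ⊗ E_{kl}`. -/
noncomputable def LLS {n : ℕ} {B : Type*} [Ring B] [Algebra Kq B] (L : Idx n → Idx n → B)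
    (i j k l : Idx n) : B :=
  ∑ j', ∑ l', (sgn ((par i + par j') * (par k + par l')) *
    sgn ((par k + par l') * (par j' + par j)) * Smat j' j l' l) • (L i j' * L k l')

/-- The coefficient of `E_{ij} ⊗ E_{kl}` in `S^{23} L^{[1]3} L^{[1]2}`. Here
* `(L_{k'l} ⊗ 1 ⊗ E_{k'l})(L_{i'j} ⊗ E_{i'j} ⊗ 1) = L_{k'l} L_{i'j} ⊗ E_{i'j} ⊗ E_{k'l}`,
* `(E_{ii'} ⊗ E_{kk'})(E_{i'j} ⊗ E_{k'l}) = (-1)^{(|k|+|k'|)(|i'|+|j|)} E_{ij} ⊗ E_{kl}`,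
and the even element `S` passes the entries of `L` without a sign. -/
noncomputable def SLL {n : ℕ} {B : Type*} [Ring B] [Algebra Kq B] (L : Idx n → Idx n → B)
    (i j k l : Idx n) : B :=
  ∑ i', ∑ k', (sgn ((par k + par k') * (par i' + par j)) * Smat i i' k k') • (L k' l * L i' j)

/-- The index set of the generators `L_{ij}`, `i ≤ j`, of `U_q(𝔮_n)`. -/
abbrev UGen (n : ℕ) : Type := {x : Idx n × Idx n // x.1 ≤ x.2}

/-- The generator `L_{ij}` has parity `|i| + |j|`. -/
def upar {n : ℕ} (x : UGen n) : ZMod 2 := par x.1.1 + par x.1.2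

/-- The matrix of free generators: `L_{ij}` for `i ≤ j`, and `0` for `i > j`. -/
noncomputable def freeL {n : ℕ} (i j : Idx n) : FreeAlgebra Kq (UGen n) :=
  if h : i ≤ j then FreeAlgebra.ι Kq ⟨(i, j), h⟩ else 0

/-- The defining relations of `U_q(𝔮_n)`: `L_{ii} L_{-i,-i} = 1` for all `i ∈ I_{n|n}` (so also
`L_{-i,-i} L_{ii} = 1`), and `L^{[1]2} L^{[1]3} S^{23} = S^{23} L^{[1]3} L^{[1]2}`. -/
inductive URel (n : ℕ) : FreeAlgebra Kq (UGen n) → FreeAlgebra Kq (UGen n) → Prop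
  | inv (i : Idx n) : URel n (freeL i i * freeL (-i) (-i)) 1
  | sll (i j k l : Idx n) : URel n (LLS freeL i j k l) (SLL freeL i j k l)

/-- The quantum queer superalgebra `U_q(𝔮_n)`. -/
abbrev Uq (n : ℕ) : Type := RingQuot (URel n)

/-- The parity of `U_q(𝔮_n)`. -/
noncomputable abbrev Ugr (n : ℕ) : ZMod 2 → Submodule Kq (Uq n) := presGrading upar (URel n)

theorem freeL_mem {n : ℕ} (i j : Idx n) : freeL i j ∈ freeGrading upar (par i + par j) := by
  unfold freeL
  split_ifs with h
  · exact ι_mem_freeGrading (p := upar) (⟨(i, j), h⟩ : UGen n)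
  · exact zero_mem _

/-- Auxiliary: a linear combination of homogeneous elements. -/
theorem smul_mem_of_ne_zero {X : Type} {p : X → ZMod 2} {c : Kq} {x : FreeAlgebra Kq X}
    {d e : ZMod 2} (hx : x ∈ freeGrading p d) (h : c ≠ 0 → d = e) :
    c • x ∈ freeGrading p e := by
  by_cases hc : c = 0
  · simp [hc]
  · exact h hc ▸ Submodule.smul_mem _ _ hx

theorem URel_homogeneous (n : ℕ) (x y : FreeAlgebra Kq (UGen n)) (h : URel n x y) :
    ∃ d, x ∈ freeGrading upar d ∧ y ∈ freeGrading upar d := by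
  cases h with
  | inv i =>
    refine ⟨0, ?_, one_mem_freeGrading⟩
    have h0 : ∀ a b : ZMod 2, a + a + (b + b) = 0 := by decide
    rw [← h0 (par i) (par (-i))]
    exact mul_mem_freeGrading (freeL_mem i i) (freeL_mem (-i) (-i))
  | sll i j k l =>
    refine ⟨par i + par j + par k + par l, ?_, ?_⟩
    · refine Submodule.sum_mem _ fun j' _ => Submodule.sum_mem _ fun l' _ => ?_
      refine smul_mem_of_ne_zero (mul_mem_freeGrading (freeL_mem _ _) (freeL_mem _ _)) fun h => ?_
      have := Smat_parity (right_ne_zero_of_mul h)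
      revert this
      generalize par i = a; generalize par j = b; generalize par k = c; generalize par l = d
      generalize par j' = e; generalize par l' = f
      revert a b c d e f; decide
    · refine Submodule.sum_mem _ fun j' _ => Submodule.sum_mem _ fun l' _ => ?_
      refine smul_mem_of_ne_zero (mul_mem_freeGrading (freeL_mem _ _) (freeL_mem _ _)) fun h => ?_
      have := Smat_parity (right_ne_zero_of_mul h)
      revert this
      generalize par i = a; generalize par j = b; generalize par k = c; generalize par l = d
      generalize par j' = e; generalize par l' = f
      revert a b c d e f; decide

noncomputable instance (n : ℕ) : GradedAlgebra (Ugr n) :=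
  presGradedAlgebra (URel n) (URel_homogeneous n)

/-- The elements `L_{ij}` of `U_q(𝔮_n)` (zero for `i > j`). -/
noncomputable def Lgen {n : ℕ} (i j : Idx n) : Uq n := RingQuot.mkAlgHom Kq (URel n) (freeL i j)

theorem Lgen_mem {n : ℕ} (i j : Idx n) : Lgen i j ∈ Ugr n (par i + par j) :=
  ⟨_, freeL_mem i j, rfl⟩

theorem Lgen_of_not_le {n : ℕ} {i j : Idx n} (h : ¬ i ≤ j) : Lgen i j = 0 := by
  simp [Lgen, freeL, h]

section Maps

variable {n : ℕ} {B C : Type*} [Ring B] [Algebra Kq B] [Ring C] [Algebra Kq C]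

theorem map_LLS (f : B →ₐ[Kq] C) (M : Idx n → Idx n → B) (i j k l : Idx n) :
    f (LLS M i j k l) = LLS (fun i j => f (M i j)) i j k l := by
  simp [LLS, map_sum, map_smul, map_mul]

theorem map_SLL (f : B →ₐ[Kq] C) (M : Idx n → Idx n → B) (i j k l : Idx n) :
    f (SLL M i j k l) = SLL (fun i j => f (M i j)) i j k l := by
  simp [SLL, map_sum, map_smul, map_mul]

theorem Lgen_SLL (i j k l : Idx n) : LLS (Lgen (n := n)) i j k l = SLL Lgen i j k l := by
  have := RingQuot.mkAlgHom_rel Kq (URel.sll i j k l)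
  rwa [map_LLS, map_SLL] at this

theorem Lgen_inv (i : Idx n) : Lgen i i * Lgen (-i) (-i) = 1 := by
  simpa [Lgen] using RingQuot.mkAlgHom_rel Kq (URel.inv i)

theorem lift_freeL (M : Idx n → Idx n → B) (h0 : ∀ i j, ¬ i ≤ j → M i j = 0) (i j : Idx n) :
    FreeAlgebra.lift Kq (fun x : UGen n => M x.1.1 x.1.2) (freeL i j) = M i j := by
  unfold freeL
  split_ifs with h
  · simp
  · simp [h0 i j h]

/-- The homomorphism out of `U_q(𝔮_n)` given by an upper triangular matrix that satisfies the
defining relations. -/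
noncomputable def Ulift (M : Idx n → Idx n → B) (h0 : ∀ i j, ¬ i ≤ j → M i j = 0)
    (hinv : ∀ i, M i i * M (-i) (-i) = 1) (hsll : ∀ i j k l, LLS M i j k l = SLL M i j k l) :
    Uq n →ₐ[Kq] B :=
  RingQuot.liftAlgHom Kq ⟨FreeAlgebra.lift Kq fun x : UGen n => M x.1.1 x.1.2, by
    intro x y h
    cases h with
    | inv i => rw [map_mul, lift_freeL M h0, lift_freeL M h0, hinv, map_one]
    | sll i j k l =>
      rw [map_LLS, map_SLL]
      simp only [lift_freeL M h0]
      exact hsll i j k l⟩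

theorem Ulift_Lgen (M : Idx n → Idx n → B) (h0 : ∀ i j, ¬ i ≤ j → M i j = 0)
    (hinv : ∀ i, M i i * M (-i) (-i) = 1) (hsll : ∀ i j k l, LLS M i j k l = SLL M i j k l)
    (i j : Idx n) : Ulift M h0 hinv hsll (Lgen i j) = M i j := by
  rw [Ulift, Lgen, RingQuot.liftAlgHom_mkAlgHom_apply, lift_freeL M h0]

/-- The matrix product `(M ⊗ N)_{ij} = ∑_k (-1)^{(|i|+|k|)(|k|+|j|)} M_{ik} N_{kj}`. -/
noncomputable def matMul (M N : Idx n → Idx n → B) (i j : Idx n) : B :=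
  ∑ k, sgn ((par i + par k) * (par k + par j)) • (M i k * N k j)

theorem sgn_mul_self (d : ZMod 2) : sgn d * sgn d = 1 := by
  rw [← sgn_add, CharTwo.add_self_eq_zero, sgn_zero]

theorem sum_sum_comm' {α D : Type*} [Fintype α] [AddCommMonoid D] (f : α → α → α → α → D) :
    ∑ a, ∑ b, ∑ c, ∑ d, f a b c d = ∑ c, ∑ d, ∑ a, ∑ b, f a b c d := by
  calc _ = ∑ a, ∑ c, ∑ b, ∑ d, f a b c d := Finset.sum_congr rfl fun a _ => Finset.sum_comm
    _ = ∑ c, ∑ a, ∑ b, ∑ d, f a b c d := Finset.sum_comm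
    _ = ∑ c, ∑ a, ∑ d, ∑ b, f a b c d :=
      Finset.sum_congr rfl fun c _ => Finset.sum_congr rfl fun a _ => Finset.sum_comm
    _ = _ := Finset.sum_congr rfl fun c _ => Finset.sum_comm

theorem matMul_LLS (M N : Idx n → Idx n → B)
    (hc : ∀ i j k l, N i j * M k l = sgn ((par i + par j) * (par k + par l)) • (M k l * N i j))
    (hM : ∀ i j k l, LLS M i j k l = SLL M i j k l)
    (hN : ∀ i j k l, LLS N i j k l = SLL N i j k l) (i j k l : Idx n) :
    LLS (matMul M N) i j k l = SLL (matMul M N) i j k l := by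
  have hA : ∀ a b c d e f g h : Idx n, M a b * N c d * (M e f * N g h) =
      sgn ((par c + par d) * (par e + par f)) • (M a b * M e f * (N c d * N g h)) := by
    intro a b c d e f g h
    rw [mul_assoc, ← mul_assoc (N c d), hc]
    simp only [smul_mul_assoc, mul_smul_comm, mul_assoc]
  have hS : ∀ (x y : ZMod 2) (a b c d : Idx n) (X : B),
      (par a + par b + par c + par d = 0 → x = y) →
      (sgn x * Smat a b c d) • X = (sgn y * Smat a b c d) • X := by
    intro x y a b c d X h
    by_cases h0 : Smat a b c d = 0
    · simp [h0]
    · rw [h (Smat_parity h0)]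
  let F (m p : Idx n) : ZMod 2 := par k * (par i + par j) + (par i + par m) * par m +
    (par k + par p) * par p + par m * (par k + par p) + par p * (par m + par j) +
    (par l + par j) * (par i + par m + par k + par p)
  let G (m p : Idx n) : ZMod 2 := par p + par m + par m * par p + par l * par p + par l * par m +
    par k * par p + par k * par l + par j * par m + par i * par p + par i * par m +
    par i * par l + par i * par j
  have hF : ∀ i j k l m p a b : ZMod 2, a + j + b + l = 0 →
      (i + a) * (k + b) + (k + b) * (a + j) + (k + p) * (p + b) + (i + m) * (m + a) +
        (m + a) * (k + p) =
      (k * (i + j) + (i + m) * m + (k + p) * p + m * (k + p) + p * (m + j) +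
        (l + j) * (i + m + k + p)) + (m + a) * (p + b) + (p + b) * (a + j) := by decide
  have hG : ∀ i j k l m p a b : ZMod 2, m + a + p + b = 0 →
      (k * (i + j) + (i + m) * m + (k + p) * p + m * (k + p) + p * (m + j) +
        (l + j) * (i + m + k + p)) + (p + b) * (a + j) =
      (b + a + a * b + l * b + l * a + k * b + k * l + j * a + i * b + i * a + i * l + i * j) +
        (i + m) * (k + p) + (k + p) * (m + a) := by decide
  have hH : ∀ i j k l m p a b : ZMod 2, i + a + k + b = 0 →
      (p + m + m * p + l * p + l * m + k * p + k * l + j * m + i * p + i * m + i * l + i * j) +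
        (k + b) * (a + m) =
      (k + b) * (a + j) + (a + m) * (m + j) + (b + p) * (p + l) + (p + l) * (a + m) := by decide
  calc LLS (matMul M N) i j k l
      = ∑ m, ∑ p, sgn (F m p) • (M i m * M k p * LLS N m j p l) := by
        simp only [LLS, matMul, Finset.mul_sum, Finset.sum_mul, Finset.smul_sum,
          smul_mul_assoc, mul_smul_comm, smul_smul, hA]
        rw [sum_sum_comm']
        rw [Finset.sum_comm]
        refine Finset.sum_congr rfl fun m _ => Finset.sum_congr rfl fun p _ =>
          Finset.sum_congr rfl fun a _ => Finset.sum_congr rfl fun b _ => ?_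
        have key := hS _ _ a j b l (M i m * M k p * (N m a * N p b))
          (hF (par i) (par j) (par k) (par l) (par m) (par p) (par a) (par b))
        simp only [F, sgn_add] at key ⊢
        convert key using 2 <;> ring
    _ = ∑ m, ∑ p, sgn (F m p) • (M i m * M k p * SLL N m j p l) := by simp only [hN]
    _ = ∑ m, ∑ p, sgn (G m p) • (LLS M i m k p * (N p l * N m j)) := by
        simp only [LLS, SLL, Finset.mul_sum, Finset.sum_mul, Finset.smul_sum,
          smul_mul_assoc, mul_smul_comm, smul_smul]
        rw [sum_sum_comm']
        refine Finset.sum_congr rfl fun a _ => Finset.sum_congr rfl fun b _ =>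
          Finset.sum_congr rfl fun m _ => Finset.sum_congr rfl fun p _ => ?_
        have key := hS _ _ m a p b (M i m * M k p * (N b l * N a j))
          (hG (par i) (par j) (par k) (par l) (par m) (par p) (par a) (par b))
        simp only [F, G, sgn_add] at key ⊢
        convert key using 2 <;> ring
    _ = ∑ m, ∑ p, sgn (G m p) • (SLL M i m k p * (N p l * N m j)) := by simp only [hM]
    _ = SLL (matMul M N) i j k l := by
        simp only [SLL, matMul, Finset.mul_sum, Finset.sum_mul, Finset.smul_sum,
          smul_mul_assoc, mul_smul_comm, smul_smul, hA]
        rw [sum_sum_comm']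
        refine Finset.sum_congr rfl fun a _ => Finset.sum_congr rfl fun b _ =>
          Finset.sum_congr rfl fun m _ => Finset.sum_congr rfl fun p _ => ?_
        have key := hS _ _ i a k b (M b p * M a m * (N p l * N m j))
          (hH (par i) (par j) (par k) (par l) (par m) (par p) (par a) (par b))
        simp only [G, sgn_add] at key ⊢
        convert key using 2 <;> ring

end Maps

theorem include_comm {n : ℕ} (i j k l : Idx n) :
    GradedTensorProduct.includeRight (Ugr n) (Ugr n) (Lgen i j) *
      GradedTensorProduct.includeLeft (Ugr n) (Ugr n) (Lgen k l) =
    sgn ((par i + par j) * (par k + par l)) •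
      (GradedTensorProduct.includeLeft (Ugr n) (Ugr n) (Lgen k l) *
        GradedTensorProduct.includeRight (Ugr n) (Ugr n) (Lgen i j)) := by
  have h := GradedTensorProduct.tmul_coe_mul_coe_tmul (R := Kq) (𝒜 := Ugr n) (ℬ := Ugr n)
    (1 : Uq n) (⟨Lgen i j, Lgen_mem i j⟩ : Ugr n _) (⟨Lgen k l, Lgen_mem k l⟩ : Ugr n _) (1 : Uq n)
  rw [one_mul, mul_one, Units.smul_def, ← Int.cast_smul_eq_zsmul Kq, ← sgn_eq_zsmul] at h
  refine h.trans ?_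
  congr 1
  exact (GradedTensorProduct.tmul_one_mul_one_tmul _ _ _ _).symm

/-- The matrix `∑_k (-1)^{(|i|+|k|)(|k|+|j|)} L_{ik} ⊗ L_{kj}` over `U_q(𝔮_n) ⊗ U_q(𝔮_n)`. -/
noncomputable def comulMat {n : ℕ} : Idx n → Idx n → (Ugr n) ᵍ⊗[Kq] (Ugr n) :=
  matMul (fun i j => GradedTensorProduct.includeLeft (Ugr n) (Ugr n) (Lgen i j))
    (fun i j => GradedTensorProduct.includeRight (Ugr n) (Ugr n) (Lgen i j))

theorem comulMat_of_not_le {n : ℕ} (i j : Idx n) (h : ¬ i ≤ j) : comulMat i j = 0 := by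
  rw [comulMat, matMul]
  refine Finset.sum_eq_zero fun k _ => ?_
  by_cases h1 : i ≤ k
  · simp only [Lgen_of_not_le (i := k) (j := j) fun h2 => h (h1.trans h2), map_zero, mul_zero,
      smul_zero]
  · simp only [Lgen_of_not_le h1, map_zero, zero_mul, smul_zero]

theorem comulMat_self {n : ℕ} (i : Idx n) : comulMat i i =
    GradedTensorProduct.includeLeft (Ugr n) (Ugr n) (Lgen i i) *
      GradedTensorProduct.includeRight (Ugr n) (Ugr n) (Lgen i i) := by
  rw [comulMat, matMul, Finset.sum_eq_single i]
  · rw [CharTwo.add_self_eq_zero, zero_mul, sgn_zero, one_smul]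
  · intro k _ hk
    by_cases h1 : i ≤ k
    · simp only [Lgen_of_not_le (i := k) (j := i) fun h2 => hk (le_antisymm h2 h1), map_zero,
        mul_zero, smul_zero]
    · simp only [Lgen_of_not_le h1, map_zero, zero_mul, smul_zero]
  · simp

theorem comulMat_inv {n : ℕ} (i : Idx n) : comulMat i i * comulMat (-i) (-i) = 1 := by
  rw [comulMat_self, comulMat_self, mul_assoc,
    ← mul_assoc (GradedTensorProduct.includeRight _ _ _), include_comm,
    CharTwo.add_self_eq_zero, zero_mul, sgn_zero, one_smul, mul_assoc,
    ← mul_assoc, ← map_mul, ← map_mul, Lgen_inv, map_one, map_one, one_mul]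

theorem comulMat_sll {n : ℕ} (i j k l : Idx n) :
    LLS (comulMat (n := n)) i j k l = SLL comulMat i j k l :=
  matMul_LLS _ _ (fun i j k l => include_comm i j k l)
    (fun i j k l => by rw [← map_LLS, ← map_SLL, Lgen_SLL])
    (fun i j k l => by rw [← map_LLS, ← map_SLL, Lgen_SLL]) i j k l

/-- The comultiplication `Δ(L) = L ⊗ L`, that is
`Δ(L_{ij}) = ∑_k (-1)^{(|i|+|k|)(|k|+|j|)} L_{ik} ⊗ L_{kj}`, a homomorphism into the tensor product
of superalgebras `U_q(𝔮_n) ⊗ U_q(𝔮_n)`; see `comul_Lgen`. -/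
noncomputable def comul (n : ℕ) : Uq n →ₐ[Kq] (Ugr n) ᵍ⊗[Kq] (Ugr n) :=
  Ulift comulMat comulMat_of_not_le comulMat_inv comulMat_sll

theorem comul_Lgen {n : ℕ} (i j : Idx n) :
    comul n (Lgen i j) = ∑ k, sgn ((par i + par k) * (par k + par j)) •
      GradedTensorProduct.of Kq (Ugr n) (Ugr n) (Lgen i k ⊗ₜ[Kq] Lgen k j) := by
  rw [comul, Ulift_Lgen, comulMat, matMul]
  refine Finset.sum_congr rfl fun k _ => ?_
  congr 1
  exact GradedTensorProduct.tmul_one_mul_one_tmul _ _ _ _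

/-- The counit `ε(L) = 1`, that is `ε(L_{ij}) = δ_{ij}`. -/
noncomputable def counit (n : ℕ) : Uq n →ₐ[Kq] Kq :=
  Ulift (fun i j => if i = j then 1 else 0)
    (by intro i j h; exact if_neg fun h' => h h'.le)
    (by intro i; simp)
    (by
      intro i j k l
      have h2 : ∀ x : ZMod 2, x + x = 0 := by decide
      simp [LLS, SLL, h2])

/-- `Δ` as a linear map into the plain tensor product. -/
noncomputable def comulLin (n : ℕ) : Uq n →ₗ[Kq] Uq n ⊗[Kq] Uq n :=
  (GradedTensorProduct.of Kq (Ugr n) (Ugr n)).symm.toLinearMap ∘ₗ (comul n).toLinearMap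

/-! ### Supermodule superalgebras -/

/-- The linear map `u ↦ (-1)^{e|u|} u` on `U_q(𝔮_n)`. -/
noncomputable def superSign (n : ℕ) (e : ZMod 2) : Uq n →ₗ[Kq] Uq n :=
  ∑ d : ZMod 2, sgn (e * d) • GradedAlgebra.proj (Ugr n) d

section Supermodule

variable {n : ℕ} {M M' : Type*} [AddCommGroup M] [Module Kq M] [AddCommGroup M'] [Module Kq M']

/-- `M = M_0 ⊕ M_1` is a `U_q(𝔮_n)`-supermodule under the action `Φ`. -/
structure IsSupermodule (gr : ZMod 2 → Submodule Kq M) (Φ : Uq n →ₗ[Kq] Module.End Kq M) :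
    Prop where
  internal : DirectSum.IsInternal gr
  map_one : Φ 1 = 1
  map_mul : ∀ u v, Φ (u * v) = Φ u * Φ v
  act_mem : ∀ (d e : ZMod 2), ∀ u ∈ Ugr n d, ∀ x ∈ gr e, Φ u x ∈ gr (d + e)

/-- `M`, with unit `one` and multiplication `mul`, is a unital associative superalgebra and a
`U_q(𝔮_n)`-supermodule such that `u.(ab) = ∑ (-1)^{|u₂||a|} (u₁.a)(u₂.b)` and `u.1 = ε(u) 1`. -/
structure IsSupermoduleSuperalgebra (gr : ZMod 2 → Submodule Kq M) (one : M)
    (mul : M ⊗[Kq] M →ₗ[Kq] M) (Φ : Uq n →ₗ[Kq] Module.End Kq M) : Prop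
    extends IsSupermodule gr Φ where
  one_mul : ∀ a, mul (one ⊗ₜ a) = a
  mul_one : ∀ a, mul (a ⊗ₜ one) = a
  mul_assoc : ∀ a b c, mul (mul (a ⊗ₜ b) ⊗ₜ c) = mul (a ⊗ₜ mul (b ⊗ₜ c))
  one_mem : one ∈ gr 0
  mul_mem : ∀ (d e : ZMod 2), ∀ a ∈ gr d, ∀ b ∈ gr e, mul (a ⊗ₜ b) ∈ gr (d + e)
  act_mul : ∀ (u : Uq n) (d : ZMod 2), ∀ a ∈ gr d, ∀ b,
    Φ u (mul (a ⊗ₜ b)) =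
      mul (TensorProduct.map (Φ.flip a) (Φ.flip b ∘ₗ superSign n d) (comulLin n u))
  act_one : ∀ u, Φ u one = counit n u • one

/-- `f` is an even homomorphism of `U_q(𝔮_n)`-supermodules. -/
structure IsSupermoduleHom (gr : ZMod 2 → Submodule Kq M) (Φ : Uq n →ₗ[Kq] Module.End Kq M)
    (gr' : ZMod 2 → Submodule Kq M') (Φ' : Uq n →ₗ[Kq] Module.End Kq M') (f : M →ₗ[Kq] M') :
    Prop where
  even : ∀ (d : ZMod 2), ∀ x ∈ gr d, f x ∈ gr' d
  equivariant : ∀ u x, f (Φ u x) = Φ' u (f x)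

/-- `f` is an isomorphism of `U_q(𝔮_n)`-supermodule superalgebras. -/
structure IsSupermoduleSuperalgebraIso
    (gr : ZMod 2 → Submodule Kq M) (one : M) (mul : M ⊗[Kq] M →ₗ[Kq] M)
    (Φ : Uq n →ₗ[Kq] Module.End Kq M)
    (gr' : ZMod 2 → Submodule Kq M') (one' : M') (mul' : M' ⊗[Kq] M' →ₗ[Kq] M')
    (Φ' : Uq n →ₗ[Kq] Module.End Kq M') (f : M →ₗ[Kq] M') : Prop
    extends IsSupermoduleHom gr Φ gr' Φ' f where
  source : IsSupermoduleSuperalgebra gr one mul Φ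
  target : IsSupermoduleSuperalgebra gr' one' mul' Φ'
  bijective : Function.Bijective f
  map_one : f one = one'
  map_mul : ∀ a b, f (mul (a ⊗ₜ b)) = mul' (f a ⊗ₜ f b)

end Supermodule

section Tensor

variable {A B : Type*} [Ring A] [Algebra Kq A] [Ring B] [Algebra Kq B]
  (grA : ZMod 2 → Submodule Kq A) (grB : ZMod 2 → Submodule Kq B)

/-- The parity of a tensor product of superspaces. -/
noncomputable def tensorGrading (d : ZMod 2) : Submodule Kq (A ⊗[Kq] B) :=
  Submodule.span Kq {z | ∃ e f : ZMod 2, e + f = d ∧ ∃ x ∈ grA e, ∃ y ∈ grB f, z = x ⊗ₜ[Kq] y}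

/-- The action of `U_q(𝔮_n)` on a tensor product,
`u.(x ⊗ y) = ∑ (-1)^{|u₂||x|} u₁.x ⊗ u₂.y`: for each parity `e`, the summand for `e` sends `x ⊗ y`
to `∑ u₁.x_e ⊗ (-1)^{e|u₂|} u₂.y`, where `x_e` is the component of `x` of parity `e`. -/
noncomputable def tensorAction [GradedAlgebra grA] {n : ℕ} (Φ : Uq n →ₗ[Kq] Module.End Kq A)
    (Ψ : Uq n →ₗ[Kq] Module.End Kq B) : Uq n →ₗ[Kq] Module.End Kq (A ⊗[Kq] B) :=
  ∑ e : ZMod 2, (TensorProduct.homTensorHomMap (RingHom.id Kq) A B A B) ∘ₗ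
    (TensorProduct.map (LinearMap.lcomp Kq A (GradedAlgebra.proj grA e) ∘ₗ Φ)
      (Ψ ∘ₗ superSign n e)) ∘ₗ comulLin n

/-- The braided multiplication `(mul ⊗ mul)(1 ⊗ Θ ⊗ 1)` on `A ⊗ B`. -/
noncomputable def braidedMul (Θ : B ⊗[Kq] A →ₗ[Kq] A ⊗[Kq] B) :
    (A ⊗[Kq] B) ⊗[Kq] (A ⊗[Kq] B) →ₗ[Kq] A ⊗[Kq] B :=
  TensorProduct.map (LinearMap.mul' Kq A) (LinearMap.mul' Kq B) ∘ₗ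
    (TensorProduct.tensorTensorTensorAssoc Kq A A B B).symm.toLinearMap ∘ₗ
    (Θ.lTensor A).rTensor B ∘ₗ
    (TensorProduct.tensorTensorTensorAssoc Kq A B A B).toLinearMap

end Tensor

/-! ### Quantum coordinate superalgebras -/

/-- The coefficient of `E_{ia} ⊗ E_{jb}` in `S^{12} T^{1[3]} T^{2[3]}`, for a matrix `T` over a
superalgebra `B` with entries `T i a` of parity `|i| + |a|`. The signs come from
* `(E_{i'a} ⊗ 1 ⊗ T_{i'a})(1 ⊗ E_{j'b} ⊗ T_{j'b})
    = (-1)^{(|i'|+|a|)(|j'|+|b|)} E_{i'a} ⊗ E_{j'b} ⊗ T_{i'a} T_{j'b}`,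
* `(E_{ii'} ⊗ E_{jj'})(E_{i'a} ⊗ E_{j'b}) = (-1)^{(|j|+|j'|)(|i'|+|a|)} E_{ia} ⊗ E_{jb}`. -/
noncomputable def STT {r n : ℕ} {B : Type*} [Ring B] [Algebra Kq B] (T : Idx r → Idx n → B)
    (i : Idx r) (a : Idx n) (j : Idx r) (b : Idx n) : B :=
  ∑ i', ∑ j', (sgn ((par j + par j') * (par i' + par a)) *
    sgn ((par i' + par a) * (par j' + par b)) * Smat i i' j j') • (T i' a * T j' b)

/-- The coefficient of `E_{ia} ⊗ E_{jb}` in `T^{2[3]} T^{1[3]} S^{12}`. Here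
* `(1 ⊗ E_{jb'} ⊗ T_{jb'})(E_{ia'} ⊗ 1 ⊗ T_{ia'}) = E_{ia'} ⊗ E_{jb'} ⊗ T_{jb'} T_{ia'}`,
* `(E_{ia'} ⊗ E_{jb'})(E_{a'a} ⊗ E_{b'b}) = (-1)^{(|j|+|b'|)(|a'|+|a|)} E_{ia} ⊗ E_{jb}`,
and the even element `S` passes the entries of `T` without a sign. -/
noncomputable def TTS {r n : ℕ} {B : Type*} [Ring B] [Algebra Kq B] (T : Idx r → Idx n → B)
    (i : Idx r) (a : Idx n) (j : Idx r) (b : Idx n) : B :=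
  ∑ a', ∑ b', (sgn ((par j + par b') * (par a' + par a)) * Smat a' a b' b) • (T j b' * T i a')

/-- The generator `t_{ia}` has parity `|i| + |a|`. -/
def apar {r n : ℕ} (x : Idx r × Idx n) : ZMod 2 := par x.1 + par x.2

/-- The free generators `t_{ia}`, `i ∈ I_{r|r}`, `a ∈ I_{n|n}`. -/
noncomputable def freeT {r n : ℕ} (i : Idx r) (a : Idx n) : FreeAlgebra Kq (Idx r × Idx n) :=
  FreeAlgebra.ι Kq (i, a)

/-- The defining relations of `A_{r,n}`: `t_{ia} = t_{-i,-a}` and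
`S^{12} T^{1[3]} T^{2[3]} = T^{2[3]} T^{1[3]} S^{12}`. -/
inductive ARel (r n : ℕ) :
    FreeAlgebra Kq (Idx r × Idx n) → FreeAlgebra Kq (Idx r × Idx n) → Prop
  | neg (i : Idx r) (a : Idx n) : ARel r n (freeT i a) (freeT (-i) (-a))
  | rtt (i : Idx r) (a : Idx n) (j : Idx r) (b : Idx n) :
      ARel r n (STT freeT i a j b) (TTS freeT i a j b)

/-- The quantum coordinate superalgebra `A_{r,n}`. -/
abbrev Acoord (r n : ℕ) : Type := RingQuot (ARel r n)

/-- The parity of `A_{r,n}`. -/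
noncomputable abbrev Agr (r n : ℕ) : ZMod 2 → Submodule Kq (Acoord r n) :=
  presGrading apar (ARel r n)

theorem freeT_mem {r n : ℕ} (i : Idx r) (a : Idx n) :
    freeT i a ∈ freeGrading apar (par i + par a) :=
  ι_mem_freeGrading (p := apar) (i, a)

theorem ARel_homogeneous (r n : ℕ) (x y : FreeAlgebra Kq (Idx r × Idx n)) (h : ARel r n x y) :
    ∃ d, x ∈ freeGrading apar d ∧ y ∈ freeGrading apar d := by
  cases h with
  | neg i a =>
    refine ⟨par i + par a, freeT_mem i a, ?_⟩
    have h0 : ∀ a b : ZMod 2, a + b = a + 1 + (b + 1) := by decide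
    rw [h0 (par i) (par a), ← par_neg, ← par_neg]
    exact freeT_mem _ _
  | rtt i a j b =>
    refine ⟨par i + par a + par j + par b, ?_, ?_⟩
    · refine Submodule.sum_mem _ fun i' _ => Submodule.sum_mem _ fun j' _ => ?_
      refine smul_mem_of_ne_zero (mul_mem_freeGrading (freeT_mem _ _) (freeT_mem _ _)) fun h => ?_
      have := Smat_parity (right_ne_zero_of_mul h)
      revert this
      generalize par i = x; generalize par j = y; generalize par a = z; generalize par b = w
      generalize par i' = u; generalize par j' = v
      revert x y z w u v; decide
    · refine Submodule.sum_mem _ fun a' _ => Submodule.sum_mem _ fun b' _ => ?_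
      refine smul_mem_of_ne_zero (mul_mem_freeGrading (freeT_mem _ _) (freeT_mem _ _)) fun h => ?_
      have := Smat_parity (right_ne_zero_of_mul h)
      revert this
      generalize par i = x; generalize par j = y; generalize par a = z; generalize par b = w
      generalize par a' = u; generalize par b' = v
      revert x y z w u v; decide

noncomputable instance (r n : ℕ) : GradedAlgebra (Agr r n) :=
  presGradedAlgebra (ARel r n) (ARel_homogeneous r n)

/-- The generators `t_{ia}` of `A_{r,n}`. -/
noncomputable def tgen {r n : ℕ} (i : Idx r) (a : Idx n) : Acoord r n :=
  RingQuot.mkAlgHom Kq (ARel r n) (freeT i a)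

section MapsA

variable {r n : ℕ} {B C : Type*} [Ring B] [Algebra Kq B] [Ring C] [Algebra Kq C]

theorem map_STT (f : B →ₐ[Kq] C) (T : Idx r → Idx n → B) (i : Idx r) (a : Idx n) (j : Idx r)
    (b : Idx n) : f (STT T i a j b) = STT (fun i a => f (T i a)) i a j b := by
  simp [STT, map_sum, map_smul, map_mul]

theorem map_TTS (f : B →ₐ[Kq] C) (T : Idx r → Idx n → B) (i : Idx r) (a : Idx n) (j : Idx r)
    (b : Idx n) : f (TTS T i a j b) = TTS (fun i a => f (T i a)) i a j b := by
  simp [TTS, map_sum, map_smul, map_mul]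

theorem tgen_neg (i : Idx r) (a : Idx n) : tgen i a = tgen (-i) (-a) :=
  RingQuot.mkAlgHom_rel Kq (ARel.neg i a)

theorem tgen_STT (i : Idx r) (a : Idx n) (j : Idx r) (b : Idx n) :
    STT (tgen (r := r) (n := n)) i a j b = TTS tgen i a j b := by
  have := RingQuot.mkAlgHom_rel Kq (ARel.rtt i a j b)
  rwa [map_STT, map_TTS] at this

end MapsA

/-! ### The embeddings `ι_p` -/

section Shift

variable {r m : ℕ} (p : ℕ) (h : p + r ≤ m)

/-- The map `I_{r|r} → I_{m|m}` with `i ↦ p + i` and `-i ↦ -(p + i)` for `i = 1, …, r`. -/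
def shift (i : Idx r) : Idx m :=
  ⟨if 0 < i.1 then p + i.1 else -(p + -i.1), by
    have h := i.2
    simp only [Finset.mem_erase, Finset.mem_Icc] at h ⊢
    split_ifs <;> omega⟩

theorem shift_val (i : Idx r) : (shift p h i).1 = if 0 < i.1 then p + i.1 else -(p + -i.1) := rfl

theorem idx_ne_zero {n : ℕ} (i : Idx n) : i.1 ≠ 0 := (Finset.mem_erase.1 i.2).1

theorem shift_neg (i : Idx r) : shift p h (-i) = -shift p h i := by
  have := idx_ne_zero i
  apply Subtype.ext
  simp only [shift_val, neg_val]
  split_ifs <;> omega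

theorem par_shift (i : Idx r) : par (shift p h i) = par i := by
  have := idx_ne_zero i
  have h1 : 0 < (shift p h i).1 ↔ 0 < i.1 := by
    rw [shift_val]; split_ifs <;> omega
  simp only [par, h1]

theorem shift_lt (i j : Idx r) : shift p h i < shift p h j ↔ i < j := by
  have := idx_ne_zero i
  have := idx_ne_zero j
  rw [← Subtype.coe_lt_coe, ← Subtype.coe_lt_coe, shift_val, shift_val]
  split_ifs <;> omega

theorem shift_inj (i j : Idx r) : shift p h i = shift p h j ↔ i = j := by
  have := idx_ne_zero i
  have := idx_ne_zero j
  rw [Subtype.ext_iff, Subtype.ext_iff, shift_val, shift_val]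
  split_ifs <;> omega

theorem phi_shift (i j : Idx r) : phi (shift p h i) (shift p h j) = phi i j := by
  have := idx_ne_zero j
  have h1 : 0 < (shift p h j).1 ↔ 0 < j.1 := by
    rw [shift_val]; split_ifs <;> omega
  simp only [phi, h1, ← shift_neg, shift_inj]

theorem Smat_shift (i i' j j' : Idx r) :
    Smat (shift p h i) (shift p h i') (shift p h j) (shift p h j') = Smat i i' j j' := by
  simp only [Smat, phi_shift, par_shift, ← shift_neg, shift_inj, shift_lt]

theorem Smat_shift_eq_zero (i j : Idx r) (x y : Idx m)
    (hxy : x ∉ Set.range (shift p h) ∨ y ∉ Set.range (shift p h)) :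
    Smat (shift p h i) x (shift p h j) y = 0 := by
  have key : ∀ z w : Idx m, z = -w → w ∈ Set.range (shift p h) → z ∈ Set.range (shift p h) := by
    rintro z w rfl ⟨v, rfl⟩
    exact ⟨-v, shift_neg p h v⟩
  have hi : shift p h i ∈ Set.range (shift p h) := ⟨i, rfl⟩
  have hj : shift p h j ∈ Set.range (shift p h) := ⟨j, rfl⟩
  unfold Smat
  rw [if_neg, if_neg (c := _ ∧ _), if_neg (c := _ ∧ _)]
  · simp
  · rintro ⟨h1, h2⟩
    have h3 : y = -shift p h i := by rw [h1, neg_neg']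
    exact hxy.elim (fun hx => hx (key _ _ h2 hj)) (fun hy => hy (key _ _ h3 hi))
  · rintro ⟨h1, h2⟩
    exact hxy.elim (fun hx => hx (h2 ▸ hj)) (fun hy => hy (h1 ▸ hi))
  · rintro ⟨h1, h2⟩
    exact hxy.elim (fun hx => hx (h1 ▸ hi)) (fun hy => hy (h2 ▸ hj))

theorem STT_shift {n : ℕ} {B : Type*} [Ring B] [Algebra Kq B] (T : Idx m → Idx n → B)
    (i : Idx r) (a : Idx n) (j : Idx r) (b : Idx n) :
    STT (fun i a => T (shift p h i) a) i a j b = STT T (shift p h i) a (shift p h j) b := by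
  have hinj : Function.Injective (shift p h) := fun i j hij => (shift_inj p h i j).1 hij
  unfold STT
  refine Fintype.sum_of_injective _ hinj _ _ (fun x hx => ?_) fun i' => ?_
  · refine Finset.sum_eq_zero fun y _ => ?_
    rw [Smat_shift_eq_zero p h i j x y (Or.inl hx), mul_zero, zero_smul]
  · refine Fintype.sum_of_injective _ hinj _ _ (fun y hy => ?_) fun j' => ?_
    · rw [Smat_shift_eq_zero p h i j _ y (Or.inr hy), mul_zero, zero_smul]
    · simp only [par_shift, Smat_shift]

/-- The homomorphism `ι_p : A_{r,n} → A_{m,n}`, `t_{ia} ↦ t_{p+i,a}` for `i = 1, …, r` (hence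
`t_{-i,a} ↦ t_{-(p+i),a}`), where `p + r ≤ m`. -/
noncomputable def iota (n : ℕ) : Acoord r n →ₐ[Kq] Acoord m n :=
  RingQuot.liftAlgHom Kq
    ⟨FreeAlgebra.lift Kq fun x : Idx r × Idx n => tgen (shift p h x.1) x.2, by
      intro x y hxy
      cases hxy with
      | neg i a =>
        simp only [freeT, FreeAlgebra.lift_ι_apply, shift_neg]
        exact tgen_neg _ _
      | rtt i a j b =>
        rw [map_STT, map_TTS]
        simp only [freeT, FreeAlgebra.lift_ι_apply]
        rw [STT_shift p h tgen, tgen_STT]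
        simp only [TTS, par_shift]⟩

theorem iota_tgen {n : ℕ} (i : Idx r) (a : Idx n) :
    iota p h n (tgen i a) = tgen (shift p h i) a := by
  rw [iota, tgen, RingQuot.liftAlgHom_mkAlgHom_apply, freeT, FreeAlgebra.lift_ι_apply]

end Shift

/-! ### The action on `A_{r,n}`, the braiding and the map `σ` -/

/-- `Φ` makes `A_{r,n}` a `U_q(𝔮_n)`-supermodule superalgebra and satisfies
`L^{[2]3} · T^{1[2]} = T^{1[2]} S^{13}`, that is
`∑ (-1)^{(|a|+|b|)(|i|+|c|)} E_{ic} ⊗ Φ_{L_{ab}}(t_{ic}) ⊗ E_{ab} = T^{1[2]} S^{13}`,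
where `(E_{id} ⊗ t_{id} ⊗ 1)(E_{dc} ⊗ 1 ⊗ E_{ab}) = (-1)^{(|i|+|d|)(|d|+|c|)} E_{ic} ⊗ t_{id} ⊗ E_{ab}`. -/
structure IsCoordAction (r n : ℕ) (Φ : Uq n →ₗ[Kq] Module.End Kq (Acoord r n)) : Prop where
  supermoduleSuperalgebra :
    IsSupermoduleSuperalgebra (Agr r n) 1 (LinearMap.mul' Kq (Acoord r n)) Φ
  act_tgen : ∀ (a b c : Idx n) (i : Idx r),
    sgn ((par a + par b) * (par i + par c)) • Φ (Lgen a b) (tgen i c) =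
      ∑ d, (sgn ((par i + par d) * (par d + par c)) * Smat d c a b) • tgen i d

/-- `Θ : A_{k,n} ⊗ A_{r,n} → A_{r,n} ⊗ A_{k,n}` is a homomorphism of `U_q(𝔮_n)`-supermodules (for
actions `Φr` and `Φk` on `A_{r,n}` and `A_{k,n}`) compatible with the multiplications and the units,
and `Θ(T_k^{1[3]} T_r^{2[4]}) = T_r^{2[3]} T_k^{1[4]} S^{12}` for the generator matrices with rows
`1, …, k` and `1, …, r`. In the last equation
* `(E_{jb} ⊗ 1 ⊗ t_{jb} ⊗ 1)(1 ⊗ E_{ia} ⊗ 1 ⊗ t_{ia})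
    = (-1)^{(|j|+|b|)(|i|+|a|)} E_{jb} ⊗ E_{ia} ⊗ t_{jb} ⊗ t_{ia}`,
* `(1 ⊗ E_{ia'} ⊗ t_{ia'} ⊗ 1)(E_{jb'} ⊗ 1 ⊗ 1 ⊗ t_{jb'}) = E_{jb'} ⊗ E_{ia'} ⊗ t_{ia'} ⊗ t_{jb'}`,
* `(E_{jb'} ⊗ E_{ia'})(E_{b'b} ⊗ E_{a'a}) = (-1)^{(|i|+|a'|)(|b'|+|b|)} E_{jb} ⊗ E_{ia}`. -/
structure IsBraiding (r k n : ℕ) (Φr : Uq n →ₗ[Kq] Module.End Kq (Acoord r n))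
    (Φk : Uq n →ₗ[Kq] Module.End Kq (Acoord k n))
    (Θ : Acoord k n ⊗[Kq] Acoord r n →ₗ[Kq] Acoord r n ⊗[Kq] Acoord k n) : Prop where
  supermoduleHom : IsSupermoduleHom
    (tensorGrading (Agr k n) (Agr r n)) (tensorAction (Agr k n) Φk Φr)
    (tensorGrading (Agr r n) (Agr k n)) (tensorAction (Agr r n) Φr Φk) Θ
  mul_right : Θ ∘ₗ (LinearMap.mul' Kq (Acoord r n)).lTensor (Acoord k n) =
    (LinearMap.mul' Kq (Acoord r n)).rTensor (Acoord k n) ∘ₗ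
      (TensorProduct.assoc Kq (Acoord r n) (Acoord r n) (Acoord k n)).symm.toLinearMap ∘ₗ
      Θ.lTensor (Acoord r n) ∘ₗ
      (TensorProduct.assoc Kq (Acoord r n) (Acoord k n) (Acoord r n)).toLinearMap ∘ₗ
      Θ.rTensor (Acoord r n) ∘ₗ
      (TensorProduct.assoc Kq (Acoord k n) (Acoord r n) (Acoord r n)).symm.toLinearMap
  mul_left : Θ ∘ₗ (LinearMap.mul' Kq (Acoord k n)).rTensor (Acoord r n) =
    (LinearMap.mul' Kq (Acoord k n)).lTensor (Acoord r n) ∘ₗ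
      (TensorProduct.assoc Kq (Acoord r n) (Acoord k n) (Acoord k n)).toLinearMap ∘ₗ
      Θ.rTensor (Acoord k n) ∘ₗ
      (TensorProduct.assoc Kq (Acoord k n) (Acoord r n) (Acoord k n)).symm.toLinearMap ∘ₗ
      Θ.lTensor (Acoord k n) ∘ₗ
      (TensorProduct.assoc Kq (Acoord k n) (Acoord k n) (Acoord r n)).toLinearMap
  one_left : ∀ x : Acoord r n, Θ (1 ⊗ₜ x) = x ⊗ₜ 1
  one_right : ∀ y : Acoord k n, Θ (y ⊗ₜ 1) = 1 ⊗ₜ y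
  map_tgen : ∀ (j : Idx k) (b : Idx n) (i : Idx r) (a : Idx n), 0 < j.1 → 0 < i.1 →
    sgn ((par j + par b) * (par i + par a)) • Θ (tgen j b ⊗ₜ tgen i a) =
      ∑ b', ∑ a', (sgn ((par i + par a') * (par b' + par b)) * Smat b' b a' a) •
        (tgen i a' ⊗ₜ[Kq] tgen j b')

/-- The linear map `σ : A_{r,n} ⊗ A_{k,n} → A_{r+k,n}`, `x ⊗ y ↦ ι_k(x) ι_0(y)`. -/
noncomputable def sigma (r k n : ℕ) :
    Acoord r n ⊗[Kq] Acoord k n →ₗ[Kq] Acoord (r + k) n :=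
  TensorProduct.lift ((LinearMap.mul Kq (Acoord (r + k) n)).compl₁₂
    (iota (r := r) (m := r + k) k (by omega) n).toLinearMap
    (iota (r := k) (m := r + k) 0 (by omega) n).toLinearMap)

end QueerBraided

open QueerBraided

/-! Everything is driven by the operator `R`, the transpose of P S, where P is the flip of
superspaces. It satisfies the Hecke relation R² = ξ R + 1 (`R_R`) and the braid relation (`braid`),
which is the Yang-Baxter equation for S. Since t_{ia} = t_{-i,-a}, the rows 1, …, r generate
A_{r,n}. In terms of these rows T_i the defining relations reduce to T_i T_j = R(T_j T_i) for i < j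
and q T_i T_i = R(T_i T_i) (`IsCoordMatrix.STT_eq_TTS`, `isCoordMatrix_tgen`). A homomorphism out of
A_{r,n} is therefore a family of r rows with these properties.

By the braid relation, moving an auxiliary index through a row by `R`, from either side, preserves
these relations. This yields two algebra homomorphisms `leftMat` and `rightMat` from A_{r,n} to
matrices over A_{r,n}. The entries of `leftMat`, corrected by signs, are the operators of the
L_{ab}. The relation of its iterate with `R` (`leftMat_comm`) becomes the defining relation of
U_q(q_n), and its multiplicativity becomes compatibility with Δ. The action is unique because it is
prescribed on generators and Δ dictates it on products.

In A_{r+k,n} a generator of a row j ≤ k can be carried to the right of ι_k(x) at the cost of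
applying `rightMat` to x (`low_mul_up`). Hence the image of σ is stable under left multiplication by
generators and σ is onto. Conversely, this exchange rule defines a representation of A_{r+k,n} on
A_{r,n} ⊗ A_{k,n}. There σ(x ⊗ y) sends 1 ⊗ 1 to x ⊗ y, so σ is injective (`exists_retraction`).

Once σ is bijective the rest is formal. Put Θ(y ⊗ x) = σ⁻¹(ι_0(y) ι_k(x)). After applying σ, the two
multiplicativity axioms for Θ become associativity in A_{r+k,n}, and equivariance follows from that
of ι_0 and ι_k. Any other Θ agrees with this one on generators, and the multiplicativity axioms
propagate the agreement. The braided product is the product of A_{r+k,n} read through σ, so its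
algebra axioms are obtained by transport (`IsSupermoduleSuperalgebra.of_bijective`). -/

namespace QueerBraided

/-! ### Hecke and braid relations for P S -/

section Braid

variable {n : ℕ} {B : Type*} [AddCommGroup B] [Module Kq B]

theorem q_ne_zero : q ≠ 0 := RatFunc.X_ne_zero

theorem par_of_pos {i : Idx n} (h : 0 < i.1) : par i = 0 := if_pos h

theorem par_of_neg {i : Idx n} (h : i.1 < 0) : par i = 1 := if_neg (by omega)

theorem sgn_one : sgn 1 = -1 := by
  have : (1 : ZMod 2).val = 1 := rfl
  simp [sgn, this]

theorem idx_eq_iff {a b : Idx n} : a = b ↔ a.1 = b.1 := Subtype.ext_iff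

theorem idx_lt_iff {a b : Idx n} : a < b ↔ a.1 < b.1 := Iff.rfl

/-- The coefficient of `e_x ⊗ e_y` in `P S (e_a ⊗ e_b)`, where `P` is the flip of superspaces. -/
noncomputable def Rmat (x y a b : Idx n) : Kq :=
  sgn ((par x + par b) * par a + par x * par y) * Smat y a x b

/-- The transpose of `P S`, acting on functions of two indices. -/
noncomputable def R : (Idx n → Idx n → B) →ₗ[Kq] (Idx n → Idx n → B) where
  toFun f a b := ∑ x, ∑ y, Rmat x y a b • f x y
  map_add' f g := by
    funext a b
    simp [Finset.sum_add_distrib]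
  map_smul' c f := by
    funext a b
    simp [Finset.smul_sum, smul_comm c]

theorem R_def (f : Idx n → Idx n → B) (a b : Idx n) :
    R f a b = ∑ x, ∑ y, Rmat x y a b • f x y := rfl

/-- P S sends e_a ⊗ e_b into the span of three basis vectors: the swapped pair, the pair itself and
the pair of negatives. The last comes from the summands E_{-j,-i} ⊗ E_{ij}, which are special to the
queer case. As 0 is not an index, the last two never coincide. -/
theorem Rmat_eq (x y a b : Idx n) : Rmat x y a b =
    (if x = b ∧ y = a then sgn (par a * par b) * q ^ phi a b else 0) +
    (if x = a ∧ y = b then (if a.1 < b.1 then xi else 0) else 0) +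
    (if x = -a ∧ y = -b then (if -a.1 < b.1 then xi * sgn (par b) else 0) else 0) := by
  have ha := idx_ne_zero a
  unfold Rmat Smat
  rw [mul_add, add_assoc]
  congr 1
  · by_cases h : x = b ∧ y = a
    · obtain ⟨rfl, rfl⟩ := h
      simp only [and_self, if_true]
      congr 2
      -- Equalities of signs are polynomial identities over ℤ/2 in the parities, so checking all
      -- values proves them; this recurs throughout.
      generalize par x = u; generalize par y = v; revert u v; decide
    · rw [if_neg h, if_neg (fun h' => h ⟨h'.2, h'.1⟩), mul_zero]
  · by_cases h1 : x = a ∧ y = b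
    · obtain ⟨rfl, rfl⟩ := h1
      have h2 : ¬ (x = -x ∧ y = -y) := by
        rintro ⟨h, -⟩; rw [idx_eq_iff, neg_val] at h; omega
      have h3 : ¬ (y = -y ∧ x = -x) := fun h => h2 ⟨h.2, h.1⟩
      simp only [h2, h3, and_self, if_true, if_false, add_zero, mul_one, idx_lt_iff]
      split_ifs
      · rw [mul_comm xi, ← mul_assoc, ← sgn_add]
        have : (par x + par y) * par x + par x * par y + par x = 0 := by
          generalize par x = u; generalize par y = v; revert u v; decide
        rw [this, sgn_zero, one_mul]
      · simp
    · by_cases h2 : x = -a ∧ y = -b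
      · obtain ⟨rfl, rfl⟩ := h2
        have h3 : ¬ (-b = b ∧ a = -a) := by
          rintro ⟨-, h⟩; rw [idx_eq_iff, neg_val] at h; omega
        simp only [h1, h3, neg_neg', and_self, if_true, if_false, zero_add, mul_one, idx_lt_iff,
          neg_val]
        split_ifs
        · rw [mul_left_comm, ← sgn_add, par_neg, par_neg]
          congr 2
          generalize par a = u; generalize par b = v; revert u v; decide
        · simp
      · have h3 : ¬ (y = b ∧ a = x) := fun h => h1 ⟨h.2.symm, h.1⟩
        have h4 : ¬ (y = -b ∧ a = -x) := by
          rintro ⟨rfl, rfl⟩; exact h2 ⟨by simp, rfl⟩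
        simp [h1, h2, h3, h4]

theorem R_apply (f : Idx n → Idx n → B) (a b : Idx n) : R f a b =
    (sgn (par a * par b) * q ^ phi a b) • f b a + (if a.1 < b.1 then xi else 0) • f a b +
      (if -a.1 < b.1 then xi * sgn (par b) else 0) • f (-a) (-b) := by
  have key : ∀ (u v : Idx n) (c : Kq),
      (∑ x, ∑ y, (if x = u ∧ y = v then c else 0) • f x y) = c • f u v := by
    intro u v c
    rw [Finset.sum_eq_single u, Finset.sum_eq_single v] <;> simp +contextual
  simp only [R_def, Rmat_eq, add_smul, Finset.sum_add_distrib, key]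

/-- Exponents and signs are recast as case distinctions on integers, so that once the signs and the
order of the indices are fixed, `omega` settles every condition. -/
theorem phi_cases (a b : Idx n) :
    phi a b = if a.1 = b.1 ∨ a.1 = -b.1 then (if 0 < b.1 then 1 else -1) else 0 := by
  have := idx_ne_zero b
  simp only [phi, idx_eq_iff, neg_val]
  split_ifs <;> omega

theorem sgn_par_cases (a : Idx n) : sgn (par a) = if 0 < a.1 then 1 else -1 := by
  have := idx_ne_zero a
  split_ifs with h
  · rw [par_of_pos h, sgn_zero]
  · rw [par_of_neg (by omega), sgn_one]

theorem sgn_par_mul_cases (a b : Idx n) :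
    sgn (par a * par b) = if 0 < a.1 then 1 else if 0 < b.1 then 1 else -1 := by
  have := idx_ne_zero a
  have := idx_ne_zero b
  split_ifs with h h'
  · rw [par_of_pos h, zero_mul, sgn_zero]
  · rw [par_of_pos h', mul_zero, sgn_zero]
  · rw [par_of_neg (i := a) (by omega), par_of_neg (by omega), mul_one, sgn_one]

theorem idx_sign_cases (a b : Idx n) :
    (a = b ∨ a = -b ∨ (a.1 ≠ b.1 ∧ a.1 ≠ -b.1)) := by
  simp only [idx_eq_iff, neg_val]; omega

/-- This is the Hecke relation (R - q)(R + q⁻¹) = 0. The cases a = b and a = -b are separate because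
only there is φ nonzero. -/
theorem R_R (f : Idx n → Idx n → B) : R (R f) = xi • R f + f := by
  have hq := q_ne_zero
  funext a b
  have ha := idx_ne_zero a
  have hb := idx_ne_zero b
  simp only [R_apply, phi_cases, sgn_par_cases, sgn_par_mul_cases, neg_val, neg_neg',
    Pi.add_apply, Pi.smul_apply]
  rcases idx_sign_cases a b with rfl | rfl | ⟨h1, h2⟩
  · rcases lt_or_gt_of_ne ha with ha' | ha' <;>
    simp (disch := omega) only [if_pos, if_neg, zpow_one, zpow_neg, true_or, if_true] <;>
    match_scalars <;> simp only [xi] <;> field_simp <;> ring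
  · rcases lt_or_gt_of_ne hb with ha' | ha' <;>
    simp (disch := omega) only [if_pos, if_neg, neg_neg', neg_val, zpow_one, zpow_neg, or_true,
      if_true] <;> match_scalars <;> simp only [xi] <;> field_simp <;> ring
  · rcases lt_or_gt_of_ne ha with ha' | ha' <;> rcases lt_or_gt_of_ne hb with hb' | hb' <;>
    rcases lt_or_gt_of_ne h1 with h1' | h1' <;> rcases lt_or_gt_of_ne h2 with h2' | h2' <;> try omega
    all_goals
      simp (disch := omega) only [if_pos, if_neg, zpow_zero]
      module

/-- `R` in the first two of three positions. -/
noncomputable def R12 : Module.End Kq (Idx n → Idx n → Idx n → B) where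
  toFun g a b c := R (fun x y => g x y c) a b
  map_add' f g := by
    funext a b c
    exact congrFun₂ (map_add R (fun x y => f x y c) (fun x y => g x y c)) a b
  map_smul' s g := by
    funext a b c
    exact congrFun₂ (map_smul R s (fun x y => g x y c)) a b

/-- `R` in the last two of three positions. -/
noncomputable def R23 : Module.End Kq (Idx n → Idx n → Idx n → B) where
  toFun g a := R (g a)
  map_add' f g := by
    funext a
    exact map_add R (f a) (g a)
  map_smul' s g := by
    funext a
    exact map_smul R s (g a)

theorem R12_apply (g : Idx n → Idx n → Idx n → B) (a b c : Idx n) :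
    R12 g a b c = R (fun x y => g x y c) a b := rfl

theorem R23_apply (g : Idx n → Idx n → Idx n → B) (a b c : Idx n) :
    R23 g a b c = R (g a) b c := rfl

/-- The transpose of the odd involution in the first position. -/
noncomputable def odd1 : Module.End Kq (Idx n → Idx n → Idx n → B) where
  toFun g a b c := sgn (par a) • g (-a) b c
  map_add' f g := by funext a b c; simp
  map_smul' s g := by funext a b c; simp [smul_comm s]

/-- The transpose of the odd involution in the second position. -/
noncomputable def odd2 : Module.End Kq (Idx n → Idx n → Idx n → B) where
  toFun g a b c := (sgn (par a) * sgn (par b)) • g a (-b) c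
  map_add' f g := by funext a b c; simp
  map_smul' s g := by funext a b c; simp [smul_comm s]

/-- The transpose of the odd involution in the third position. -/
noncomputable def odd3 : Module.End Kq (Idx n → Idx n → Idx n → B) where
  toFun g a b c := (sgn (par a) * sgn (par b) * sgn (par c)) • g a b (-c)
  map_add' f g := by funext a b c; simp
  map_smul' s g := by funext a b c; simp [smul_comm s]

theorem odd1_apply (g : Idx n → Idx n → Idx n → B) (a b c : Idx n) :
    odd1 g a b c = sgn (par a) • g (-a) b c := rfl

theorem odd2_apply (g : Idx n → Idx n → Idx n → B) (a b c : Idx n) :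
    odd2 g a b c = (sgn (par a) * sgn (par b)) • g a (-b) c := rfl

theorem odd3_apply (g : Idx n → Idx n → Idx n → B) (a b c : Idx n) :
    odd3 g a b c = (sgn (par a) * sgn (par b) * sgn (par c)) • g a b (-c) := rfl

/-- Negating a interchanges the conditions a < b and -a < b, so the two ξ-terms of `R_apply` trade
places and no correction appears. In other words, S commutes with the odd involution of its first
factor, and P carries it to the other leg. -/
theorem R_odd_left (f : Idx n → Idx n → B) (a b : Idx n) :
    sgn (par a) • R f (-a) b = R (fun x y => (sgn (par x) * sgn (par y)) • f x (-y)) a b := by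
  have ha := idx_ne_zero a
  have hb := idx_ne_zero b
  simp only [R_apply, phi_cases, sgn_par_cases, sgn_par_mul_cases, neg_val, neg_neg']
  rcases idx_sign_cases a b with rfl | rfl | ⟨h1, h2⟩
  · rcases lt_or_gt_of_ne ha with ha' | ha' <;>
    simp (disch := omega) only [if_pos, if_neg, true_or, or_true, if_true] <;> module
  · rcases lt_or_gt_of_ne hb with ha' | ha' <;>
    simp (disch := omega) only [if_pos, if_neg, neg_neg', neg_val, or_true, if_true] <;>
    module
  · rcases lt_or_gt_of_ne ha with ha' | ha' <;> rcases lt_or_gt_of_ne hb with hb' | hb' <;>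
    rcases lt_or_gt_of_ne h1 with h1' | h1' <;> rcases lt_or_gt_of_ne h2 with h2' | h2' <;> try omega
    all_goals
      simp (disch := omega) only [if_pos, if_neg, zpow_zero]
      module

/-- For a ≠ ±b, negating b turns a < b and -a < b into the complements of -a < b and a < b. Passing
to the complement of a condition costs a full ξ-term, which is the correction. For a = ±b the
correction comes from q - q⁻¹ = ξ. -/
theorem R_odd_right (f : Idx n → Idx n → B) (a b : Idx n) :
    (sgn (par a) * sgn (par b)) • R f a (-b) = R (fun x y => sgn (par x) • f (-x) y) a b +
      xi • ((sgn (par a) * sgn (par b)) • f a (-b) - sgn (par a) • f (-a) b) := by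
  have hq := q_ne_zero
  have ha := idx_ne_zero a
  have hb := idx_ne_zero b
  simp only [R_apply, phi_cases, sgn_par_cases, sgn_par_mul_cases, neg_val, neg_neg']
  rcases idx_sign_cases a b with rfl | rfl | ⟨h1, h2⟩
  · rcases lt_or_gt_of_ne ha with ha' | ha' <;>
    simp (disch := omega) only [if_pos, if_neg, zpow_one, zpow_neg, true_or, if_true] <;>
    match_scalars <;> simp only [xi] <;> ring
  · rcases lt_or_gt_of_ne hb with ha' | ha' <;>
    simp (disch := omega) only [if_pos, if_neg, neg_neg', neg_val, zpow_one, zpow_neg, true_or,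
      or_true, if_true] <;> match_scalars <;> simp only [xi] <;> ring
  · rcases lt_or_gt_of_ne ha with ha' | ha' <;> rcases lt_or_gt_of_ne hb with hb' | hb' <;>
    rcases lt_or_gt_of_ne h1 with h1' | h1' <;> rcases lt_or_gt_of_ne h2 with h2' | h2' <;> try omega
    all_goals
      simp (disch := omega) only [if_pos, if_neg, zpow_zero]
      module

/-- `P S` is even. -/
theorem R_even (f : Idx n → Idx n → B) (a b : Idx n) :
    (sgn (par a) * sgn (par b)) • R f a b =
      R (fun x y => (sgn (par x) * sgn (par y)) • f x y) a b := by
  simp only [R_apply, par_neg, sgn_add, sgn_one]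
  module

theorem odd1_R12 (g : Idx n → Idx n → Idx n → B) : odd1 (R12 g) = R12 (odd2 g) := by
  funext a b c
  exact R_odd_left (fun x y => g x y c) a b

theorem odd2_R12 (g : Idx n → Idx n → Idx n → B) :
    odd2 (R12 g) = R12 (odd1 g) + xi • (odd2 g - odd1 g) := by
  funext a b c
  exact R_odd_right (fun x y => g x y c) a b

theorem odd3_R12 (g : Idx n → Idx n → Idx n → B) : odd3 (R12 g) = R12 (odd3 g) := by
  funext a b c
  have h := R_even (fun x y => sgn (par c) • g x y (-c)) a b
  simp only [R12_apply, odd3_apply, R_apply, smul_smul] at h ⊢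
  convert h using 1
  module

theorem odd1_R23 (g : Idx n → Idx n → Idx n → B) : odd1 (R23 g) = R23 (odd1 g) := by
  funext a b c
  simp only [R23_apply, odd1_apply, R_apply]
  module

theorem odd2_R23 (g : Idx n → Idx n → Idx n → B) : odd2 (R23 g) = R23 (odd3 g) := by
  funext a b c
  have h := congrArg (sgn (par a) • ·) (R_odd_left (g a) b c)
  simp only [R23_apply, odd2_apply, odd3_apply, R_apply, smul_smul, smul_add] at h ⊢
  convert h using 1 <;> module

theorem odd3_R23 (g : Idx n → Idx n → Idx n → B) :
    odd3 (R23 g) = R23 (odd2 g) + xi • (odd3 g - odd2 g) := by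
  funext a b c
  have h := congrArg (sgn (par a) • ·) (R_odd_right (g a) b c)
  simp only [R23_apply, odd2_apply, odd3_apply, R_apply, smul_smul, smul_add, smul_sub,
    Pi.add_apply, Pi.sub_apply, Pi.smul_apply] at h ⊢
  convert h using 1 <;> module

theorem R12_R12 (g : Idx n → Idx n → Idx n → B) : R12 (R12 g) = xi • R12 g + g := by
  funext a b c
  exact congrFun₂ (R_R fun x y => g x y c) a b

theorem R23_R23 (g : Idx n → Idx n → Idx n → B) : R23 (R23 g) = xi • R23 g + g := by
  funext a
  exact R_R (g a)

/-- The third term disappears since -a > 0 > b. What remains is an R-matrix of Hecke type A at the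
parameter -q⁻¹, with a sign on the flip, and the queer structure is no longer visible. -/
theorem R_apply_of_neg (f : Idx n → Idx n → B) {a b : Idx n} (ha : a.1 < 0) (hb : b.1 < 0) :
    R f a b = (if a = b then -q⁻¹ else -1 : Kq) • f b a + (if a.1 < b.1 then xi else 0) • f a b := by
  simp only [R_apply, phi_cases, sgn_par_mul_cases, idx_eq_iff]
  by_cases h : a.1 = b.1 <;>
    simp (disch := omega) only [if_pos, if_neg, zpow_zero, zpow_neg, zpow_one] <;> module

theorem braid_of_neg (g : Idx n → Idx n → Idx n → B) {a b c : Idx n} (ha : a.1 < 0)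
    (hb : b.1 < 0) (hc : c.1 < 0) : R12 (R23 (R12 g)) a b c = R23 (R12 (R23 g)) a b c := by
  have hq := q_ne_zero
  simp only [R12_apply, R23_apply, R_apply_of_neg, ha, hb, hc]
  -- Of the 27 combinations only the thirteen consistent relative orders of a, b, c survive `omega`.
  -- When indices coincide the scalars may involve q q⁻¹ = 1 and the definition of ξ, hence the
  -- second alternative below.
  rcases lt_trichotomy a.1 b.1 with h1 | h1 | h1 <;>
    rcases lt_trichotomy b.1 c.1 with h2 | h2 | h2 <;>
    rcases lt_trichotomy a.1 c.1 with h3 | h3 | h3 <;> try omega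
  all_goals
    try obtain rfl := idx_eq_iff.2 h1
    try obtain rfl := idx_eq_iff.2 h2
    try obtain rfl := idx_eq_iff.2 h3
    simp (disch := omega) only [if_pos, if_neg, idx_eq_iff, if_true] <;>
    first
    | module
    | (match_scalars <;> (try simp only [xi]) <;> field_simp <;> ring)

theorem smul_sgn_cancel {d : ZMod 2} {x y : B} (h : sgn d • x = sgn d • y) : x = y := by
  have := congrArg (sgn d • ·) h
  simpa only [smul_smul, sgn_mul_self, one_smul] using this

/-- Both triple products intertwine `odd3` with `odd1` exactly, so the relation for `odd3 g` at (a,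
b, c) is, up to a sign, the relation for g at (-a, b, c). This is why the hypothesis quantifies over
all g. -/
theorem braid_neg_left {a b c : Idx n}
    (h : ∀ g : Idx n → Idx n → Idx n → B, R12 (R23 (R12 g)) a b c = R23 (R12 (R23 g)) a b c)
    (g : Idx n → Idx n → Idx n → B) :
    R12 (R23 (R12 g)) (-a) b c = R23 (R12 (R23 g)) (-a) b c := by
  have key := h (odd3 g)
  rw [← odd3_R12, ← odd2_R23, ← odd1_R12, ← odd2_R23, ← odd1_R12, ← odd1_R23] at key
  exact smul_sgn_cancel key

/-- Moving `odd2` through either triple product produces ξ-corrections, but they are the same on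
both sides and cancel in the difference. -/
theorem braid_neg_middle {a b c : Idx n}
    (h : ∀ g : Idx n → Idx n → Idx n → B, R12 (R23 (R12 g)) a b c = R23 (R12 (R23 g)) a b c)
    (g : Idx n → Idx n → Idx n → B) :
    R12 (R23 (R12 g)) a (-b) c = R23 (R12 (R23 g)) a (-b) c := by
  have key : odd2 (R12 (R23 (R12 g))) - odd2 (R23 (R12 (R23 g))) =
      R12 (R23 (R12 (odd2 g))) - R23 (R12 (R23 (odd2 g))) := by
    simp only [odd1_R12, odd2_R12, odd3_R12, odd1_R23, odd2_R23, odd3_R23, map_add, map_sub,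
      map_smul]
    module
  have h2 : (odd2 (R12 (R23 (R12 g))) - odd2 (R23 (R12 (R23 g)))) a b c = 0 := by
    rw [key]
    exact sub_eq_zero.2 (h (odd2 g))
  have h3 := sub_eq_zero.1 h2
  rw [odd2_apply, odd2_apply, ← sgn_add] at h3
  exact smul_sgn_cancel h3

/-- Here the ξ-corrections contain squares of `R12` and `R23`, and they cancel in the difference
only after the Hecke relation is used. -/
theorem braid_neg_right {a b c : Idx n}
    (h : ∀ g : Idx n → Idx n → Idx n → B, R12 (R23 (R12 g)) a b c = R23 (R12 (R23 g)) a b c)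
    (g : Idx n → Idx n → Idx n → B) :
    R12 (R23 (R12 g)) a b (-c) = R23 (R12 (R23 g)) a b (-c) := by
  have key : odd3 (R12 (R23 (R12 g))) - odd3 (R23 (R12 (R23 g))) =
      R12 (R23 (R12 (odd1 g))) - R23 (R12 (R23 (odd1 g))) := by
    simp only [odd2_R12, odd3_R12, odd1_R23, odd2_R23, odd3_R23, map_add, map_sub,
      map_smul, R12_R12, R23_R23]
    module
  have h2 : (odd3 (R12 (R23 (R12 g))) - odd3 (R23 (R12 (R23 g)))) a b c = 0 := by
    rw [key]
    exact sub_eq_zero.2 (h (odd1 g))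
  have h3 := sub_eq_zero.1 h2
  rw [odd3_apply, odd3_apply, ← sgn_add, ← sgn_add] at h3
  exact smul_sgn_cancel h3

/-- The braid relation for `P S`, equivalent to the Yang-Baxter equation for `S`. -/
theorem braid (g : Idx n → Idx n → Idx n → B) : R12 (R23 (R12 g)) = R23 (R12 (R23 g)) := by
  funext a b c
  have key : ∀ a : Idx n, a.1 < 0 ∨ (-a).1 < 0 := fun a => by
    have := idx_ne_zero a
    rw [neg_val]; omega
  have h1 : ∀ a b c : Idx n, a.1 < 0 → b.1 < 0 → ∀ g : Idx n → Idx n → Idx n → B,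
      R12 (R23 (R12 g)) a b c = R23 (R12 (R23 g)) a b c := by
    intro a b c ha hb
    rcases key c with hc | hc
    · exact fun g => braid_of_neg g ha hb hc
    · rw [← neg_neg' c]
      exact braid_neg_right fun g => braid_of_neg g ha hb hc
  have h2 : ∀ a b c : Idx n, a.1 < 0 → ∀ g : Idx n → Idx n → Idx n → B,
      R12 (R23 (R12 g)) a b c = R23 (R12 (R23 g)) a b c := by
    intro a b c ha
    rcases key b with hb | hb
    · exact h1 a b c ha hb
    · rw [← neg_neg' b]
      exact braid_neg_middle (h1 a _ c ha hb)
  rcases key a with ha | ha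
  · exact h2 a b c ha g
  · rw [← neg_neg' a]
    exact braid_neg_left (h2 _ b c ha) g

end Braid
end QueerBraided

namespace QueerBraided

/-! ### Presentation of A_{r,n} by its positive rows -/

section Presentation

variable {r n : ℕ} {B C : Type*} [Ring B] [Algebra Kq B] [Ring C] [Algebra Kq C]

/-- Negation of indices as a permutation. -/
def negEquiv (n : ℕ) : Idx n ≃ Idx n := ⟨Neg.neg, Neg.neg, neg_neg', neg_neg'⟩

theorem sum_neg_idx {D : Type*} [AddCommMonoid D] (f : Idx n → D) : ∑ i, f (-i) = ∑ i, f i :=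
  (negEquiv n).sum_comp f

theorem neg_eq_iff' {a b : Idx n} : -a = b ↔ a = -b :=
  ⟨fun h => by rw [← h, neg_neg'], fun h => by rw [h, neg_neg']⟩

theorem Smat_neg_left (a' a b' b : Idx n) : Smat (-a') (-a) b' b = Smat a' a b' b := by
  have h : phi (-a') b' = phi a' b' := by
    simp only [phi, neg_eq_iff', neg_neg']
    ring
  simp only [Smat, h, neg_eq_iff', neg_neg']
  rw [add_comm (if a' = -b ∧ a = -b' then (1 : Kq) else 0)]

/-- Off the diagonal, negation reverses the order of b' and b, so exactly one of the two entries
carries the ξ-term. On the diagonal φ changes sign, and q^φ - q^{-φ} = ±ξ gives the same correction.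
-/
theorem Smat_neg_right (a' a b' b : Idx n) : Smat a' a b' b = Smat a' a (-b') (-b) +
    xi * sgn (par b') * ((if a' = b ∧ a = b' then 1 else 0) +
      (if a' = -b ∧ a = -b' then 1 else 0)) := by
  have hb := idx_ne_zero b'
  have hb2 := idx_ne_zero b
  simp only [Smat, idx_lt_iff, neg_val, neg_neg', par_neg, sgn_add, sgn_one, neg_eq_iff']
  by_cases h : b' = b
  · subst h
    simp only [lt_irrefl, if_false, and_true]
    by_cases h1 : a' = a
    · subst h1
      simp only [phi_cases, neg_val, sgn_par_cases, and_self]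
      by_cases h2 : a' = b'
      · subst h2
        have h3 : a' ≠ -a' := by rw [Ne, idx_eq_iff, neg_val]; omega
        rcases lt_or_gt_of_ne hb with hb' | hb' <;>
          simp (disch := omega) only [if_pos, if_neg, h3, if_true, if_false, true_or, xi,
            zpow_one, zpow_neg, neg_neg, or_true] <;> ring
      · by_cases h3 : a' = -b'
        · subst h3
          rcases lt_or_gt_of_ne hb with hb' | hb' <;>
          simp (disch := omega) only [if_pos, if_neg, h2, if_true, if_false, true_or, xi,
            zpow_one, zpow_neg, neg_neg, or_true, neg_val] <;> ring
        · have h4 : a'.1 ≠ b'.1 := fun h => h2 (idx_eq_iff.2 h)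
          have h5 : a'.1 ≠ -b'.1 := fun h => h3 (idx_eq_iff.2 h)
          simp (disch := omega) only [h2, h3, if_neg, if_true, if_false]
          ring
    · have h2 : ¬ (a' = b' ∧ a = b') := by rintro ⟨h, h'⟩; exact h1 (h.trans h'.symm)
      have h3 : ¬ (a' = -b' ∧ a = -b') := by rintro ⟨h, h'⟩; exact h1 (h.trans h'.symm)
      simp [h1, h2, h3]
  · have h' : b'.1 ≠ b.1 := fun h' => h (idx_eq_iff.2 h')
    simp only [h, and_false, if_false, zero_add]
    rcases lt_or_gt_of_ne h' with h1 | h1 <;>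
      simp (disch := omega) only [if_pos, if_neg] <;> ring

/-- The products of the entries of the rows `i` and `j`. -/
def rowMul (T : Idx r → Idx n → B) (i j : Idx r) (a b : Idx n) : B := T i a * T j b

/-- The relations between the rows `1, …, r` of a matrix that present `A_{r,n}`. -/
structure IsCoordMatrix (T : Idx r → Idx n → B) : Prop where
  neg : ∀ i a, T i a = T (-i) (-a)
  lt : ∀ i j, 0 < i.1 → i.1 < j.1 → rowMul T i j = R (rowMul T j i)
  self : ∀ i, 0 < i.1 → q • rowMul T i i = R (rowMul T i i)

/-- Applying the Hecke relation to the relation for the opposite order shows that the relations with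
i > j are redundant. -/
theorem IsCoordMatrix.gt {T : Idx r → Idx n → B} (h : IsCoordMatrix T) (i j : Idx r)
    (hj : 0 < j.1) (hij : j.1 < i.1) :
    R (rowMul T j i) = rowMul T i j + xi • rowMul T j i := by
  rw [h.lt j i hj hij, R_R, add_comm]

theorem TTS_of_pos (T : Idx r → Idx n → B) {i j : Idx r} (hj : 0 < j.1)
    (a b : Idx n) : TTS T i a j b = sgn (par a * par b) • R (rowMul T j i) a b := by
  rw [TTS, R_def, Finset.sum_comm, Finset.smul_sum]
  refine Finset.sum_congr rfl fun x _ => ?_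
  rw [Finset.smul_sum]
  refine Finset.sum_congr rfl fun y _ => ?_
  rw [smul_smul, Rmat, ← mul_assoc, ← sgn_add, par_of_pos hj, rowMul]
  congr 3
  generalize par a = a; generalize par b = b; generalize par x = x; generalize par y = y
  revert a b x y; decide

/-- The row side of the relation also involves only three products of entries: the pair (i, j), the
swapped pair, and the swapped pair of negatives. -/
theorem STT_eq (T : Idx r → Idx n → B) (i j : Idx r) (a b : Idx n) : STT T i a j b =
    (sgn ((par i + par a) * (par j + par b)) * q ^ phi i j) • (T i a * T j b) +
    (if j.1 < i.1 then sgn ((par j + par i) * (par j + par a)) *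
      sgn ((par j + par a) * (par i + par b)) * (xi * sgn (par j)) else 0) • (T j a * T i b) +
    (if j.1 < -i.1 then sgn ((par j + par (-i)) * (par (-j) + par a)) *
      sgn ((par (-j) + par a) * (par (-i) + par b)) * (xi * sgn (par j)) else 0) •
        (T (-j) a * T (-i) b) := by
  have key : ∀ (u v : Idx r) (c : Kq),
      (∑ x, ∑ y, (if x = u ∧ y = v then c else 0) • (T x a * T y b)) = c • (T u a * T v b) := by
    intro u v c
    rw [Finset.sum_eq_single u, Finset.sum_eq_single v] <;> simp +contextual
  rw [← key i j, ← key j i, ← key (-j) (-i)]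
  simp only [STT, ← Finset.sum_add_distrib, ← add_smul]
  refine Finset.sum_congr rfl fun x _ => Finset.sum_congr rfl fun y _ => ?_
  congr 1
  rw [Smat, mul_add, add_assoc]
  congr 1
  · by_cases h : x = i ∧ y = j
    · obtain ⟨rfl, rfl⟩ := h
      simp only [and_self, if_true]
      rw [← sgn_add]
      congr 2
      generalize par a = a; generalize par b = b; generalize par x = x; generalize par y = y
      revert a b x y; decide
    · rw [if_neg h, if_neg (fun h' => h ⟨h'.1.symm, h'.2.symm⟩), mul_zero]
  · simp only [idx_lt_iff]
    have e1 : (i = y ∧ x = j) ↔ (x = j ∧ y = i) := by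
      constructor <;> rintro ⟨rfl, rfl⟩ <;> exact ⟨rfl, rfl⟩
    have e2 : (i = -y ∧ x = -j) ↔ (x = -j ∧ y = -i) := by
      constructor <;> rintro ⟨rfl, rfl⟩ <;> simp
    rw [if_congr e1 rfl rfl, if_congr e2 rfl rfl]
    have hj := idx_ne_zero j
    by_cases h1 : x = j ∧ y = i
    · obtain ⟨rfl, rfl⟩ := h1
      have h2 : ¬ (x = -x ∧ y = -y) := by
        rintro ⟨h, -⟩; rw [idx_eq_iff, neg_val] at h; omega
      simp only [h2, and_self, if_true, if_false, add_zero]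
      split_ifs <;> ring
    · by_cases h2 : x = -j ∧ y = -i
      · obtain ⟨rfl, rfl⟩ := h2
        simp only [h1, and_self, if_true, if_false, zero_add, neg_val]
        split_ifs <;> ring
      · simp [h1, h2]

theorem STT_of_pos (T : Idx r → Idx n → B) {i j : Idx r} (hi : 0 < i.1) (hj : 0 < j.1)
    (a b : Idx n) : STT T i a j b = sgn (par a * par b) •
      ((if i = j then q else 1) • rowMul T i j a b +
        (if j.1 < i.1 then xi else 0) • rowMul T j i a b) := by
  have h1 : phi i j = if i = j then 1 else 0 := by
    rw [phi_cases]
    simp only [idx_eq_iff]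
    split_ifs <;> omega
  have h2 : q ^ (if i = j then 1 else 0 : ℤ) = if i = j then q else 1 := by
    split_ifs <;> simp
  rw [STT_eq, if_neg (by omega : ¬ j.1 < -i.1), zero_smul, add_zero, h1, h2, par_of_pos hi,
    par_of_pos hj]
  simp only [rowMul, zero_add, zero_mul, sgn_zero, one_mul, mul_one, smul_add, smul_smul]
  split_ifs <;> simp

/-- S is unchanged when both indices of its first factor are negated. Together with `TTS_neg_left`
this reduces the defining relations to i > 0. -/
theorem STT_neg_left {T : Idx r → Idx n → B} (h : ∀ i a, T i a = T (-i) (-a)) (i : Idx r)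
    (a : Idx n) (j : Idx r) (b : Idx n) : STT T (-i) (-a) j b = STT T i a j b := by
  unfold STT
  rw [← sum_neg_idx]
  refine Finset.sum_congr rfl fun x _ => Finset.sum_congr rfl fun y _ => ?_
  rw [Smat_neg_left, ← h, par_neg, par_neg, add_add_add_comm, CharTwo.add_self_eq_zero, add_zero]

theorem TTS_neg_left {T : Idx r → Idx n → B} (h : ∀ i a, T i a = T (-i) (-a)) (i : Idx r)
    (a : Idx n) (j : Idx r) (b : Idx n) : TTS T (-i) (-a) j b = TTS T i a j b := by
  unfold TTS
  rw [← sum_neg_idx]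
  refine Finset.sum_congr rfl fun x _ => Finset.sum_congr rfl fun y _ => ?_
  rw [Smat_neg_left, ← h, par_neg, par_neg, add_add_add_comm, CharTwo.add_self_eq_zero, add_zero]

theorem IsCoordMatrix.STT_eq_TTS_of_pos {T : Idx r → Idx n → B} (h : IsCoordMatrix T)
    {i j : Idx r} (hi : 0 < i.1) (hj : 0 < j.1) (a b : Idx n) : STT T i a j b = TTS T i a j b := by
  rw [STT_of_pos T hi hj, TTS_of_pos T hj]
  congr 1
  rcases lt_trichotomy i.1 j.1 with hij | hij | hij
  · rw [if_neg (by rw [idx_eq_iff]; omega), if_neg (by omega), h.lt i j hi hij]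
    simp
  · obtain rfl := idx_eq_iff.2 hij
    rw [if_pos rfl, if_neg (by omega), zero_smul, add_zero]
    exact congrFun₂ (h.self i hi) a b
  · rw [if_neg (by rw [idx_eq_iff]; omega), if_pos hij, h.gt i j hj hij]
    simp

/-- Negating in the second factor of S is not a symmetry. The defect computed here is what the
ξ-terms on the row side must match when the relation for a row -j is deduced from that for the row
j. -/
theorem TTS_neg_right {T : Idx r → Idx n → B} (h : ∀ i a, T i a = T (-i) (-a)) {i j : Idx r}
    (hj : 0 < j.1) (a b : Idx n) : TTS T i a j b = TTS T i a (-j) (-b) +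
      xi • (sgn (par a * par b) • (T j a * T i b) +
        sgn ((par a + 1) * (par b + 1) + par a + 1) • (T j (-a) * T i (-b))) := by
  have key : ∀ (u v : Idx n) (c : Kq),
      (∑ x, ∑ y, (if x = u ∧ y = v then c else 0) • (T j y * T i x)) = c • (T j v * T i u) := by
    intro u v c
    rw [Finset.sum_eq_single u, Finset.sum_eq_single v] <;> simp +contextual
  -- Reindexing by y ↦ -y and using T_{-j,-y} = T_{j,y} makes both sums run over the same products,
  -- so coefficients can be compared one by one.
  have e : TTS T i a (-j) (-b) = ∑ x, ∑ y, (sgn ((par (-j) + par (-y)) * (par x + par a)) *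
      Smat x a (-y) (-b)) • (T j y * T i x) := by
    unfold TTS
    refine Finset.sum_congr rfl fun x _ => ?_
    rw [← sum_neg_idx]
    refine Finset.sum_congr rfl fun y _ => ?_
    rw [← h]
  rw [smul_add, smul_smul, smul_smul, ← key b a, ← key (-b) (-a), e]
  simp only [TTS, ← Finset.sum_add_distrib]
  refine Finset.sum_congr rfl fun x _ => Finset.sum_congr rfl fun y _ => ?_
  rw [← add_smul, ← add_smul]
  congr 1
  rw [Smat_neg_right, mul_add, par_neg, par_neg, par_of_pos hj, add_add_add_comm (0 : ZMod 2) 1,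
    CharTwo.add_self_eq_zero, add_zero, add_assoc]
  congr 1
  have e1 : (x = b ∧ a = y) ↔ (x = b ∧ y = a) := by rw [eq_comm (a := a)]
  have e2 : (x = -b ∧ a = -y) ↔ (x = -b ∧ y = -a) := by rw [eq_comm (a := a), neg_eq_iff']
  rw [if_congr e1 rfl rfl, if_congr e2 rfl rfl, mul_add (xi * _), mul_add (sgn _)]
  congr 1
  · by_cases hh : x = b ∧ y = a
    · obtain ⟨rfl, rfl⟩ := hh
      simp only [and_self, if_true, mul_one]
      rw [mul_left_comm, ← sgn_add]
      congr 2
      generalize par x = x; generalize par y = y; revert x y; decide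
    · simp [hh]
  · by_cases hh : x = -b ∧ y = -a
    · obtain ⟨rfl, rfl⟩ := hh
      simp only [and_self, if_true, mul_one]
      rw [mul_left_comm, ← sgn_add, par_neg, par_neg]
      congr 2
      generalize par a = x; generalize par b = y; revert x y; decide
    · simp [hh]

/-- The full set of relations, for rows of either sign, follows from those between positive rows.
This is what makes homomorphisms out of A_{r,n} manageable. -/
theorem IsCoordMatrix.STT_eq_TTS {T : Idx r → Idx n → B} (h : IsCoordMatrix T)
    (i : Idx r) (a : Idx n) (j : Idx r) (b : Idx n) : STT T i a j b = TTS T i a j b := by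
  have key : ∀ (i : Idx r) (a : Idx n) (j : Idx r) (b : Idx n), 0 < i.1 →
      STT T i a j b = TTS T i a j b := by
    intro i a j b hi
    rcases lt_or_gt_of_ne (idx_ne_zero j) with hj | hj
    · rw [← neg_neg' j, ← neg_neg' b]
      generalize hj' : -j = k
      generalize -b = c
      have hk : 0 < k.1 := by rw [← hj', neg_val]; omega
      have h1 := TTS_neg_right h.neg (i := i) hk a c
      rw [← h.STT_eq_TTS_of_pos hi hk, STT_of_pos T hi hk] at h1
      have e1 : T (-k) a = T k (-a) := by rw [h.neg (-k) a, neg_neg']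
      rw [eq_sub_of_add_eq h1.symm, STT_eq, ← h.neg k c, ← h.neg i c, neg_neg', e1, par_neg,
        par_neg, par_neg, par_of_pos hi, par_of_pos hk]
      have h2 : (1 + 1 : ZMod 2) = 0 := rfl
      have h3 : ∀ x : ZMod 2, x = 0 ∨ x = 1 := by decide
      have hc : phi i (-k) = if i = k then -1 else 0 := by
        rw [phi_cases, neg_val]
        simp only [idx_eq_iff]
        split_ifs <;> omega
      rw [hc, neg_val, if_pos (by omega : -k.1 < i.1)]
      simp only [rowMul]
      rcases lt_trichotomy i.1 k.1 with hij | hij | hij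
      · have hne : i ≠ k := by rw [Ne, idx_eq_iff]; omega
        rw [if_neg hne, if_neg hne, if_neg (by omega : ¬ k.1 < i.1), if_pos (by omega)]
        rcases h3 (par a) with ha | ha <;> rcases h3 (par c) with hc | hc <;>
          simp only [ha, hc, h2, add_zero, zero_add, mul_zero, mul_one, one_mul, sgn_zero,
            sgn_one, zpow_zero] <;> module
      · obtain rfl := idx_eq_iff.2 hij
        rw [if_pos rfl, if_pos rfl, if_neg (by omega), if_neg (by omega)]
        rcases h3 (par a) with ha | ha <;> rcases h3 (par c) with hc | hc <;>
          simp only [ha, hc, h2, add_zero, zero_add, mul_zero, mul_one, one_mul, sgn_zero,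
            sgn_one, zpow_neg, zpow_one, xi] <;> module
      · have hne : i ≠ k := by rw [Ne, idx_eq_iff]; omega
        rw [if_neg hne, if_neg hne, if_pos hij, if_neg (by omega)]
        rcases h3 (par a) with ha | ha <;> rcases h3 (par c) with hc | hc <;>
          simp only [ha, hc, h2, add_zero, zero_add, mul_zero, mul_one, one_mul, sgn_zero,
            sgn_one, zpow_zero] <;> module
    · exact h.STT_eq_TTS_of_pos hi hj a b
  rcases lt_or_gt_of_ne (idx_ne_zero i) with hi | hi
  · rw [← neg_neg' i, ← neg_neg' a, STT_neg_left h.neg, TTS_neg_left h.neg]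
    exact key _ _ _ _ (by rw [neg_val]; omega)
  · exact key i a j b hi

theorem isCoordMatrix_tgen : IsCoordMatrix (tgen (r := r) (n := n)) where
  neg := tgen_neg
  lt i j hi hij := by
    funext a b
    have h := tgen_STT i a j b
    rw [STT_of_pos _ hi (by omega), TTS_of_pos _ (by omega),
      if_neg (by rw [idx_eq_iff]; omega), if_neg (by omega), one_smul, zero_smul, add_zero] at h
    exact smul_sgn_cancel h
  self i hi := by
    funext a b
    have h := tgen_STT i a i b
    rw [STT_of_pos _ hi hi, TTS_of_pos _ hi, if_pos rfl, if_neg (by omega), zero_smul,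
      add_zero] at h
    exact smul_sgn_cancel h

/-- The homomorphism out of `A_{r,n}` given by a matrix that satisfies the relations. -/
noncomputable def Alift (T : Idx r → Idx n → B) (h : IsCoordMatrix T) : Acoord r n →ₐ[Kq] B :=
  RingQuot.liftAlgHom Kq ⟨FreeAlgebra.lift Kq fun x : Idx r × Idx n => T x.1 x.2, by
    intro x y hxy
    cases hxy with
    | neg i a => simpa only [freeT, FreeAlgebra.lift_ι_apply] using h.neg i a
    | rtt i a j b =>
      rw [map_STT, map_TTS]
      simp only [freeT, FreeAlgebra.lift_ι_apply]
      exact h.STT_eq_TTS i a j b⟩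

theorem Alift_tgen (T : Idx r → Idx n → B) (h : IsCoordMatrix T) (i : Idx r) (a : Idx n) :
    Alift T h (tgen i a) = T i a := by
  rw [Alift, tgen, RingQuot.liftAlgHom_mkAlgHom_apply, freeT, FreeAlgebra.lift_ι_apply]

theorem adjoin_tgen :
    Algebra.adjoin Kq {x : Acoord r n | ∃ i a, 0 < i.1 ∧ x = tgen i a} = ⊤ := by
  rw [eq_top_iff]
  rintro x -
  obtain ⟨y, rfl⟩ := RingQuot.mkAlgHom_surjective Kq (ARel r n) x
  induction y using FreeAlgebra.induction with
  | grade0 c => rw [AlgHom.commutes]; exact Subalgebra.algebraMap_mem _ c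
  | grade1 x =>
    obtain ⟨i, a⟩ := x
    change tgen i a ∈ _
    refine Algebra.subset_adjoin ?_
    rcases lt_or_gt_of_ne (idx_ne_zero i) with hi | hi
    · exact ⟨-i, -a, by rw [neg_val]; omega, tgen_neg i a⟩
    · exact ⟨i, a, hi, rfl⟩
  | mul a b ha hb => rw [map_mul]; exact mul_mem ha hb
  | add a b ha hb => rw [map_add]; exact add_mem ha hb

/-- A subspace that contains `1` and is stable under left multiplication by the generators of the
positive rows is everything. -/
theorem mem_of_tgen_mul_mem {W : Submodule Kq (Acoord r n)} (h1 : 1 ∈ W)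
    (h : ∀ (i : Idx r) (a : Idx n), 0 < i.1 → ∀ x ∈ W, tgen i a * x ∈ W) (x : Acoord r n) :
    x ∈ W := by
  have key : ∀ x : Acoord r n, ∀ w ∈ W, x * w ∈ W := by
    intro x
    have hx : x ∈ Algebra.adjoin Kq {x : Acoord r n | ∃ i a, 0 < i.1 ∧ x = tgen i a} := by
      rw [adjoin_tgen]; trivial
    induction hx using Algebra.adjoin_induction with
    | mem x hx => obtain ⟨i, a, hi, rfl⟩ := hx; exact h i a hi
    | algebraMap c => intro w hw; rw [← Algebra.smul_def]; exact W.smul_mem c hw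
    | add x y _ _ hx hy => intro w hw; rw [add_mul]; exact W.add_mem (hx w hw) (hy w hw)
    | mul x y _ _ hx hy => intro w hw; rw [mul_assoc]; exact hx _ (hy w hw)
  simpa using key x 1 h1

theorem Acoord_algHom_ext {f g : Acoord r n →ₐ[Kq] B}
    (h : ∀ (i : Idx r) (a : Idx n), 0 < i.1 → f (tgen i a) = g (tgen i a)) : f = g := by
  refine AlgHom.ext_of_adjoin_eq_top adjoin_tgen ?_
  rintro _ ⟨i, a, hi, rfl⟩
  exact h i a hi

/-- Extends a family of rows indexed by `1, …, r` to all of `I_{r|r}` by `t_{-i,-a} = t_{ia}`. -/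
def extendRows {D : Type*} (T : Idx r → Idx n → D) (i : Idx r) (a : Idx n) : D :=
  if 0 < i.1 then T i a else T (-i) (-a)

theorem extendRows_of_pos {D : Type*} (T : Idx r → Idx n → D) {i : Idx r} (hi : 0 < i.1) (a : Idx n) :
    extendRows T i a = T i a := if_pos hi

theorem rowMul_extendRows {D : Type*} [Ring D] (T : Idx r → Idx n → D) {i j : Idx r} (hi : 0 < i.1) (hj : 0 < j.1) :
    rowMul (extendRows T) i j = rowMul T i j := by
  funext a b
  rw [rowMul, extendRows_of_pos T hi, extendRows_of_pos T hj, rowMul]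

/-- The symmetry under simultaneous negation defines the negative rows and holds by construction, so
only the positive rows carry conditions. -/
theorem isCoordMatrix_extendRows {T : Idx r → Idx n → B}
    (hlt : ∀ i j, 0 < i.1 → i.1 < j.1 → rowMul T i j = R (rowMul T j i))
    (hself : ∀ i, 0 < i.1 → q • rowMul T i i = R (rowMul T i i)) :
    IsCoordMatrix (extendRows T) where
  neg i a := by
    have := idx_ne_zero i
    unfold extendRows
    simp only [neg_val, neg_neg']
    split_ifs <;> first | rfl | omega
  lt i j hi hij := by
    rw [rowMul_extendRows T hi (by omega), rowMul_extendRows T (by omega) hi, hlt i j hi hij]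
  self i hi := by rw [rowMul_extendRows T hi hi, hself i hi]

end Presentation
end QueerBraided

namespace QueerBraided

/-! ### Moving an index through A_{r,n}: the homomorphisms `leftMat` and `rightMat` -/

section Operators

variable {r n : ℕ} {B C : Type*} [Ring B] [Algebra Kq B]

theorem map_R {D E : Type*} [AddCommGroup D] [Module Kq D] [AddCommGroup E] [Module Kq E]
    (φ : D →ₗ[Kq] E) (f : Idx n → Idx n → D) (a b : Idx n) :
    φ (R f a b) = R (fun x y => φ (f x y)) a b := by
  simp only [R_def, map_sum, map_smul]

theorem R_single_left {D : Type*} [AddCommGroup D] [Module Kq D] (f : Idx n → D)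
    (c a b : Idx n) :
    R (fun x y => if x = c then f y else 0) a b = ∑ y, Rmat c y a b • f y := by
  rw [R_def, Finset.sum_eq_single c] <;> simp +contextual

theorem R_single_right {D : Type*} [AddCommGroup D] [Module Kq D] (f : Idx n → D)
    (c a b : Idx n) :
    R (fun x y => if y = c then f x else 0) a b = ∑ x, Rmat x c a b • f x := by
  rw [R_def]
  refine Finset.sum_congr rfl fun x _ => ?_
  rw [Finset.sum_eq_single c] <;> simp +contextual

/-- The matrix over `B` obtained by moving an index to the left of a row `f` through `P S`. -/
noncomputable def moveLeft (f : Idx n → B) (a : Idx n) : Matrix (Idx n) (Idx n) B :=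
  Matrix.of fun c' c => R (fun x y => if x = c' then f y else 0) a c

/-- The matrix over `B` obtained by moving an index to the right of a row `f` through `P S`. -/
noncomputable def moveRight (f : Idx n → B) (a : Idx n) : Matrix (Idx n) (Idx n) B :=
  Matrix.of fun c c' => R (fun x y => if y = c' then f x else 0) c a

theorem moveLeft_apply (f : Idx n → B) (a c' c : Idx n) :
    moveLeft f a c' c = ∑ y, Rmat c' y a c • f y := R_single_left f c' a c

theorem moveRight_apply (f : Idx n → B) (a c c' : Idx n) :
    moveRight f a c c' = ∑ x, Rmat x c' c a • f x := R_single_right f c' c a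

/-- The matrix product sums over the intermediate position of the auxiliary index, which thus passes
first one row by `R12` and then the other by `R23`. -/
theorem moveLeft_mul (f g : Idx n → B) (a b c' c : Idx n) :
    (moveLeft f a * moveLeft g b) c' c =
      R23 (R12 (fun x y z => if x = c' then f y * g z else 0)) a b c := by
  rw [Matrix.mul_apply, R23_apply, R_def]
  refine Finset.sum_congr rfl fun u _ => ?_
  rw [moveLeft_apply, moveLeft_apply, Finset.mul_sum]
  refine Finset.sum_congr rfl fun v _ => ?_
  rw [R12_apply, R_single_left (fun y => f y * g v), mul_smul_comm, Finset.sum_mul]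
  simp only [smul_mul_assoc]

theorem moveRight_mul (f g : Idx n → B) (a b c c' : Idx n) :
    (moveRight f a * moveRight g b) c c' =
      R12 (R23 (fun x y z => if z = c' then f x * g y else 0)) c a b := by
  rw [Matrix.mul_apply, R12_apply, R_def, Finset.sum_comm]
  refine Finset.sum_congr rfl fun v _ => ?_
  rw [moveRight_apply, moveRight_apply, Finset.sum_mul]
  refine Finset.sum_congr rfl fun u _ => ?_
  rw [R23_apply, R_single_right (fun y => f u * g y), smul_mul_assoc, Finset.mul_sum]
  simp only [mul_smul_comm]

theorem R_matrix_apply (F : Idx n → Idx n → Matrix (Idx n) (Idx n) B) (a b c c' : Idx n) :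
    R F a b c c' = R (fun x y => F x y c c') a b :=
  map_R (Matrix.entryLinearMap Kq B c c') F a b

theorem R23_single (f : Idx n → Idx n → B) (c : Idx n) :
    R23 (fun x y z => if x = c then f y z else 0) = fun x y z => if x = c then R f y z else 0 := by
  funext x y z
  rw [R23_apply]
  split_ifs
  · rfl
  · exact congrFun₂ (map_zero R) y z

theorem R12_single (f : Idx n → Idx n → B) (c : Idx n) :
    R12 (fun x y z => if z = c then f x y else 0) = fun x y z => if z = c then R f x y else 0 := by
  funext x y z
  rw [R12_apply]
  split_ifs
  · rfl
  · exact congrFun₂ (map_zero R) x y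

/-- The braid relation converts exchanging the two rows after the auxiliary index has passed them
into exchanging them beforehand. -/
theorem R_moveLeft_mul (f g : Idx n → B) (a b c' c : Idx n) :
    R (fun a b => moveLeft f a * moveLeft g b) a b c' c =
      R23 (R12 (fun x y z => if x = c' then R (fun u v => f u * g v) y z else 0)) a b c := by
  rw [R_matrix_apply, ← R23_single, ← braid, R12_apply _ a b c]
  simp only [moveLeft_mul]

theorem R_moveRight_mul (f g : Idx n → B) (a b c c' : Idx n) :
    R (fun a b => moveRight f a * moveRight g b) a b c c' =
      R12 (R23 (fun x y z => if z = c' then R (fun u v => f u * g v) x y else 0)) c a b := by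
  rw [R_matrix_apply, ← R12_single, braid, R23_apply _ c a b]
  simp only [moveRight_mul]

/-- By `R_moveLeft_mul`, `R` applied to a product of moved rows equals the move of `R` applied to
the product, so each relation between rows is inherited by the moved rows. -/
theorem isCoordMatrix_moveLeft {T : Idx r → Idx n → B} (h : IsCoordMatrix T) :
    IsCoordMatrix (extendRows fun i => moveLeft (T i)) := by
  refine isCoordMatrix_extendRows (fun i j hi hij => ?_) fun i hi => ?_
  · funext a b
    ext c' c
    refine Eq.trans ?_ (R_moveLeft_mul (T j) (T i) a b c' c).symm
    have e : R (fun u v => T j u * T i v) = fun u v => T i u * T j v := (h.lt i j hi hij).symm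
    rw [rowMul, moveLeft_mul, e]
  · funext a b
    ext c' c
    refine Eq.trans ?_ (R_moveLeft_mul (T i) (T i) a b c' c).symm
    have e : R (fun u v => T i u * T i v) = q • fun u v => T i u * T i v := (h.self i hi).symm
    have e2 : (fun x y z => if x = c' then R (fun u v => T i u * T i v) y z else 0) =
        q • fun x y z => if x = c' then T i y * T i z else 0 := by
      funext x y z
      simp only [e, Pi.smul_apply, smul_ite, smul_zero]
    rw [e2, map_smul, map_smul]
    simp only [Pi.smul_apply, Matrix.smul_apply]
    rw [rowMul, moveLeft_mul]

theorem isCoordMatrix_moveRight {T : Idx r → Idx n → B} (h : IsCoordMatrix T) :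
    IsCoordMatrix (extendRows fun i => moveRight (T i)) := by
  refine isCoordMatrix_extendRows (fun i j hi hij => ?_) fun i hi => ?_
  · funext a b
    ext c c'
    refine Eq.trans ?_ (R_moveRight_mul (T j) (T i) a b c c').symm
    have e : R (fun u v => T j u * T i v) = fun u v => T i u * T j v := (h.lt i j hi hij).symm
    rw [rowMul, moveRight_mul, e]
  · funext a b
    ext c c'
    refine Eq.trans ?_ (R_moveRight_mul (T i) (T i) a b c c').symm
    have e : R (fun u v => T i u * T i v) = q • fun u v => T i u * T i v := (h.self i hi).symm
    have e2 : (fun x y z => if z = c' then R (fun u v => T i u * T i v) x y else 0) =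
        q • fun x y z => if z = c' then T i x * T i y else 0 := by
      funext x y z
      simp only [e, Pi.smul_apply, smul_ite, smul_zero]
    rw [e2, map_smul, map_smul]
    simp only [Pi.smul_apply, Matrix.smul_apply]
    rw [rowMul, moveRight_mul]

/-- The homomorphism `A_{r,n} → Mat(A_{r,n})` whose entries are, up to signs, the actions of the
generators `L_{ab}`. -/
noncomputable def leftMat (r n : ℕ) : Acoord r n →ₐ[Kq] Matrix (Idx n) (Idx n) (Acoord r n) :=
  Alift _ (isCoordMatrix_moveLeft isCoordMatrix_tgen)

/-- The homomorphism `A_{r,n} → Mat(A_{r,n})` that describes how a row of generators is moved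
through `A_{r,n}` from the left to the right. -/
noncomputable def rightMat (r n : ℕ) : Acoord r n →ₐ[Kq] Matrix (Idx n) (Idx n) (Acoord r n) :=
  Alift _ (isCoordMatrix_moveRight isCoordMatrix_tgen)

theorem leftMat_tgen {i : Idx r} (hi : 0 < i.1) (a c' c : Idx n) :
    leftMat r n (tgen i a) c' c = ∑ y, Rmat c' y a c • tgen i y := by
  rw [leftMat, Alift_tgen, extendRows_of_pos _ hi, moveLeft_apply]

theorem rightMat_tgen {i : Idx r} (hi : 0 < i.1) (a c c' : Idx n) :
    rightMat r n (tgen i a) c c' = ∑ x, Rmat x c' c a • tgen i x := by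
  rw [rightMat, Alift_tgen, extendRows_of_pos _ hi, moveRight_apply]

theorem sum_Rmat_single {D : Type*} [AddCommGroup D] [Module Kq D] (t : D) (b' a' x y : Idx n) :
    ∑ u, ∑ v, Rmat b' a' u v • (if x = u then (if y = v then t else 0) else 0) =
      Rmat b' a' x y • t := by
  rw [Finset.sum_eq_single x, Finset.sum_eq_single y] <;> simp +contextual [eq_comm]

theorem leftMat_leftMat_tgen {i : Idx r} (hi : 0 < i.1) (c b' a' u v : Idx n) :
    leftMat r n (leftMat r n (tgen i c) b' u) a' v =
      R12 (R23 fun x y z => if x = b' then (if y = a' then tgen i z else 0) else 0) c u v := by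
  rw [R23_single, R12_apply,
    R_single_left fun y => R (fun y z => if y = a' then tgen i z else 0) y v, leftMat_tgen hi]
  have h := map_sum (Matrix.entryLinearMap Kq (Acoord r n) a' v ∘ₗ (leftMat r n).toLinearMap)
    (fun y => Rmat b' y c u • tgen i y) Finset.univ
  refine h.trans (Finset.sum_congr rfl fun y _ => ?_)
  rw [map_smul, R_single_left]
  congr 1
  exact leftMat_tgen hi y a' v

theorem rightMat_rightMat_tgen {i : Idx r} (hi : 0 < i.1) (a b c a' b' : Idx n) :
    rightMat r n (rightMat r n (tgen i c) b b') a a' =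
      R23 (R12 fun x y z => if z = b' then (if y = a' then tgen i x else 0) else 0) a b c := by
  rw [R12_single, R23_apply,
    R_single_right fun y => R (fun x y => if y = a' then tgen i x else 0) a y, rightMat_tgen hi]
  have h := map_sum (Matrix.entryLinearMap Kq (Acoord r n) a a' ∘ₗ (rightMat r n).toLinearMap)
    (fun y => Rmat y b' b c • tgen i y) Finset.univ
  refine h.trans (Finset.sum_congr rfl fun y _ => ?_)
  rw [map_smul, R_single_right]
  congr 1
  exact rightMat_tgen hi y a a'

/-- If the iterate of a matrix-valued homomorphism commutes with a scalar matrix on generators, it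
does so everywhere. -/
theorem iterate_commute (F : Acoord r n →ₐ[Kq] Matrix (Idx n) (Idx n) (Acoord r n))
    (s : Idx n × Idx n → Idx n × Idx n → Kq)
    (h : ∀ (i : Idx r) (a : Idx n), 0 < i.1 → ∀ u v w z : Idx n,
      ∑ x, ∑ y, s (x, y) (w, z) • F (F (tgen i a) u x) v y =
        ∑ x, ∑ y, s (u, v) (x, y) • F (F (tgen i a) x w) y z) (t : Acoord r n) (u v w z : Idx n) :
    ∑ x, ∑ y, s (x, y) (w, z) • F (F t u x) v y =
      ∑ x, ∑ y, s (u, v) (x, y) • F (F t x w) y z := by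
  -- A matrix of matrices is read as one matrix indexed by pairs, so the iterate of F is itself an
  -- algebra homomorphism. The elements whose image commutes with a fixed matrix then form a
  -- subalgebra, and generators suffice.
  let G : Acoord r n →ₐ[Kq] Matrix (Idx n × Idx n) (Idx n × Idx n) (Acoord r n) :=
    (Matrix.compAlgEquiv (Idx n) (Idx n) (Acoord r n) Kq).toAlgHom.comp (F.mapMatrix.comp F)
  let M : Matrix (Idx n × Idx n) (Idx n × Idx n) (Acoord r n) :=
    Matrix.of fun p p' => algebraMap Kq (Acoord r n) (s p p')
  have e1 : ∀ t u v w z, (G t * M) (u, v) (w, z) =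
      ∑ x, ∑ y, s (x, y) (w, z) • F (F t u x) v y := by
    intro t u v w z
    rw [Matrix.mul_apply, Fintype.sum_prod_type]
    refine Finset.sum_congr rfl fun x _ => Finset.sum_congr rfl fun y _ => ?_
    rw [Algebra.smul_def, Algebra.commutes]
    rfl
  have e2 : ∀ t u v w z, (M * G t) (u, v) (w, z) =
      ∑ x, ∑ y, s (u, v) (x, y) • F (F t x w) y z := by
    intro t u v w z
    rw [Matrix.mul_apply, Fintype.sum_prod_type]
    refine Finset.sum_congr rfl fun x _ => Finset.sum_congr rfl fun y _ => ?_
    rw [Algebra.smul_def]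
    rfl
  have key : (⊤ : Subalgebra Kq (Acoord r n)) ≤ (Subalgebra.centralizer Kq {M}).comap G := by
    rw [← adjoin_tgen, Algebra.adjoin_le_iff]
    rintro _ ⟨i, a, hi, rfl⟩
    change G (tgen i a) ∈ Subalgebra.centralizer Kq {M}
    rw [Subalgebra.mem_centralizer_iff]
    rintro _ rfl
    ext ⟨u, v⟩ ⟨w, z⟩
    rw [e1, e2]
    exact (h i a hi u v w z).symm
  have h1 : G t ∈ Subalgebra.centralizer Kq {M} := key (Algebra.mem_top (x := t))
  rw [Subalgebra.mem_centralizer_iff] at h1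
  rw [← e1, ← e2, h1 M rfl]

/-- On a generator the iterate of `leftMat` carries two auxiliary indices past a row; by the braid
relation they may be exchanged before or after. This becomes the relation between L, L and S in
`Lop_sll`. -/
theorem leftMat_comm (t : Acoord r n) (b' a' a b : Idx n) :
    R (fun u v => leftMat r n (leftMat r n t b' u) a' v) a b =
      ∑ u, ∑ v, Rmat b' a' u v • leftMat r n (leftMat r n t u a) v b := by
  refine iterate_commute (leftMat r n) (fun p p' => Rmat p.1 p.2 p'.1 p'.2) ?_ t b' a' a b
  intro i c hi b' a' a b
  simp only [leftMat_leftMat_tgen hi]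
  refine (R_def (R12 (R23 _) c) a b).symm.trans ?_
  rw [← R23_apply (R12 _), ← braid]
  -- After `braid` the innermost operator acts on an elementary function, where it is a scalar
  -- combination of elementary functions; linearity brings the scalars outside.
  have e : R12 (fun x y z => if x = b' then (if y = a' then tgen i z else 0) else 0) =
      ∑ u, ∑ v, Rmat b' a' u v •
        fun x y z => if x = u then (if y = v then tgen (n := n) i z else 0) else 0 := by
    funext x y z
    simp only [Finset.sum_apply, Pi.smul_apply]
    rw [sum_Rmat_single, R12_apply,
      R_single_left (fun y => if y = a' then tgen i z else 0), Finset.sum_eq_single a'] <;>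
      simp +contextual
  rw [e]
  simp only [map_sum, map_smul, Finset.sum_apply, Pi.smul_apply]

/-- This is the mirror image of `leftMat_comm`. It ensures that the operators by which the lower
rows act on A_{r,n} ⊗ A_{k,n} satisfy the relations among themselves. -/
theorem rightMat_comm (t : Acoord r n) (a b a' b' : Idx n) :
    ∑ u, ∑ v, Rmat b' a' u v • rightMat r n (rightMat r n t b v) a u =
      R (fun u v => rightMat r n (rightMat r n t v a') u b') a b := by
  -- The index that passes first is the outer one on the right, so both pairs enter the scalar
  -- matrix in reversed order.
  have key := iterate_commute (rightMat r n) (fun p p' => Rmat p'.2 p'.1 p.2 p.1) ?_ t b a a' b'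
  · rw [Finset.sum_comm, key, R_def, Finset.sum_comm]
  intro i c hi b a a' b'
  simp only [rightMat_rightMat_tgen hi]
  have e : R23 (fun x y z => if z = a' then (if y = b' then tgen i x else 0) else 0) =
      ∑ u, ∑ v, Rmat b' a' v u •
        fun x y z => if z = u then (if y = v then tgen (n := n) i x else 0) else 0 := by
    funext x y z
    simp only [Finset.sum_apply, Pi.smul_apply]
    rw [Finset.sum_eq_single z, Finset.sum_eq_single y, R23_apply, R_def,
      Finset.sum_eq_single b', Finset.sum_eq_single a'] <;> simp +contextual [eq_comm]
  have e2 := congrFun (congrFun (congrFun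
    (braid (fun x y z => if z = a' then (if y = b' then tgen i x else 0) else 0)) a) b) c
  rw [e] at e2
  simp only [map_sum, map_smul, Finset.sum_apply, Pi.smul_apply] at e2
  rw [← e2, R12_apply, R_def, Finset.sum_comm]

end Operators
end QueerBraided

namespace QueerBraided

/-! ### The exchange rule in A_{r+k,n} and surjectivity of σ -/

section Sigma

variable (r k n : ℕ)

/-- The homomorphism `ι_k : A_{r,n} → A_{r+k,n}` onto the upper rows. -/
noncomputable abbrev iotaUp : Acoord r n →ₐ[Kq] Acoord (r + k) n :=
  iota (r := r) (m := r + k) k (by omega) n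

/-- The homomorphism `ι_0 : A_{k,n} → A_{r+k,n}` onto the lower rows. -/
noncomputable abbrev iotaLow : Acoord k n →ₐ[Kq] Acoord (r + k) n :=
  iota (r := k) (m := r + k) 0 (by omega) n

/-- The index of an upper row. -/
abbrev rowUp (i : Idx r) : Idx (r + k) := shift (m := r + k) k (by omega) i

/-- The index of a lower row. -/
abbrev rowLow (j : Idx k) : Idx (r + k) := shift (m := r + k) 0 (by omega) j

variable {r k n}

theorem rowUp_val {i : Idx r} (hi : 0 < i.1) : (rowUp r k i).1 = k + i.1 := by
  rw [shift_val, if_pos hi]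

theorem rowLow_val {j : Idx k} (hj : 0 < j.1) : (rowLow r k j).1 = j.1 := by
  rw [shift_val, if_pos hj]; simp

theorem row_cases (i : Idx (r + k)) (hi : 0 < i.1) :
    (∃ j : Idx k, 0 < j.1 ∧ i = rowLow r k j) ∨ ∃ i' : Idx r, 0 < i'.1 ∧ i = rowUp r k i' := by
  have h := i.2
  simp only [Finset.mem_erase, Finset.mem_Icc, Nat.cast_add] at h
  by_cases hk : i.1 ≤ k
  · left
    refine ⟨⟨i.1, ?_⟩, hi, ?_⟩
    · simp only [Finset.mem_erase, Finset.mem_Icc]; omega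
    · exact idx_eq_iff.2 (rowLow_val (r := r) (k := k) (j := ⟨i.1, _⟩) hi).symm
  · right
    have hi' : 0 < i.1 - k := by omega
    refine ⟨⟨i.1 - k, ?_⟩, hi', ?_⟩
    · simp only [Finset.mem_erase, Finset.mem_Icc]; omega
    · refine idx_eq_iff.2 (Eq.trans ?_ (rowUp_val (r := r) (k := k) (i := ⟨i.1 - k, _⟩) hi').symm)
      simp

theorem idx_le (j : Idx k) : j.1 ≤ k := by
  have h := j.2
  simp only [Finset.mem_erase, Finset.mem_Icc] at h
  omega

theorem low_mul_up_tgen {j : Idx k} {i : Idx r} (hj : 0 < j.1) (hi : 0 < i.1) (b a : Idx n) :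
    iotaLow r k n (tgen j b) * iotaUp r k n (tgen i a) =
      ∑ y, iotaUp r k n (rightMat r n (tgen i a) b y) * iotaLow r k n (tgen j y) := by
  have h := congrFun₂ (isCoordMatrix_tgen (r := r + k) (n := n) |>.lt (rowLow r k j) (rowUp r k i)
    (by rw [rowLow_val hj]; exact hj)
    (by rw [rowLow_val hj, rowUp_val hi]; have := idx_le j; omega)) b a
  rw [iota_tgen, iota_tgen]
  refine h.trans ?_
  rw [R_def, Finset.sum_comm]
  refine Finset.sum_congr rfl fun y _ => ?_
  rw [rightMat_tgen hi, map_sum, Finset.sum_mul]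
  refine Finset.sum_congr rfl fun x _ => ?_
  rw [map_smul, smul_mul_assoc, iota_tgen, iota_tgen, rowMul]

/-- For x a generator this is the relation between the rows j and k + i, and it extends to products
because `rightMat` is multiplicative. It is the rule by which the braiding sorts products. -/
theorem low_mul_up {j : Idx k} (hj : 0 < j.1) (x : Acoord r n) (b : Idx n) :
    iotaLow r k n (tgen j b) * iotaUp r k n x =
      ∑ y, iotaUp r k n (rightMat r n x b y) * iotaLow r k n (tgen j y) := by
  -- D b measures the failure of the rule. The induction must treat all b together, since passing a
  -- generator changes the column index.
  let D (b : Idx n) : Acoord r n →ₗ[Kq] Acoord (r + k) n :=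
    LinearMap.mulLeft Kq (iotaLow r k n (tgen j b)) ∘ₗ (iotaUp r k n).toLinearMap -
      ∑ y, LinearMap.mulRight Kq (iotaLow r k n (tgen j y)) ∘ₗ (iotaUp r k n).toLinearMap ∘ₗ
        Matrix.entryLinearMap Kq (Acoord r n) b y ∘ₗ (rightMat r n).toLinearMap
  have hD : ∀ b x, D b x = iotaLow r k n (tgen j b) * iotaUp r k n x -
      ∑ y, iotaUp r k n (rightMat r n x b y) * iotaLow r k n (tgen j y) := by
    intro b x
    simp [D, LinearMap.sum_apply]
  have key : ∀ x : Acoord r n, x ∈ ⨅ b, LinearMap.ker (D b) := by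
    refine mem_of_tgen_mul_mem ?_ fun i a hi x hx => ?_
    · simp only [Submodule.mem_iInf, LinearMap.mem_ker, hD, map_one, sub_eq_zero]
      intro b
      rw [Finset.sum_eq_single b]
      · simp
      · intro y _ hy
        simp [Matrix.one_apply_ne' hy]
      · simp
    · simp only [Submodule.mem_iInf, LinearMap.mem_ker, hD, sub_eq_zero] at hx ⊢
      intro b
      rw [map_mul, ← mul_assoc, low_mul_up_tgen hj hi, Finset.sum_mul]
      simp only [mul_assoc, hx, Finset.mul_sum]
      rw [Finset.sum_comm]
      refine Finset.sum_congr rfl fun z _ => ?_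
      rw [map_mul, Matrix.mul_apply, map_sum, Finset.sum_mul]
      refine Finset.sum_congr rfl fun y _ => ?_
      rw [map_mul, mul_assoc]
  have h := key x
  simp only [Submodule.mem_iInf, LinearMap.mem_ker, hD, sub_eq_zero] at h
  exact h b

theorem sigma_tmul (x : Acoord r n) (y : Acoord k n) :
    sigma r k n (x ⊗ₜ y) = iotaUp r k n x * iotaLow r k n y := rfl

/-- The image contains 1 and is stable under left multiplication by generators: an upper generator
is absorbed into x, and a lower one is first carried past ι_k(x) by `low_mul_up`. -/
theorem sigma_surjective : Function.Surjective (sigma r k n) := by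
  rw [← LinearMap.range_eq_top, eq_top_iff]
  rintro z -
  refine mem_of_tgen_mul_mem (W := LinearMap.range (sigma r k n))
    ⟨1 ⊗ₜ 1, by simp [sigma_tmul]⟩ (fun i a hi z hz => ?_) z
  obtain ⟨w, rfl⟩ := hz
  induction w using TensorProduct.induction_on with
  | zero => simp
  | add w w' h h' => rw [map_add, mul_add]; exact add_mem h h'
  | tmul x y =>
    rw [sigma_tmul]
    rcases row_cases i hi with ⟨j, hj, rfl⟩ | ⟨i, hi, rfl⟩
    · rw [← iota_tgen (r := k) (m := r + k) 0 (by omega), ← mul_assoc, low_mul_up hj,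
        Finset.sum_mul]
      refine Submodule.sum_mem _ fun b _ => ?_
      exact ⟨rightMat r n x a b ⊗ₜ (tgen j b * y), by rw [sigma_tmul, map_mul, mul_assoc]⟩
    · rw [← iota_tgen (r := r) (m := r + k) k (by omega)]
      exact ⟨(tgen i a * x) ⊗ₜ y, by rw [sigma_tmul, map_mul, mul_assoc]⟩

end Sigma

/-! ### A representation of A_{r+k,n} on the tensor product, and injectivity of σ -/

section Retraction

variable {r k n : ℕ} {A B : Type*} [Ring A] [Algebra Kq A] [Ring B] [Algebra Kq B]

variable (B) in
/-- The operator on `A ⊗ B` by which an element of an upper row acts. -/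
noncomputable def opUp (f : Idx n → A) (a : Idx n) : Module.End Kq (A ⊗[Kq] B) :=
  (LinearMap.mulLeft Kq (f a)).rTensor B

/-- The operator on `A ⊗ B` by which an element of a lower row acts. -/
noncomputable def opLow (P : A →ₐ[Kq] Matrix (Idx n) (Idx n) A) (f : Idx n → B) (b : Idx n) :
    Module.End Kq (A ⊗[Kq] B) :=
  ∑ y, TensorProduct.map (Matrix.entryLinearMap Kq A b y ∘ₗ P.toLinearMap)
    (LinearMap.mulLeft Kq (f y))

theorem opUp_tmul (f : Idx n → A) (a : Idx n) (x : A) (y : B) :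
    opUp B f a (x ⊗ₜ[Kq] y) = (f a * x) ⊗ₜ y := rfl

theorem opLow_tmul (P : A →ₐ[Kq] Matrix (Idx n) (Idx n) A) (f : Idx n → B) (b : Idx n) (x : A)
    (y : B) : opLow P f b (x ⊗ₜ[Kq] y) = ∑ z, P x b z ⊗ₜ (f z * y) := by
  rw [opLow, LinearMap.sum_apply]
  rfl

theorem R_end_apply {D : Type*} [AddCommGroup D] [Module Kq D]
    (F : Idx n → Idx n → Module.End Kq D) (a b : Idx n) (x : D) :
    R F a b x = R (fun u v => F u v x) a b :=
  map_R (LinearMap.applyₗ x) F a b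

theorem R_opUp_mul (f g : Idx n → A) (a b : Idx n) (x : A) (y : B) :
    R (fun a b => opUp B f a * opUp B g b) a b (x ⊗ₜ y) =
      (R (fun u v => f u * g v) a b * x) ⊗ₜ y := by
  rw [R_end_apply]
  refine Eq.trans ?_ (map_R ((TensorProduct.mk Kq A B).flip y ∘ₗ LinearMap.mulRight Kq x)
    (fun u v => f u * g v) a b).symm
  refine congrArg (fun F => R F a b) (funext₂ fun u v => ?_)
  simp [opUp_tmul, mul_assoc]

theorem opLow_mul (P : A →ₐ[Kq] Matrix (Idx n) (Idx n) A) (f g : Idx n → B) (a b : Idx n)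
    (x : A) (y : B) : (opLow P f a * opLow P g b) (x ⊗ₜ y) =
      ∑ u, ∑ v, P (P x b v) a u ⊗ₜ[Kq] (f u * g v * y) := by
  rw [Module.End.mul_apply, opLow_tmul, map_sum]
  simp only [opLow_tmul]
  rw [Finset.sum_comm]
  simp only [mul_assoc]

/-- The hypothesis on P lets `R` pass from the outer indices of the iterated matrix to its inner
ones. There it meets the products f_u g_v and acts on them, so relations between rows in B become
relations between operators. -/
theorem R_opLow_mul {P : A →ₐ[Kq] Matrix (Idx n) (Idx n) A}
    (hP : ∀ t a b a' b', ∑ u, ∑ v, Rmat b' a' u v • P (P t b v) a u =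
      R (fun u v => P (P t v a') u b') a b) (f g : Idx n → B) (a b : Idx n) (x : A) (y : B) :
    R (fun a b => opLow P f a * opLow P g b) a b (x ⊗ₜ y) =
      ∑ u, ∑ v, P (P x b v) a u ⊗ₜ[Kq] (R (fun u v => f u * g v) u v * y) := by
  rw [R_end_apply]
  simp only [opLow_mul]
  calc R (fun a b => ∑ u, ∑ v, P (P x b v) a u ⊗ₜ[Kq] (f u * g v * y)) a b
      = ∑ u, ∑ v, R (fun a b => P (P x b v) a u) a b ⊗ₜ[Kq] (f u * g v * y) := by
        simp only [R_def, Finset.smul_sum, TensorProduct.sum_tmul, TensorProduct.smul_tmul']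
        rw [sum_sum_comm']
    _ = ∑ u, ∑ v, (∑ u', ∑ v', Rmat u v u' v' • P (P x b v') a u') ⊗ₜ[Kq] (f u * g v * y) := by
        refine Finset.sum_congr rfl fun u _ => Finset.sum_congr rfl fun v _ => ?_
        rw [← hP]
    _ = _ := by
        simp only [R_def, Finset.sum_mul, TensorProduct.sum_tmul, TensorProduct.tmul_sum,
          TensorProduct.smul_tmul, smul_mul_assoc]
        rw [sum_sum_comm']

theorem opLow_mul_opUp {P : A →ₐ[Kq] Matrix (Idx n) (Idx n) A} {f : Idx n → A}
    (hf : ∀ a, P (f a) = moveRight f a) (g : Idx n → B) (a b : Idx n) (x : A) (y : B) :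
    (opLow P g a * opUp B f b) (x ⊗ₜ y) =
      R (fun a b => opUp B f a * opLow P g b) a b (x ⊗ₜ y) := by
  rw [R_end_apply, Module.End.mul_apply, opUp_tmul, opLow_tmul, R_def]
  simp only [Module.End.mul_apply, opLow_tmul, map_sum, opUp_tmul, map_mul, hf, Matrix.mul_apply,
    moveRight_apply, Finset.sum_mul, TensorProduct.sum_tmul, Finset.smul_sum, smul_mul_assoc,
    TensorProduct.smul_tmul']
  calc _ = ∑ v, ∑ z, ∑ u, Rmat u v a b • ((f u * P x v z) ⊗ₜ[Kq] (g z * y)) := Finset.sum_comm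
    _ = ∑ v, ∑ u, ∑ z, Rmat u v a b • ((f u * P x v z) ⊗ₜ[Kq] (g z * y)) :=
      Finset.sum_congr rfl fun v _ => Finset.sum_comm
    _ = _ := Finset.sum_comm

/-- The rows `1, …, r + k` of operators by which the generators of `A_{r+k,n}` act on `A ⊗ B`. -/
noncomputable def opRow (P : A →ₐ[Kq] Matrix (Idx n) (Idx n) A) (TA : Idx r → Idx n → A)
    (TB : Idx k → Idx n → B) (i : Idx (r + k)) (a : Idx n) : Module.End Kq (A ⊗[Kq] B) :=
  if h : 0 < i.1 ∧ i.1 ≤ k then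
    opLow P (TB ⟨i.1, by simp only [Finset.mem_erase, Finset.mem_Icc]; omega⟩) a
  else if h : k < i.1 then
    opUp B (TA ⟨i.1 - k, by
      have := idx_le i
      simp only [Finset.mem_erase, Finset.mem_Icc]; omega⟩) a
  else 0

variable {P : A →ₐ[Kq] Matrix (Idx n) (Idx n) A} {TA : Idx r → Idx n → A} {TB : Idx k → Idx n → B}

theorem opRow_rowLow {j : Idx k} (hj : 0 < j.1) :
    opRow P TA TB (rowLow r k j) = opLow P (TB j) := by
  have h := rowLow_val (r := r) hj
  have := idx_le j
  funext a
  rw [opRow, dif_pos (by omega)]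
  congr 2
  exact idx_eq_iff.2 h

theorem opRow_rowUp {i : Idx r} (hi : 0 < i.1) :
    opRow P TA TB (rowUp r k i) = opUp B (TA i) := by
  have h := rowUp_val (k := k) hi
  funext a
  rw [opRow, dif_neg (by omega), dif_pos (by omega)]
  congr 2
  refine idx_eq_iff.2 ?_
  change (rowUp r k i).1 - k = i.1
  omega

/-- Relations between two upper rows come from A, and those between two lower rows from B by
`R_opLow_mul`. The mixed ones are the exchange rule, which is built into the value of P on the rows
of A. -/
theorem isCoordMatrix_opRow
    (hP : ∀ t a b a' b', ∑ u, ∑ v, Rmat b' a' u v • P (P t b v) a u =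
      R (fun u v => P (P t v a') u b') a b)
    (hPT : ∀ i, 0 < i.1 → ∀ a, P (TA i a) = moveRight (TA i) a)
    (hA : IsCoordMatrix TA) (hB : IsCoordMatrix TB) :
    IsCoordMatrix (extendRows (opRow P TA TB)) := by
  refine isCoordMatrix_extendRows (fun i j hi hij => ?_) fun i hi => ?_
  · funext a b
    refine TensorProduct.ext' fun x y => ?_
    unfold rowMul
    rcases row_cases j (by omega) with ⟨j, hj, rfl⟩ | ⟨j, hj, rfl⟩
    · rcases row_cases i hi with ⟨i, hi', rfl⟩ | ⟨i, hi', rfl⟩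
      · rw [rowLow_val hi', rowLow_val hj] at hij
        simp only [opRow_rowLow hi', opRow_rowLow hj]
        rw [R_opLow_mul hP, opLow_mul]
        have e : R (fun u v => TB j u * TB i v) = fun u v => TB i u * TB j v :=
          (hB.lt i j hi' hij).symm
        rw [e]
      · rw [rowUp_val hi', rowLow_val hj] at hij
        have := idx_le j
        omega
    · rcases row_cases i hi with ⟨i, hi', rfl⟩ | ⟨i, hi', rfl⟩
      · simp only [opRow_rowLow hi', opRow_rowUp hj]
        exact opLow_mul_opUp (hPT j hj) (TB i) a b x y
      · rw [rowUp_val hi', rowUp_val hj] at hij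
        simp only [opRow_rowUp hi', opRow_rowUp hj]
        have e : R (fun u v => TA j u * TA i v) = fun u v => TA i u * TA j v :=
          (hA.lt i j hi' (by omega)).symm
        rw [R_opUp_mul, e, Module.End.mul_apply, opUp_tmul, opUp_tmul, mul_assoc]
  · funext a b
    refine TensorProduct.ext' fun x y => ?_
    unfold rowMul
    simp only [Pi.smul_apply, LinearMap.smul_apply]
    rcases row_cases i hi with ⟨i, hi', rfl⟩ | ⟨i, hi', rfl⟩
    · simp only [opRow_rowLow hi']
      have e : R (fun u v => TB i u * TB i v) = q • fun u v => TB i u * TB i v :=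
        (hB.self i hi').symm
      rw [R_opLow_mul hP, opLow_mul, e]
      simp only [Finset.smul_sum, Pi.smul_apply, smul_mul_assoc, TensorProduct.tmul_smul]
    · simp only [opRow_rowUp hi']
      have e : R (fun u v => TA i u * TA i v) = q • fun u v => TA i u * TA i v :=
        (hA.self i hi').symm
      rw [R_opUp_mul, e, Module.End.mul_apply, opUp_tmul, opUp_tmul, Pi.smul_apply, Pi.smul_apply,
        smul_mul_assoc, mul_assoc, TensorProduct.smul_tmul']

/-- A linear map out of `A_{r+k,n}` that recovers `x ⊗ y` from `ι_k(x) ι_0(y)`. -/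
theorem exists_retraction
    (hP : ∀ t a b a' b', ∑ u, ∑ v, Rmat b' a' u v • P (P t b v) a u =
      R (fun u v => P (P t v a') u b') a b)
    (hPT : ∀ i, 0 < i.1 → ∀ a, P (TA i a) = moveRight (TA i) a)
    (hA : IsCoordMatrix TA) (hB : IsCoordMatrix TB) :
    ∃ τ : Acoord (r + k) n →ₗ[Kq] A ⊗[Kq] B, ∀ x y,
      τ (iotaUp r k n x * iotaLow r k n y) = Alift TA hA x ⊗ₜ Alift TB hB y := by
  let ρ := Alift _ (isCoordMatrix_opRow hP hPT hA hB)
  -- The retraction evaluates the representation at 1 ⊗ 1. Since P 1 is the identity matrix, a lower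
  -- row acts on 1 ⊗ y by plain left multiplication; an upper row always multiplies the first
  -- factor.
  refine ⟨LinearMap.applyₗ (1 ⊗ₜ[Kq] 1) ∘ₗ ρ.toLinearMap, fun x y => ?_⟩
  have hup : ∀ (x : Acoord r n) (a : A) (b : B),
      ρ (iotaUp r k n x) (a ⊗ₜ b) = (Alift TA hA x * a) ⊗ₜ b := by
    intro x a b
    let f : Acoord r n →ₗ[Kq] A ⊗[Kq] B :=
      LinearMap.applyₗ (a ⊗ₜ[Kq] b) ∘ₗ (ρ.comp (iotaUp r k n)).toLinearMap
    let g : Acoord r n →ₗ[Kq] A ⊗[Kq] B :=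
      (TensorProduct.mk Kq A B).flip b ∘ₗ LinearMap.mulRight Kq a ∘ₗ (Alift TA hA).toLinearMap
    refine mem_of_tgen_mul_mem (W := LinearMap.eqLocus f g) ?_ (fun i c hi x hx => ?_) x
    · change ρ (iotaUp r k n 1) (a ⊗ₜ b) = (Alift TA hA 1 * a) ⊗ₜ b
      rw [map_one, map_one, map_one, one_mul, Module.End.one_apply]
    · change ρ (iotaUp r k n x) (a ⊗ₜ b) = (Alift TA hA x * a) ⊗ₜ b at hx
      change ρ (iotaUp r k n (tgen i c * x)) (a ⊗ₜ b) = (Alift TA hA (tgen i c * x) * a) ⊗ₜ b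
      rw [map_mul, map_mul, Module.End.mul_apply, hx, iota_tgen, Alift_tgen,
        extendRows_of_pos _ (by rw [rowUp_val hi]; omega), opRow_rowUp hi, opUp_tmul, map_mul,
        Alift_tgen, mul_assoc]
  have hlow : ∀ y : Acoord k n, ρ (iotaLow r k n y) (1 ⊗ₜ 1) = 1 ⊗ₜ Alift TB hB y := by
    intro y
    let f : Acoord k n →ₗ[Kq] A ⊗[Kq] B :=
      LinearMap.applyₗ (1 ⊗ₜ[Kq] 1) ∘ₗ (ρ.comp (iotaLow r k n)).toLinearMap
    let g : Acoord k n →ₗ[Kq] A ⊗[Kq] B :=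
      TensorProduct.mk Kq A B 1 ∘ₗ (Alift TB hB).toLinearMap
    refine mem_of_tgen_mul_mem (W := LinearMap.eqLocus f g) ?_ (fun i c hi y hy => ?_) y
    · change ρ (iotaLow r k n 1) (1 ⊗ₜ 1) = 1 ⊗ₜ Alift TB hB 1
      rw [map_one, map_one, map_one, Module.End.one_apply]
    · change ρ (iotaLow r k n y) (1 ⊗ₜ 1) = 1 ⊗ₜ Alift TB hB y at hy
      change ρ (iotaLow r k n (tgen i c * y)) (1 ⊗ₜ 1) = 1 ⊗ₜ Alift TB hB (tgen i c * y)
      rw [map_mul, map_mul, Module.End.mul_apply, hy, iota_tgen, Alift_tgen,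
        extendRows_of_pos _ (by rw [rowLow_val hi]; omega), opRow_rowLow hi, opLow_tmul, map_mul,
        Alift_tgen, map_one, Finset.sum_eq_single c]
      · rw [Matrix.one_apply_eq]
      · intro z _ hz
        rw [Matrix.one_apply_ne' hz, TensorProduct.zero_tmul]
      · simp
  change ρ (iotaUp r k n x * iotaLow r k n y) (1 ⊗ₜ 1) = _
  rw [map_mul, Module.End.mul_apply, hlow, hup, mul_one]

end Retraction

theorem Alift_tgen_eq_id {r n : ℕ} :
    Alift (tgen (r := r) (n := n)) isCoordMatrix_tgen = AlgHom.id Kq _ :=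
  Acoord_algHom_ext fun i a _ => by rw [Alift_tgen, AlgHom.id_apply]

theorem sigma_injective {r k n : ℕ} : Function.Injective (sigma r k n) := by
  obtain ⟨τ, hτ⟩ := exists_retraction (P := rightMat r n) (TA := tgen (r := r))
    (TB := tgen (r := k)) rightMat_comm
    (fun i hi a => by rw [rightMat, Alift_tgen, extendRows_of_pos _ hi])
    isCoordMatrix_tgen isCoordMatrix_tgen
  refine Function.LeftInverse.injective (g := τ) fun z => ?_
  have key : τ ∘ₗ sigma r k n = LinearMap.id := by
    refine TensorProduct.ext' fun x y => ?_
    refine (hτ x y).trans ?_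
    rw [Alift_tgen_eq_id, Alift_tgen_eq_id]
    rfl
  exact LinearMap.congr_fun key z

theorem sigma_bijective (r k n : ℕ) : Function.Bijective (sigma r k n) :=
  ⟨sigma_injective, sigma_surjective⟩

end QueerBraided

namespace QueerBraided

/-! ### Induction over homogeneous elements -/

section Graded

theorem sum_sgn_proj {A : Type*} [Ring A] [Algebra Kq A] (gr : ZMod 2 → Submodule Kq A)
    [GradedAlgebra gr] (e : ZMod 2) {f : ZMod 2} {x : A} (hx : x ∈ gr f) :
    (∑ d : ZMod 2, sgn (e * d) • GradedAlgebra.proj gr d) x = sgn (e * f) • x := by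
  rw [LinearMap.sum_apply, Finset.sum_eq_single f]
  · rw [LinearMap.smul_apply, GradedAlgebra.proj_apply, DirectSum.decompose_of_mem_same _ hx]
  · intro d _ hd
    rw [LinearMap.smul_apply, GradedAlgebra.proj_apply, DirectSum.decompose_of_mem_ne _ hx hd.symm,
      smul_zero]
  · simp

/-- A graded subspace that contains `1` and is stable under left multiplication by the generators
contains everything. -/
theorem presGrading_le {X : Type} {p : X → ZMod 2}
    {rel : FreeAlgebra Kq X → FreeAlgebra Kq X → Prop} {W : ZMod 2 → Submodule Kq (RingQuot rel)}
    (h1 : 1 ∈ W 0)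
    (h : ∀ x d, ∀ y ∈ W d, RingQuot.mkAlgHom Kq rel (FreeAlgebra.ι Kq x) * y ∈ W (p x + d))
    (d : ZMod 2) : presGrading p rel d ≤ W d := by
  rw [presGrading, Submodule.map_le_iff_le_comap, freeGrading, Submodule.span_le]
  rintro _ ⟨l, rfl, rfl⟩
  change RingQuot.mkAlgHom Kq rel _ ∈ W _
  induction l with
  | nil => simpa using h1
  | cons x l ih =>
    simp only [List.map_cons, List.prod_cons, List.sum_cons, map_mul]
    exact h x _ _ ih

/-- A generator of a negative row equals one of a positive row with the opposite column, so it is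
enough to treat positive rows, where t_{ia} has the parity of a. -/
theorem Agr_le {r n : ℕ} {W : ZMod 2 → Submodule Kq (Acoord r n)} (h1 : 1 ∈ W 0)
    (h : ∀ (i : Idx r) (a : Idx n), 0 < i.1 → ∀ d, ∀ x ∈ W d, tgen i a * x ∈ W (par a + d))
    (d : ZMod 2) : Agr r n d ≤ W d := by
  refine presGrading_le h1 ?_ d
  rintro ⟨i, a⟩ d x hx
  change tgen i a * x ∈ W (par i + par a + d)
  rcases lt_or_gt_of_ne (idx_ne_zero i) with hi | hi
  · rw [tgen_neg, par_of_neg hi, add_comm 1, ← par_neg]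
    exact h _ _ (by rw [neg_val]; omega) d x hx
  · rw [par_of_pos hi, zero_add]
    exact h i a hi d x hx

theorem tgen_mem {r n : ℕ} (i : Idx r) (a : Idx n) : tgen i a ∈ Agr r n (par i + par a) :=
  ⟨_, freeT_mem i a, rfl⟩

theorem graded_induction {A : Type*} [Ring A] [Algebra Kq A] (gr : ZMod 2 → Submodule Kq A)
    [GradedAlgebra gr] {W : Submodule Kq A} (h : ∀ d, gr d ≤ W) (x : A) : x ∈ W := by
  induction x using DirectSum.Decomposition.inductionOn gr with
  | zero => exact zero_mem _
  | homogeneous x => exact h _ x.2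
  | add x y hx hy => exact add_mem hx hy

theorem Lgen_induction {n : ℕ} {W : Submodule Kq (Uq n)} (h1 : 1 ∈ W)
    (h : ∀ i j, ∀ u ∈ W, Lgen i j * u ∈ W) (u : Uq n) : u ∈ W := by
  refine graded_induction (Ugr n) (presGrading_le (W := fun _ => W) h1 ?_) u
  rintro ⟨⟨i, j⟩, hij⟩ d u hu
  have e : Lgen i j = RingQuot.mkAlgHom Kq (URel n) (FreeAlgebra.ι Kq ⟨(i, j), hij⟩) := by
    rw [Lgen, freeL, dif_pos hij]
  rw [← e]
  exact h i j u hu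

theorem Ugr_le {n : ℕ} {W : ZMod 2 → Submodule Kq (Uq n)} (h1 : 1 ∈ W 0)
    (h : ∀ i j d, ∀ u ∈ W d, Lgen i j * u ∈ W (par i + par j + d)) (d : ZMod 2) :
    Ugr n d ≤ W d := by
  refine presGrading_le h1 ?_ d
  rintro ⟨⟨i, j⟩, hij⟩ d u hu
  have e : Lgen i j = RingQuot.mkAlgHom Kq (URel n) (FreeAlgebra.ι Kq ⟨(i, j), hij⟩) := by
    rw [Lgen, freeL, dif_pos hij]
  rw [← e]
  exact h i j d u hu

end Graded

/-! ### Parity, triangularity and diagonal entries of `leftMat` -/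

section Parity

variable {n : ℕ}

theorem Rmat_parity {x y a b : Idx n} (h : Rmat x y a b ≠ 0) :
    par x + par y + par a + par b = 0 := by
  have := Smat_parity (right_ne_zero_of_mul h)
  rw [← this]
  ring

theorem Rmat_eq_zero_of_not_le {x y a b : Idx n} (h : ¬ x ≤ b) : Rmat x y a b = 0 := by
  rw [Rmat, Smat, if_neg (fun h' => h h'.2.le), if_neg (fun h' => h h'.le), add_zero, mul_zero]

theorem Rmat_self (x y a : Idx n) :
    Rmat x y a x = if y = a then sgn (par x * par a) * q ^ phi a x else 0 := by
  rw [Rmat, Smat]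
  simp only [lt_irrefl, if_false, add_zero, and_true, CharTwo.add_self_eq_zero, zero_mul, zero_add]
  split_ifs with h
  · rw [h]
  · simp

theorem phi_neg_right (a b : Idx n) : phi a (-b) = - phi a b := by
  have := idx_ne_zero b
  simp only [phi_cases, neg_val]
  split_ifs <;> omega

end Parity

section LeftMat

variable {r n : ℕ}

theorem leftMat_mem (a b : Idx n) {d : ZMod 2} {x : Acoord r n} (hx : x ∈ Agr r n d) :
    leftMat r n x a b ∈ Agr r n (par a + par b + d) := by
  let f (a b : Idx n) : Acoord r n →ₗ[Kq] Acoord r n :=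
    Matrix.entryLinearMap Kq (Acoord r n) a b ∘ₗ (leftMat r n).toLinearMap
  have key : Agr r n d ≤ ⨅ a, ⨅ b, (Agr r n (par a + par b + d)).comap (f a b) := by
    refine Agr_le (W := fun d => ⨅ a, ⨅ b, (Agr r n (par a + par b + d)).comap (f a b)) ?_ ?_ d
    · simp only [Submodule.mem_iInf]
      intro a b
      change leftMat r n 1 a b ∈ Agr r n _
      rw [map_one]
      by_cases h : a = b
      · rw [h, Matrix.one_apply_eq, CharTwo.add_self_eq_zero, zero_add]
        exact SetLike.GradedOne.one_mem
      · rw [Matrix.one_apply_ne h]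
        exact zero_mem _
    · intro i c hi d x hx
      simp only [Submodule.mem_iInf] at hx ⊢
      intro a b
      change leftMat r n (tgen i c * x) a b ∈ Agr r n _
      rw [map_mul, Matrix.mul_apply]
      refine Submodule.sum_mem _ fun z _ => ?_
      have h1 : leftMat r n (tgen i c) a z ∈ Agr r n (par a + par z + par c) := by
        rw [leftMat_tgen hi]
        refine Submodule.sum_mem _ fun y _ => ?_
        by_cases h0 : Rmat a y c z = 0
        · rw [h0, zero_smul]; exact zero_mem _
        · have e := Rmat_parity h0
          have e2 : par a + par z + par c = par i + par y := by
            rw [par_of_pos hi]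
            revert e
            generalize par a = a; generalize par z = z; generalize par c = c; generalize par y = y
            revert a z c y; decide
          rw [e2]
          exact Submodule.smul_mem _ _ (tgen_mem i y)
      have e3 : ∀ a b c d z : ZMod 2, a + b + (c + d) = a + z + c + (z + b + d) := by decide
      rw [e3 _ _ _ _ (par z)]
      exact SetLike.GradedMul.mul_mem h1 (hx z b)
  have := key hx
  simp only [Submodule.mem_iInf] at this
  exact this a b

/-- S is triangular in its second factor, so the matrices of generators are upper triangular, and
products of such matrices remain so. This corresponds to L_{ab} = 0 for a > b. -/
theorem leftMat_of_not_le {a b : Idx n} (h : ¬ a ≤ b) (x : Acoord r n) :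
    leftMat r n x a b = 0 := by
  let f (a b : Idx n) : Acoord r n →ₗ[Kq] Acoord r n :=
    Matrix.entryLinearMap Kq (Acoord r n) a b ∘ₗ (leftMat r n).toLinearMap
  have key := mem_of_tgen_mul_mem
    (W := ⨅ a, ⨅ b, ⨅ (_ : ¬ a ≤ b), LinearMap.ker (f a b)) ?_ ?_ x
  · simp only [Submodule.mem_iInf] at key
    exact key a b h
  · simp only [Submodule.mem_iInf]
    intro a b h
    change leftMat r n 1 a b = 0
    rw [map_one, Matrix.one_apply_ne (fun h' => h h'.le)]
  · intro i c hi x hx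
    simp only [Submodule.mem_iInf] at hx ⊢
    intro a b h
    change leftMat r n (tgen i c * x) a b = 0
    rw [map_mul, Matrix.mul_apply]
    refine Finset.sum_eq_zero fun z _ => ?_
    by_cases h1 : a ≤ z
    · have h2 : leftMat r n x z b = 0 := hx z b fun h2 => h (h1.trans h2)
      rw [h2, mul_zero]
    · rw [leftMat_tgen hi]
      simp [Rmat_eq_zero_of_not_le h1]

theorem leftMat_mul_self (a : Idx n) (x y : Acoord r n) :
    leftMat r n (x * y) a a = leftMat r n x a a * leftMat r n y a a := by
  rw [map_mul, Matrix.mul_apply, Finset.sum_eq_single a]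
  · intro z _ hz
    by_cases h : a ≤ z
    · rw [leftMat_of_not_le (x := y) fun h' => hz (le_antisymm h' h), mul_zero]
    · rw [leftMat_of_not_le h, zero_mul]
  · simp

/-- By triangularity the diagonal entries are multiplicative, and on a generator they are scalars,
so only scalars have to be compared. The leftover sign is removed by the normalization in `Lop`. -/
theorem leftMat_inv (a : Idx n) {d : ZMod 2} {x : Acoord r n} (hx : x ∈ Agr r n d) :
    leftMat r n (leftMat r n x (-a) (-a)) a a = sgn d • x := by
  let f (a b : Idx n) : Acoord r n →ₗ[Kq] Acoord r n :=
    Matrix.entryLinearMap Kq (Acoord r n) a b ∘ₗ (leftMat r n).toLinearMap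
  refine Agr_le (W := fun d => LinearMap.eqLocus (f a a ∘ₗ f (-a) (-a)) (sgn d • LinearMap.id))
    ?_ ?_ d hx
  · change leftMat r n (leftMat r n 1 (-a) (-a)) a a = sgn 0 • 1
    simp
  · intro i c hi d x hx
    change leftMat r n (leftMat r n x (-a) (-a)) a a = sgn d • x at hx
    change leftMat r n (leftMat r n (tgen i c * x) (-a) (-a)) a a = sgn _ • (tgen i c * x)
    rw [leftMat_mul_self, leftMat_mul_self, hx]
    have e : ∀ a, leftMat r n (tgen i c) a a = (sgn (par a * par c) * q ^ phi c a) • tgen i c := by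
      intro a
      rw [leftMat_tgen hi, Finset.sum_eq_single c]
      · rw [Rmat_self, if_pos rfl]
      · intro y _ hy
        rw [Rmat_self, if_neg hy, zero_smul]
      · simp
    -- The powers of q cancel because φ(c, -a) = -φ(c, a), and of the signs only (-1)^{|c|}
    -- survives.
    have e2 : leftMat r n (leftMat r n (tgen i c) (-a) (-a)) a a = sgn (par c) • tgen i c := by
      rw [e, map_smul, Matrix.smul_apply, e, smul_smul, phi_neg_right, zpow_neg, par_neg, add_mul,
        one_mul, sgn_add]
      congr 1
      have hq : q ^ phi c a ≠ 0 := zpow_ne_zero _ q_ne_zero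
      have hs := sgn_mul_self (par a * par c)
      field_simp
      linear_combination (sgn (par c)) * hs
    rw [e2, smul_mul_smul_comm, ← sgn_add]

end LeftMat
end QueerBraided

namespace QueerBraided

/-! ### The action of U_q(q_n) on A_{r,n} -/

section Action

variable {r n : ℕ}

/-- The action of `L_{ab}` on `A_{r,n}`. -/
noncomputable def Lop (r : ℕ) {n : ℕ} (a b : Idx n) : Module.End Kq (Acoord r n) :=
  sgn (par a * par b + par b) •
    (Matrix.entryLinearMap Kq (Acoord r n) a b ∘ₗ (leftMat r n).toLinearMap ∘ₗ
      ∑ d : ZMod 2, sgn (par b * d) • GradedAlgebra.proj (Agr r n) d)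

/-- The entries of `leftMat` multiply as ordinary matrices, without Koszul signs. This
parity-dependent sign turns that product into the signed sum of `Lop_mul` and the commutation of
`leftMat_comm` into the signed relation of `Lop_sll`. -/
theorem Lop_apply (a b : Idx n) {d : ZMod 2} {x : Acoord r n} (hx : x ∈ Agr r n d) :
    Lop r a b x = sgn (par a * par b + par b + par b * d) • leftMat r n x a b := by
  rw [Lop, LinearMap.smul_apply, LinearMap.comp_apply, LinearMap.comp_apply,
    sum_sgn_proj (Agr r n) _ hx, map_smul, map_smul, smul_smul, ← sgn_add]
  rfl

theorem Lop_mem (a b : Idx n) {d : ZMod 2} {x : Acoord r n} (hx : x ∈ Agr r n d) :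
    Lop r a b x ∈ Agr r n (par a + par b + d) := by
  rw [Lop_apply a b hx]
  exact Submodule.smul_mem _ _ (leftMat_mem a b hx)

/-- Two linear maps that agree on homogeneous elements are equal. -/
theorem graded_linearMap_ext {A M : Type*} [Ring A] [Algebra Kq A] (gr : ZMod 2 → Submodule Kq A)
    [GradedAlgebra gr] [AddCommGroup M] [Module Kq M] {f g : A →ₗ[Kq] M}
    (h : ∀ d, ∀ x ∈ gr d, f x = g x) : f = g :=
  LinearMap.ext fun x => graded_induction gr (W := LinearMap.eqLocus f g) (fun d x hx => h d x hx) x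

theorem Lop_of_not_le (a b : Idx n) (h : ¬ a ≤ b) : Lop r a b = 0 :=
  graded_linearMap_ext (Agr r n) fun d x hx => by
    rw [Lop_apply a b hx, leftMat_of_not_le h, smul_zero, LinearMap.zero_apply]

theorem Lop_inv (a : Idx n) : Lop r a a * Lop r (-a) (-a) = 1 :=
  graded_linearMap_ext (Agr r n) fun d x hx => by
    rw [Module.End.mul_apply, Lop_apply _ _ (Lop_mem _ _ hx), Lop_apply _ _ hx, map_smul,
      Matrix.smul_apply, leftMat_inv a hx, smul_smul, smul_smul, ← sgn_add, ← sgn_add, par_neg,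
      Module.End.one_apply]
    have e : ∀ a d : ZMod 2, a * a + a + a * (a + 1 + (a + 1) + d) +
        ((a + 1) * (a + 1) + (a + 1) + (a + 1) * d) + d = 0 := by decide
    rw [e, sgn_zero, one_smul]

theorem Lop_Lop_apply (a b a' b' : Idx n) {d : ZMod 2} {x : Acoord r n} (hx : x ∈ Agr r n d) :
    (Lop r a b * Lop r a' b') x = sgn (par a * par b + par b + par b * (par a' + par b' + d) +
      (par a' * par b' + par b' + par b' * d)) • leftMat r n (leftMat r n x a' b') a b := by
  rw [Module.End.mul_apply, Lop_apply _ _ (Lop_mem _ _ hx), Lop_apply _ _ hx, map_smul,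
    Matrix.smul_apply, smul_smul, ← sgn_add]

theorem Lop_sll (i j k l : Idx n) : LLS (Lop r (n := n)) i j k l = SLL (Lop r) i j k l := by
  refine graded_linearMap_ext (Agr r n) fun d x hx => ?_
  have key := leftMat_comm x k i j l
  -- The two sides of `leftMat_comm` need the same overall sign: wherever the coefficient of S is
  -- nonzero, evenness of S removes the dependence on the summation indices.
  let s : ZMod 2 := par i * par k + (par i + par k + 1 + d) * (par j + par l) +
    par k * par j + par l * par j
  have e1 : LLS (Lop r (n := n)) i j k l x =
      sgn s • R (fun u v => leftMat r n (leftMat r n x k u) i v) j l := by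
    rw [R_def, Finset.sum_comm, Finset.smul_sum, LLS, LinearMap.sum_apply]
    refine Finset.sum_congr rfl fun v _ => ?_
    rw [Finset.smul_sum, LinearMap.sum_apply]
    refine Finset.sum_congr rfl fun u _ => ?_
    rw [LinearMap.smul_apply, Lop_Lop_apply _ _ _ _ hx, smul_smul, smul_smul]
    congr 1
    by_cases h0 : Smat v j u l = 0
    · simp [h0, Rmat]
    · have e := Smat_parity h0
      rw [Rmat, mul_right_comm, ← mul_assoc, ← sgn_add, ← sgn_add, ← sgn_add]
      congr 2
      revert e
      simp only [s]
      generalize par i = i; generalize par j = j; generalize par k = k; generalize par l = l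
      generalize par u = u; generalize par v = v
      clear key hx
      revert i j k l u v d; decide
  have e2 : SLL (Lop r (n := n)) i j k l x =
      sgn s • ∑ u, ∑ v, Rmat k i u v • leftMat r n (leftMat r n x u j) v l := by
    rw [Finset.smul_sum, SLL, LinearMap.sum_apply]
    refine Finset.sum_congr rfl fun u _ => ?_
    rw [Finset.smul_sum, LinearMap.sum_apply]
    refine Finset.sum_congr rfl fun v _ => ?_
    rw [LinearMap.smul_apply, Lop_Lop_apply _ _ _ _ hx, smul_smul, smul_smul]
    congr 1
    by_cases h0 : Smat i u k v = 0
    · simp [h0, Rmat]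
    · have e := Smat_parity h0
      rw [Rmat, mul_right_comm, ← mul_assoc, ← sgn_add, ← sgn_add]
      congr 2
      revert e
      simp only [s]
      generalize par i = i; generalize par j = j; generalize par k = k; generalize par l = l
      generalize par u = u; generalize par v = v
      clear key hx e1
      revert i j k l u v d; decide
  rw [e1, e2, key]

/-- The action of `U_q(𝔮_n)` on `A_{r,n}`. -/
noncomputable def coordAct (r n : ℕ) : Uq n →ₐ[Kq] Module.End Kq (Acoord r n) :=
  Ulift (Lop r) Lop_of_not_le Lop_inv Lop_sll

theorem coordAct_Lgen (a b : Idx n) : coordAct r n (Lgen a b) = Lop r a b :=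
  Ulift_Lgen _ _ _ _ a b

theorem coordAct_mem {d e : ZMod 2} {u : Uq n} (hu : u ∈ Ugr n d) {x : Acoord r n}
    (hx : x ∈ Agr r n e) : coordAct r n u x ∈ Agr r n (d + e) := by
  let f (x : Acoord r n) : Uq n →ₗ[Kq] Acoord r n :=
    LinearMap.applyₗ x ∘ₗ (coordAct r n).toLinearMap
  refine Ugr_le (W := fun d => (Agr r n (d + e)).comap (f x)) ?_ (fun i j d u hu => ?_) d hu
  · change coordAct r n 1 x ∈ Agr r n (0 + e)
    rwa [map_one, zero_add, Module.End.one_apply]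
  · change coordAct r n (Lgen i j * u) x ∈ Agr r n (par i + par j + d + e)
    rw [map_mul, Module.End.mul_apply, coordAct_Lgen, add_assoc]
    exact Lop_mem _ _ hu

/-- This is multiplicativity of `leftMat` with signs restored: the expansion of a matrix product is
the coproduct formula, and d(|c| + |b|) is the sign of L_{cb} passing x. -/
theorem Lop_mul (a b : Idx n) {d : ZMod 2} {x : Acoord r n} (hx : x ∈ Agr r n d)
    (y : Acoord r n) : Lop r a b (x * y) = ∑ c, sgn ((par a + par c) * (par c + par b) +
      d * (par c + par b)) • (Lop r a c x * Lop r c b y) := by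
  let f : Acoord r n →ₗ[Kq] Acoord r n := Lop r a b ∘ₗ LinearMap.mulLeft Kq x
  let g : Acoord r n →ₗ[Kq] Acoord r n := ∑ c, sgn ((par a + par c) * (par c + par b) +
      d * (par c + par b)) • (LinearMap.mulLeft Kq (Lop r a c x) ∘ₗ Lop r c b)
  have key : f = g := by
    refine graded_linearMap_ext (Agr r n) fun e y hy => ?_
    change Lop r a b (x * y) = _
    rw [LinearMap.sum_apply, Lop_apply a b (SetLike.GradedMul.mul_mem hx hy), map_mul,
      Matrix.mul_apply, Finset.smul_sum]
    refine Finset.sum_congr rfl fun c _ => ?_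
    change _ = sgn _ • (Lop r a c x * Lop r c b y)
    rw [Lop_apply _ _ hx, Lop_apply _ _ hy, smul_mul_smul_comm, smul_smul, ← sgn_add, ← sgn_add]
    congr 2
    generalize par a = a; generalize par b = b; generalize par c = c
    clear hx hy f g
    revert a b c d e; decide
  have h := LinearMap.congr_fun key y
  rw [LinearMap.sum_apply] at h
  exact h

theorem coordAct_one (u : Uq n) : coordAct r n u 1 = counit n u • 1 := by
  let f : Uq n →ₗ[Kq] Acoord r n := LinearMap.applyₗ 1 ∘ₗ (coordAct r n).toLinearMap
  let g : Uq n →ₗ[Kq] Acoord r n := LinearMap.toSpanSingleton Kq _ 1 ∘ₗ (counit n).toLinearMap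
  refine Lgen_induction (W := LinearMap.eqLocus f g) ?_ (fun i j u hu => ?_) u
  · change coordAct r n 1 1 = counit n 1 • 1
    rw [map_one (coordAct r n), map_one (counit n), one_smul, Module.End.one_apply]
  · change coordAct r n u 1 = counit n u • 1 at hu
    change coordAct r n (Lgen i j * u) 1 = counit n (Lgen i j * u) • 1
    have e : counit n (Lgen i j) = if i = j then 1 else 0 := Ulift_Lgen _ _ _ _ i j
    rw [map_mul, Module.End.mul_apply, hu, map_smul, coordAct_Lgen,
      Lop_apply (d := 0) _ _ SetLike.GradedOne.one_mem, map_one, map_mul, e]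
    by_cases h : i = j
    · subst h
      have e2 : ∀ a : ZMod 2, a * a + a + a * 0 = 0 := by decide
      rw [Matrix.one_apply_eq, if_pos rfl, e2, sgn_zero, one_smul, one_mul]
    · rw [Matrix.one_apply_ne h, if_neg h, smul_zero, smul_zero, zero_mul, zero_smul]

theorem superSign_apply (e : ZMod 2) {f : ZMod 2} {u : Uq n} (hu : u ∈ Ugr n f) :
    superSign n e u = sgn (e * f) • u := sum_sgn_proj (Ugr n) e hu

theorem comulLin_one : comulLin n 1 = 1 ⊗ₜ 1 := by
  rw [comulLin, LinearMap.comp_apply, AlgHom.toLinearMap_apply, map_one]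
  rfl

theorem comulLin_Lgen (i j : Idx n) : comulLin n (Lgen i j) =
    ∑ k, sgn ((par i + par k) * (par k + par j)) • (Lgen i k ⊗ₜ[Kq] Lgen k j) := by
  rw [comulLin, LinearMap.comp_apply, AlgHom.toLinearMap_apply, comul_Lgen, map_sum]
  refine Finset.sum_congr rfl fun k _ => ?_
  rw [map_smul]
  rfl

theorem gradedTensor_of_mul_of {e f : ZMod 2} (u : Uq n) {v u' : Uq n} (hv : v ∈ Ugr n f)
    (hu' : u' ∈ Ugr n e) (v' : Uq n) :
    GradedTensorProduct.of Kq (Ugr n) (Ugr n) (u ⊗ₜ v) *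
      GradedTensorProduct.of Kq (Ugr n) (Ugr n) (u' ⊗ₜ v') =
    sgn (f * e) • GradedTensorProduct.of Kq (Ugr n) (Ugr n) ((u * u') ⊗ₜ (v * v')) := by
  have h := GradedTensorProduct.tmul_coe_mul_coe_tmul (R := Kq) (𝒜 := Ugr n) (ℬ := Ugr n)
    u (⟨v, hv⟩ : Ugr n f) (⟨u', hu'⟩ : Ugr n e) v'
  rw [Units.smul_def, ← Int.cast_smul_eq_zsmul Kq, ← sgn_eq_zsmul] at h
  exact h

/-- The coproduct is multiplicative for the signed product, so L_{kj} has to pass the first leg of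
Δ(u). That sign is the `superSign` factor, and the formula permits induction on u. -/
theorem comulLin_Lgen_mul (i j : Idx n) (u : Uq n) : comulLin n (Lgen i j * u) =
    ∑ k, sgn ((par i + par k) * (par k + par j)) •
      TensorProduct.map (LinearMap.mulLeft Kq (Lgen i k))
        (LinearMap.mulLeft Kq (Lgen k j)) (TensorProduct.map (superSign n (par k + par j))
          LinearMap.id (comulLin n u)) := by
  have key : ∀ z : Uq n ⊗[Kq] Uq n, (GradedTensorProduct.of Kq (Ugr n) (Ugr n)).symm
      (comul n (Lgen i j) * GradedTensorProduct.of Kq (Ugr n) (Ugr n) z) =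
      ∑ k, sgn ((par i + par k) * (par k + par j)) •
      TensorProduct.map (LinearMap.mulLeft Kq (Lgen i k))
        (LinearMap.mulLeft Kq (Lgen k j)) (TensorProduct.map (superSign n (par k + par j))
          LinearMap.id z) := by
    intro z
    induction z using TensorProduct.induction_on with
    | zero => simp
    | add z w hz hw =>
      simp only [map_add, mul_add, smul_add, Finset.sum_add_distrib, hz, hw]
    | tmul v w =>
      induction v using DirectSum.Decomposition.inductionOn (Ugr n) with
      | zero => simp
      | add v v' hv hv' =>
        simp only [TensorProduct.add_tmul, map_add, mul_add, smul_add, Finset.sum_add_distrib, hv,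
          hv']
      | homogeneous v =>
        rw [comul_Lgen, Finset.sum_mul, map_sum]
        refine Finset.sum_congr rfl fun k _ => ?_
        rw [smul_mul_assoc, map_smul, gradedTensor_of_mul_of _ (Lgen_mem k j) v.2, map_smul]
        simp only [LinearEquiv.symm_apply_apply, TensorProduct.map_tmul, superSign_apply _ v.2,
          LinearMap.id_apply, LinearMap.mulLeft_apply, mul_smul_comm, TensorProduct.smul_tmul']
  refine Eq.trans ?_ (key (comulLin n u))
  rw [comulLin, LinearMap.comp_apply, AlgHom.toLinearMap_apply, map_mul]
  rfl

/-- Compatibility with products is built up one factor L_{ij} at a time, starting from `Lop_mul`. -/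
theorem coordAct_mul (u : Uq n) {d : ZMod 2} {x : Acoord r n} (hx : x ∈ Agr r n d)
    (y : Acoord r n) : coordAct r n u (x * y) = LinearMap.mul' Kq (Acoord r n)
      (TensorProduct.map ((coordAct r n).toLinearMap.flip x)
        ((coordAct r n).toLinearMap.flip y ∘ₗ superSign n d) (comulLin n u)) := by
  let F : Uq n ⊗[Kq] Uq n →ₗ[Kq] Acoord r n := LinearMap.mul' Kq (Acoord r n) ∘ₗ
    TensorProduct.map ((coordAct r n).toLinearMap.flip x)
      ((coordAct r n).toLinearMap.flip y ∘ₗ superSign n d)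
  have hF : ∀ u v : Uq n, ∀ e, v ∈ Ugr n e →
      F (u ⊗ₜ v) = sgn (d * e) • (coordAct r n u x * coordAct r n v y) := by
    intro u v e hv
    change coordAct r n u x * coordAct r n (superSign n d v) y = _
    rw [superSign_apply d hv, map_smul, LinearMap.smul_apply, mul_smul_comm]
  -- Left multiplication by Δ(L_{ij}) on the tensor corresponds to the operator of L_{ij} on the
  -- product; it suffices to compare signs on homogeneous pure tensors.
  have key : ∀ i j, ∀ z : Uq n ⊗[Kq] Uq n,
      F (∑ k, sgn ((par i + par k) * (par k + par j)) •
        TensorProduct.map (LinearMap.mulLeft Kq (Lgen i k))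
          (LinearMap.mulLeft Kq (Lgen k j)) (TensorProduct.map (superSign n (par k + par j))
            LinearMap.id z)) = Lop r i j (F z) := by
    intro i j z
    induction z using TensorProduct.induction_on with
    | zero => simp
    | add z w hz hw => simp only [map_add, smul_add, Finset.sum_add_distrib, hz, hw]
    | tmul v w =>
      induction v using DirectSum.Decomposition.inductionOn (Ugr n) with
      | zero => simp
      | add v v' hv hv' =>
        simp only [TensorProduct.add_tmul, map_add, smul_add, Finset.sum_add_distrib, hv, hv']
      | @homogeneous e v =>
        induction w using DirectSum.Decomposition.inductionOn (Ugr n) with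
        | zero => simp
        | add w w' hw hw' =>
          simp only [TensorProduct.tmul_add, map_add, smul_add, Finset.sum_add_distrib, hw, hw']
        | @homogeneous f w =>
          rw [hF _ _ _ w.2, map_smul, Lop_mul i j (coordAct_mem v.2 hx), map_sum, Finset.smul_sum]
          refine Finset.sum_congr rfl fun k _ => ?_
          simp only [TensorProduct.map_tmul, superSign_apply _ v.2, LinearMap.id_apply,
            LinearMap.mulLeft_apply, ← TensorProduct.smul_tmul', map_smul]
          rw [hF _ _ _ (SetLike.GradedMul.mul_mem (Lgen_mem k j) w.2), map_mul, map_mul,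
            Module.End.mul_apply, Module.End.mul_apply, coordAct_Lgen, coordAct_Lgen]
          simp only [smul_smul, ← sgn_add]
          congr 2
          generalize par i = i; generalize par j = j; generalize par k = k
          clear * -
          revert i j k d e f; decide
  let f : Uq n →ₗ[Kq] Acoord r n := LinearMap.applyₗ (x * y) ∘ₗ (coordAct r n).toLinearMap
  refine Lgen_induction (W := LinearMap.eqLocus f (F ∘ₗ comulLin n)) ?_ (fun i j u hu => ?_) u
  · change coordAct r n 1 (x * y) = F (comulLin n 1)
    rw [comulLin_one, hF 1 1 0 SetLike.GradedOne.one_mem, map_one (coordAct r n), mul_zero, sgn_zero, one_smul]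
    rfl
  · change coordAct r n u (x * y) = F (comulLin n u) at hu
    change coordAct r n (Lgen i j * u) (x * y) = F (comulLin n (Lgen i j * u))
    rw [comulLin_Lgen_mul, key, ← hu, map_mul (coordAct r n), Module.End.mul_apply, coordAct_Lgen]

end Action
end QueerBraided

namespace QueerBraided

/-! ### Existence and uniqueness of the coordinate action -/

section CoordAction

variable {r n : ℕ}

theorem Lop_tgen_of_pos (a b c : Idx n) {i : Idx r} (hi : 0 < i.1) :
    sgn ((par a + par b) * (par i + par c)) • Lop r a b (tgen i c) =
      ∑ d, (sgn ((par i + par d) * (par d + par c)) * Smat d c a b) • tgen i d := by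
  rw [Lop_apply a b (tgen_mem i c), leftMat_tgen hi, Finset.smul_sum, Finset.smul_sum]
  refine Finset.sum_congr rfl fun d _ => ?_
  rw [smul_smul, smul_smul, Rmat]
  congr 1
  by_cases h0 : Smat d c a b = 0
  · simp [h0]
  · have e := Smat_parity h0
    rw [← mul_assoc, ← sgn_add, ← sgn_add, par_of_pos hi]
    congr 2
    revert e
    generalize par a = a; generalize par b = b; generalize par c = c; generalize par d = d
    clear * -
    revert a b c d; decide

/-- The formula for a negative row follows from that for the opposite row: both t and S are
unchanged under the simultaneous negations involved, and the parities shift in pairs. -/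
theorem Lop_tgen (a b c : Idx n) (i : Idx r) :
    sgn ((par a + par b) * (par i + par c)) • Lop r a b (tgen i c) =
      ∑ d, (sgn ((par i + par d) * (par d + par c)) * Smat d c a b) • tgen i d := by
  rcases lt_or_gt_of_ne (idx_ne_zero i) with hi | hi
  · have h := Lop_tgen_of_pos a b (-c) (i := -i) (by rw [neg_val]; omega)
    have e : ∀ x y : ZMod 2, x + 1 + (y + 1) = x + y := by decide
    rw [← tgen_neg, par_neg, par_neg, e] at h
    rw [h, ← sum_neg_idx]
    refine Finset.sum_congr rfl fun d _ => ?_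
    rw [Smat_neg_left, ← tgen_neg, par_neg, e, e]
  · exact Lop_tgen_of_pos a b c hi

theorem isCoordAction_coordAct (r n : ℕ) : IsCoordAction r n (coordAct r n).toLinearMap where
  supermoduleSuperalgebra :=
    { internal := DirectSum.Decomposition.isInternal _
      map_one := map_one (coordAct r n)
      map_mul := fun u v => map_mul (coordAct r n) u v
      act_mem := fun d e u hu x hx => coordAct_mem hu hx
      one_mul := fun a => one_mul a
      mul_one := fun a => mul_one a
      mul_assoc := fun a b c => mul_assoc a b c
      one_mem := SetLike.GradedOne.one_mem
      mul_mem := fun d e a ha b hb => SetLike.GradedMul.mul_mem ha hb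
      act_mul := fun u d a ha b => coordAct_mul u ha b
      act_one := fun u => coordAct_one u }
  act_tgen a b c i := by
    rw [AlgHom.toLinearMap_apply, coordAct_Lgen]
    exact Lop_tgen a b c i

theorem act_Lgen_mul {Ψ : Uq n →ₗ[Kq] Module.End Kq (Acoord r n)}
    (h : IsSupermoduleSuperalgebra (Agr r n) 1 (LinearMap.mul' Kq (Acoord r n)) Ψ) (a b : Idx n)
    {d : ZMod 2} {x : Acoord r n} (hx : x ∈ Agr r n d) (y : Acoord r n) :
    Ψ (Lgen a b) (x * y) = ∑ c, sgn ((par a + par c) * (par c + par b) +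
      d * (par c + par b)) • (Ψ (Lgen a c) x * Ψ (Lgen c b) y) := by
  refine (h.act_mul (Lgen a b) d x hx y).trans ?_
  rw [comulLin_Lgen, map_sum, map_sum]
  refine Finset.sum_congr rfl fun c _ => ?_
  rw [map_smul, map_smul, TensorProduct.map_tmul, LinearMap.mul'_apply, LinearMap.comp_apply,
    superSign_apply _ (Lgen_mem c b), map_smul, mul_smul_comm, smul_smul, ← sgn_add]
  rfl

/-- The required formula fixes L_{ab} on generators. Compatibility with Δ(L_{ab}), which again
involves only generators of U_q(q_n), fixes it on products. All L_{ab} are compared simultaneously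
because the coproduct mixes them. -/
theorem IsCoordAction.eq_coordAct {Ψ : Uq n →ₗ[Kq] Module.End Kq (Acoord r n)}
    (h : IsCoordAction r n Ψ) : Ψ = (coordAct r n).toLinearMap := by
  have hs := h.supermoduleSuperalgebra
  have h0 := isCoordAction_coordAct r n
  have hs0 := h0.supermoduleSuperalgebra
  have ht : ∀ a b i c, Ψ (Lgen a b) (tgen i c) = coordAct r n (Lgen a b) (tgen i c) :=
    fun a b i c => smul_sgn_cancel ((h.act_tgen a b c i).trans (h0.act_tgen a b c i).symm)
  have hL : ∀ a b, Ψ (Lgen a b) = coordAct r n (Lgen a b) := by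
    have key : ∀ x : Acoord r n, x ∈ ⨅ a, ⨅ b,
        LinearMap.eqLocus (Ψ (Lgen a b)) (coordAct r n (Lgen a b)) := by
      refine mem_of_tgen_mul_mem ?_ fun i c hi x hx => ?_
      · simp only [Submodule.mem_iInf]
        intro a b
        exact (hs.act_one _).trans (hs0.act_one _).symm
      · simp only [Submodule.mem_iInf] at hx ⊢
        intro a b
        refine (act_Lgen_mul hs a b (tgen_mem i c) x).trans
          (Eq.trans ?_ (act_Lgen_mul hs0 a b (tgen_mem i c) x).symm)
        refine Finset.sum_congr rfl fun z _ => ?_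
        have h1 : Ψ (Lgen z b) x = coordAct r n (Lgen z b) x := hx z b
        rw [ht, h1]
        rfl
    intro a b
    ext x
    have := key x
    simp only [Submodule.mem_iInf] at this
    exact this a b
  refine LinearMap.ext fun u => Lgen_induction
    (W := LinearMap.eqLocus Ψ (coordAct r n).toLinearMap) ?_ (fun i j u hu => ?_) u
  · exact hs.map_one.trans hs0.map_one.symm
  · change Ψ u = coordAct r n u at hu
    change Ψ (Lgen i j * u) = coordAct r n (Lgen i j * u)
    rw [hs.map_mul, hL, hu, map_mul]

theorem isCoordAction_iff (Ψ : Uq n →ₗ[Kq] Module.End Kq (Acoord r n)) :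
    IsCoordAction r n Ψ ↔ Ψ = (coordAct r n).toLinearMap :=
  ⟨fun h => h.eq_coordAct, fun h => h ▸ isCoordAction_coordAct r n⟩

end CoordAction

/-! ### The embeddings ι_p are even and equivariant -/

section Iota

variable {r m n : ℕ} (p : ℕ) (h : p + r ≤ m)

theorem shift_pos {i : Idx r} (hi : 0 < i.1) : 0 < (shift p h i).1 := by
  rw [shift_val, if_pos hi]; omega

/-- The coefficients of `leftMat` on a generator depend only on column indices, whereas ι_p only
renames rows. -/
theorem leftMat_iota (x : Acoord r n) (a b : Idx n) :
    leftMat m n (iota p h n x) a b = iota p h n (leftMat r n x a b) := by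
  have key : (leftMat m n).comp (iota p h n) = (iota p h n).mapMatrix.comp (leftMat r n) := by
    refine Acoord_algHom_ext fun i c hi => ?_
    ext a b
    rw [AlgHom.comp_apply, AlgHom.comp_apply, iota_tgen, leftMat_tgen (shift_pos p h hi),
      AlgHom.mapMatrix_apply, Matrix.map_apply, leftMat_tgen hi, map_sum]
    refine Finset.sum_congr rfl fun y _ => ?_
    rw [map_smul, iota_tgen]
  have := congrFun₂ (DFunLike.congr_fun key x) a b
  exact this

theorem iota_mem {d : ZMod 2} {x : Acoord r n} (hx : x ∈ Agr r n d) :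
    iota p h n x ∈ Agr m n d := by
  refine Agr_le (W := fun d => (Agr m n d).comap (iota p h n).toLinearMap) ?_
    (fun i a hi d x hx => ?_) d hx
  · change iota p h n 1 ∈ Agr m n 0
    rw [map_one]
    exact SetLike.GradedOne.one_mem
  · change iota p h n (tgen i a * x) ∈ Agr m n (par a + d)
    rw [map_mul, iota_tgen]
    refine SetLike.GradedMul.mul_mem ?_ hx
    have := tgen_mem (n := n) (shift p h i) a
    rwa [par_of_pos (shift_pos p h hi), zero_add] at this

theorem coordAct_iota (u : Uq n) (x : Acoord r n) :
    coordAct m n u (iota p h n x) = iota p h n (coordAct r n u x) := by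
  have hL : ∀ a b (x : Acoord r n), Lop m a b (iota p h n x) = iota p h n (Lop r a b x) := by
    intro a b x
    refine LinearMap.congr_fun (f := Lop m a b ∘ₗ (iota p h n).toLinearMap)
      (g := (iota p h n).toLinearMap ∘ₗ Lop r a b) ?_ x
    refine graded_linearMap_ext (Agr r n) fun d x hx => ?_
    change Lop m a b (iota p h n x) = iota p h n (Lop r a b x)
    rw [Lop_apply a b (iota_mem p h hx), Lop_apply a b hx, map_smul, leftMat_iota]
  let f : Uq n →ₗ[Kq] Acoord m n :=
    LinearMap.applyₗ (iota p h n x) ∘ₗ (coordAct m n).toLinearMap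
  let g : Uq n →ₗ[Kq] Acoord m n :=
    (iota p h n).toLinearMap ∘ₗ LinearMap.applyₗ x ∘ₗ (coordAct r n).toLinearMap
  refine Lgen_induction (W := LinearMap.eqLocus f g) ?_ (fun i j u hu => ?_) u
  · change coordAct m n 1 (iota p h n x) = iota p h n (coordAct r n 1 x)
    rw [map_one (coordAct m n), map_one (coordAct r n)]
    rfl
  · change coordAct m n u (iota p h n x) = iota p h n (coordAct r n u x) at hu
    change coordAct m n (Lgen i j * u) (iota p h n x) = iota p h n (coordAct r n (Lgen i j * u) x)
    rw [map_mul (coordAct m n), map_mul (coordAct r n), Module.End.mul_apply, Module.End.mul_apply,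
      hu, coordAct_Lgen, coordAct_Lgen, hL]

end Iota
end QueerBraided

namespace QueerBraided

/-! ### Transport of structure along a bijection -/

section Transport

variable {n : ℕ} {M M' : Type*} [AddCommGroup M] [Module Kq M] [AddCommGroup M'] [Module Kq M']

theorem isInternal_of_equiv {gr : ZMod 2 → Submodule Kq M} {gr' : ZMod 2 → Submodule Kq M'}
    (e : M ≃ₗ[Kq] M') (h : ∀ d x, x ∈ gr d ↔ e x ∈ gr' d) (h' : DirectSum.IsInternal gr') :
    DirectSum.IsInternal gr := by
  -- The grading is the image of the given one under an isomorphism of submodule lattices, which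
  -- preserves independence and suprema.
  have hgr : gr = (Submodule.orderIsoMapComap e).symm ∘ gr' := by
    funext d
    ext x
    exact h d x
  rw [DirectSum.isInternal_submodule_iff_iSupIndep_and_iSup_eq_top] at h' ⊢
  rw [hgr, iSupIndep_map_orderIso_iff]
  refine ⟨h'.1, ?_⟩
  have := (Submodule.orderIsoMapComap e).symm.map_iSup gr'
  rw [h'.2, OrderIso.map_top] at this
  exact this.symm

/-- The structure of a supermodule superalgebra is transported along a linear bijection. -/
theorem IsSupermoduleSuperalgebra.of_bijective {gr : ZMod 2 → Submodule Kq M} {one : M}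
    {mul : M ⊗[Kq] M →ₗ[Kq] M} {Φ : Uq n →ₗ[Kq] Module.End Kq M}
    {gr' : ZMod 2 → Submodule Kq M'} {one' : M'} {mul' : M' ⊗[Kq] M' →ₗ[Kq] M'}
    {Φ' : Uq n →ₗ[Kq] Module.End Kq M'} {f : M →ₗ[Kq] M'}
    (h : IsSupermoduleSuperalgebra gr' one' mul' Φ') (hf : Function.Bijective f)
    (hgr : ∀ d x, x ∈ gr d ↔ f x ∈ gr' d) (hone : f one = one')
    (hmul : ∀ a b, f (mul (a ⊗ₜ b)) = mul' (f a ⊗ₜ f b))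
    (hact : ∀ u x, f (Φ u x) = Φ' u (f x)) : IsSupermoduleSuperalgebra gr one mul Φ where
  internal := isInternal_of_equiv (LinearEquiv.ofBijective f hf) hgr h.internal
  map_one := LinearMap.ext fun x => hf.1 <| by rw [hact, h.map_one]; rfl
  map_mul u v := LinearMap.ext fun x => hf.1 <| by
    rw [hact, h.map_mul, Module.End.mul_apply, Module.End.mul_apply, hact, hact]
  act_mem d e u hu x hx := by
    rw [hgr, hact]
    exact h.act_mem d e u hu _ ((hgr e x).1 hx)
  one_mul a := hf.1 <| by rw [hmul, hone, h.one_mul]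
  mul_one a := hf.1 <| by rw [hmul, hone, h.mul_one]
  mul_assoc a b c := hf.1 <| by rw [hmul, hmul, hmul, hmul, h.mul_assoc]
  one_mem := by rw [hgr, hone]; exact h.one_mem
  mul_mem d e a ha b hb := by
    rw [hgr, hmul]
    exact h.mul_mem d e _ ((hgr d a).1 ha) _ ((hgr e b).1 hb)
  act_mul u d a ha b := hf.1 <| by
    rw [hact, hmul, h.act_mul u d _ ((hgr d a).1 ha)]
    -- Both sides are linear in Δ(u), so it may be replaced by a pure tensor.
    generalize comulLin n u = z
    induction z using TensorProduct.induction_on with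
    | zero => simp only [map_zero]
    | add z w hz hw => simp only [map_add, hz, hw]
    | tmul v w =>
      rw [TensorProduct.map_tmul, TensorProduct.map_tmul, hmul]
      simp only [LinearMap.comp_apply, LinearMap.flip_apply, hact]
  act_one u := hf.1 <| by rw [hact, hone, h.act_one, map_smul, hone]

end Transport

/-! ### Tensor product action and grading; the maps x ⊗ y ↦ f(x) g(y) -/

section TensorProducts

variable {n : ℕ} {A B C : Type*} [Ring A] [Algebra Kq A] [Ring B] [Algebra Kq B] [Ring C]
  [Algebra Kq C]

theorem tensorAction_tmul (grA : ZMod 2 → Submodule Kq A) [GradedAlgebra grA]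
    (Φ : Uq n →ₗ[Kq] Module.End Kq A) (Ψ : Uq n →ₗ[Kq] Module.End Kq B) (u : Uq n) {d : ZMod 2}
    {x : A} (hx : x ∈ grA d) (y : B) : tensorAction grA Φ Ψ u (x ⊗ₜ y) =
      TensorProduct.map (Φ.flip x) (Ψ.flip y ∘ₗ superSign n d) (comulLin n u) := by
  rw [tensorAction, LinearMap.sum_apply, LinearMap.sum_apply]
  simp only [LinearMap.comp_apply]
  generalize comulLin n u = z
  induction z using TensorProduct.induction_on with
  | zero => simp only [map_zero, LinearMap.zero_apply, Finset.sum_const_zero]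
  | add z w hz hw => simp only [map_add, LinearMap.add_apply, Finset.sum_add_distrib, hz, hw]
  | tmul v w =>
    simp only [TensorProduct.map_tmul, LinearMap.comp_apply, LinearMap.flip_apply]
    rw [Finset.sum_eq_single d]
    · rw [TensorProduct.homTensorHomMap_apply, TensorProduct.map_tmul, LinearMap.lcomp_apply,
        GradedAlgebra.proj_apply, DirectSum.decompose_of_mem_same _ hx]
    · intro e _ he
      rw [TensorProduct.homTensorHomMap_apply, TensorProduct.map_tmul, LinearMap.lcomp_apply,
        GradedAlgebra.proj_apply, DirectSum.decompose_of_mem_ne _ hx he.symm, map_zero,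
        TensorProduct.zero_tmul]
    · exact fun h => absurd (Finset.mem_univ d) h

/-- The linear map `x ⊗ y ↦ f(x) g(y)`. -/
noncomputable def mulMap (f : A →ₐ[Kq] C) (g : B →ₐ[Kq] C) : A ⊗[Kq] B →ₗ[Kq] C :=
  TensorProduct.lift ((LinearMap.mul Kq C).compl₁₂ f.toLinearMap g.toLinearMap)

@[simp] theorem mulMap_tmul (f : A →ₐ[Kq] C) (g : B →ₐ[Kq] C) (x : A) (y : B) :
    mulMap f g (x ⊗ₜ y) = f x * g y := rfl

theorem mulMap_mem {f : A →ₐ[Kq] C} {g : B →ₐ[Kq] C} {grA : ZMod 2 → Submodule Kq A}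
    {grB : ZMod 2 → Submodule Kq B} {grC : ZMod 2 → Submodule Kq C} [SetLike.GradedMonoid grC]
    (hf : ∀ d, ∀ x ∈ grA d, f x ∈ grC d) (hg : ∀ d, ∀ x ∈ grB d, g x ∈ grC d) {d : ZMod 2}
    {z : A ⊗[Kq] B} (hz : z ∈ tensorGrading grA grB d) : mulMap f g z ∈ grC d := by
  refine Submodule.span_le (p := (grC d).comap (mulMap f g)).2 ?_ hz
  rintro _ ⟨e, e', rfl, x, hx, y, hy, rfl⟩
  exact SetLike.GradedMul.mul_mem (hf e x hx) (hg e' y hy)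

/-- The action on a tensor product and the action on a product in C use the same sum over Δ(u) with
the same sign. This one statement covers σ and the map y ⊗ x ↦ ι_0(y) ι_k(x). -/
theorem mulMap_tensorAction {f : A →ₐ[Kq] C} {g : B →ₐ[Kq] C} {grA : ZMod 2 → Submodule Kq A}
    [GradedAlgebra grA] {grC : ZMod 2 → Submodule Kq C} {Φ : Uq n →ₗ[Kq] Module.End Kq A}
    {Ψ : Uq n →ₗ[Kq] Module.End Kq B} {Ω : Uq n →ₗ[Kq] Module.End Kq C}
    (h : IsSupermoduleSuperalgebra grC 1 (LinearMap.mul' Kq C) Ω)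
    (hf : ∀ d, ∀ x ∈ grA d, f x ∈ grC d) (hΦ : ∀ u x, Ω u (f x) = f (Φ u x))
    (hΨ : ∀ u y, Ω u (g y) = g (Ψ u y)) (u : Uq n) (z : A ⊗[Kq] B) :
    mulMap f g (tensorAction grA Φ Ψ u z) = Ω u (mulMap f g z) := by
  induction z using TensorProduct.induction_on with
  | zero => simp only [map_zero]
  | add z w hz hw => simp only [map_add, hz, hw]
  | tmul x y =>
    induction x using DirectSum.Decomposition.inductionOn grA with
    | zero => simp only [map_zero, TensorProduct.zero_tmul]
    | add x x' hx hx' => simp only [map_add, TensorProduct.add_tmul, hx, hx']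
    | @homogeneous d x =>
      rw [tensorAction_tmul grA Φ Ψ u x.2 y, mulMap_tmul]
      refine Eq.trans ?_ (h.act_mul u d _ (hf d _ x.2) (g y)).symm
      generalize comulLin n u = z
      induction z using TensorProduct.induction_on with
      | zero => simp only [map_zero]
      | add z w hz hw => simp only [map_add, hz, hw]
      | tmul v w =>
        simp only [TensorProduct.map_tmul, LinearMap.comp_apply, LinearMap.flip_apply, mulMap_tmul,
          LinearMap.mul'_apply, hΦ, hΨ]

theorem tensorGrading_sup (grA : ZMod 2 → Submodule Kq A) (grB : ZMod 2 → Submodule Kq B)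
    [GradedAlgebra grA] [GradedAlgebra grB] (d : ZMod 2) :
    tensorGrading grA grB d ⊔ tensorGrading grA grB (d + 1) = ⊤ := by
  refine eq_top_iff.2 fun z hz => ?_
  clear hz
  induction z using TensorProduct.induction_on with
  | zero => exact zero_mem _
  | add z w hz hw => exact add_mem hz hw
  | tmul x y =>
    induction x using DirectSum.Decomposition.inductionOn grA with
    | zero => rw [TensorProduct.zero_tmul]; exact zero_mem _
    | add x x' hx hx' => rw [TensorProduct.add_tmul]; exact add_mem hx hx'
    | @homogeneous e x =>
      induction y using DirectSum.Decomposition.inductionOn grB with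
      | zero => rw [TensorProduct.tmul_zero]; exact zero_mem _
      | add y y' hy hy' => rw [TensorProduct.tmul_add]; exact add_mem hy hy'
      | @homogeneous e' y =>
        have h2 : ∀ e e' d : ZMod 2, e + e' = d ∨ e + e' = d + 1 := by decide
        rcases h2 e e' d with h | h
        · exact Submodule.mem_sup_left
            (Submodule.subset_span ⟨e, e', h, x, x.2, y, y.2, rfl⟩)
        · exact Submodule.mem_sup_right
            (Submodule.subset_span ⟨e, e', h, x, x.2, y, y.2, rfl⟩)

theorem eq_zero_of_mem_of_mem (gr : ZMod 2 → Submodule Kq A) [GradedAlgebra gr] {d : ZMod 2}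
    {x : A} (h : x ∈ gr d) (h' : x ∈ gr (d + 1)) : x = 0 := by
  have hd : ∀ d : ZMod 2, d ≠ d + 1 := by decide
  rw [← DirectSum.decompose_of_mem_same gr h', DirectSum.decompose_of_mem_ne gr h (hd d)]

end TensorProducts

/-! ### The braiding, its uniqueness, and σ as an isomorphism -/

section Braiding

variable (r k n : ℕ)

theorem sigma_eq_mulMap : sigma r k n = mulMap (iotaUp r k n) (iotaLow r k n) := rfl

variable {r k n}

theorem iotaUp_mem (d : ZMod 2) (x : Acoord r n) (hx : x ∈ Agr r n d) :
    iotaUp r k n x ∈ Agr (r + k) n d := iota_mem k _ hx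

theorem iotaLow_mem (d : ZMod 2) (x : Acoord k n) (hx : x ∈ Agr k n d) :
    iotaLow r k n x ∈ Agr (r + k) n d := iota_mem 0 _ hx

theorem coordAct_iotaUp (u : Uq n) (x : Acoord r n) :
    (coordAct (r + k) n).toLinearMap u (iotaUp r k n x) =
      iotaUp r k n ((coordAct r n).toLinearMap u x) := coordAct_iota k _ u x

theorem coordAct_iotaLow (u : Uq n) (x : Acoord k n) :
    (coordAct (r + k) n).toLinearMap u (iotaLow r k n x) =
      iotaLow r k n ((coordAct k n).toLinearMap u x) := coordAct_iota 0 _ u x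

variable (r k n)

theorem sigma_mem {d : ZMod 2} {z : Acoord r n ⊗[Kq] Acoord k n}
    (hz : z ∈ tensorGrading (Agr r n) (Agr k n) d) : sigma r k n z ∈ Agr (r + k) n d := by
  rw [sigma_eq_mulMap]
  exact mulMap_mem iotaUp_mem iotaLow_mem hz

theorem sigma_mem_iff (d : ZMod 2) (z : Acoord r n ⊗[Kq] Acoord k n) :
    z ∈ tensorGrading (Agr r n) (Agr k n) d ↔ sigma r k n z ∈ Agr (r + k) n d := by
  refine ⟨sigma_mem r k n, fun h => ?_⟩
  -- The part z₁ of the wrong parity has an image lying in both degrees. That image is zero, so z₁ =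
  -- 0 by injectivity.
  obtain ⟨z₀, h₀, z₁, h₁, rfl⟩ : ∃ z₀ ∈ tensorGrading (Agr r n) (Agr k n) d,
      ∃ z₁ ∈ tensorGrading (Agr r n) (Agr k n) (d + 1), z₀ + z₁ = z :=
    Submodule.mem_sup.1 (tensorGrading_sup (Agr r n) (Agr k n) d ▸ Submodule.mem_top)
  rw [map_add] at h
  have h0 := eq_zero_of_mem_of_mem (Agr (r + k) n)
    ((Submodule.add_mem_iff_right _ (sigma_mem r k n h₀)).1 h) (sigma_mem r k n h₁)
  rw [sigma_injective (h0.trans (map_zero _).symm), add_zero]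
  exact h₀

theorem sigma_equivariant (u : Uq n) (z : Acoord r n ⊗[Kq] Acoord k n) :
    sigma r k n (tensorAction (Agr r n) (coordAct r n).toLinearMap (coordAct k n).toLinearMap u z) =
      (coordAct (r + k) n).toLinearMap u (sigma r k n z) := by
  rw [sigma_eq_mulMap]
  exact mulMap_tensorAction (isCoordAction_coordAct (r + k) n).supermoduleSuperalgebra
    iotaUp_mem coordAct_iotaUp coordAct_iotaLow u z

/-- The braiding `y ⊗ x ↦ σ⁻¹(ι_0(y) ι_k(x))`. -/
noncomputable def braiding : Acoord k n ⊗[Kq] Acoord r n →ₗ[Kq] Acoord r n ⊗[Kq] Acoord k n :=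
  (LinearEquiv.ofBijective (sigma r k n) (sigma_bijective r k n)).symm.toLinearMap ∘ₗ
    mulMap (iotaLow r k n) (iotaUp r k n)

theorem sigma_braiding (z : Acoord k n ⊗[Kq] Acoord r n) :
    sigma r k n (braiding r k n z) = mulMap (iotaLow r k n) (iotaUp r k n) z :=
  (LinearEquiv.ofBijective (sigma r k n) (sigma_bijective r k n)).apply_symm_apply _

variable {r k n}

/-- After applying σ, the last steps of the axiom for products in A_{r,n} become right
multiplication by ι_k(x). The set Y allows for a Ξ known only on some y: the uniqueness proof uses
the generators, the existence proof everything. -/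
theorem sigma_mul_right {Ξ : Acoord k n ⊗[Kq] Acoord r n →ₗ[Kq] Acoord r n ⊗[Kq] Acoord k n}
    {Y : Set (Acoord k n)} {x : Acoord r n}
    (h : ∀ y ∈ Y, sigma r k n (Ξ (y ⊗ₜ x)) = iotaLow r k n y * iotaUp r k n x)
    {w : Acoord r n ⊗[Kq] Acoord k n}
    (hw : w ∈ Submodule.span Kq {z | ∃ x : Acoord r n, ∃ y ∈ Y, z = x ⊗ₜ[Kq] y}) :
    sigma r k n ((LinearMap.mul' Kq (Acoord r n)).rTensor (Acoord k n)
      ((TensorProduct.assoc Kq (Acoord r n) (Acoord r n) (Acoord k n)).symm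
        (Ξ.lTensor (Acoord r n)
          (TensorProduct.assoc Kq (Acoord r n) (Acoord k n) (Acoord r n) (w ⊗ₜ x))))) =
      sigma r k n w * iotaUp r k n x := by
  induction hw using Submodule.span_induction with
  | zero => simp only [map_zero, TensorProduct.zero_tmul, zero_mul]
  | add w w' _ _ hw hw' => simp only [map_add, TensorProduct.add_tmul, add_mul, hw, hw']
  | smul c w _ hw =>
    simp only [map_smul, ← TensorProduct.smul_tmul', smul_mul_assoc, hw]
  | mem w hw =>
    obtain ⟨x', y, hy, rfl⟩ := hw
    rw [TensorProduct.assoc_tmul, LinearMap.lTensor_tmul, sigma_tmul, mul_assoc, ← h y hy]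
    generalize Ξ (y ⊗ₜ x) = v
    induction v using TensorProduct.induction_on with
    | zero => simp only [map_zero, TensorProduct.tmul_zero, mul_zero]
    | add v v' hv hv' => simp only [map_add, TensorProduct.tmul_add, mul_add, hv, hv']
    | tmul a b =>
      rw [TensorProduct.assoc_symm_tmul, LinearMap.rTensor_tmul, LinearMap.mul'_apply, sigma_tmul,
        sigma_tmul, map_mul, mul_assoc]

theorem sigma_mul_left {Ξ : Acoord k n ⊗[Kq] Acoord r n →ₗ[Kq] Acoord r n ⊗[Kq] Acoord k n}
    {y : Acoord k n}
    (h : ∀ x, sigma r k n (Ξ (y ⊗ₜ x)) = iotaLow r k n y * iotaUp r k n x)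
    (w : Acoord r n ⊗[Kq] Acoord k n) :
    sigma r k n ((LinearMap.mul' Kq (Acoord k n)).lTensor (Acoord r n)
      (TensorProduct.assoc Kq (Acoord r n) (Acoord k n) (Acoord k n)
        (Ξ.rTensor (Acoord k n)
          ((TensorProduct.assoc Kq (Acoord k n) (Acoord r n) (Acoord k n)).symm (y ⊗ₜ w))))) =
      iotaLow r k n y * sigma r k n w := by
  induction w using TensorProduct.induction_on with
  | zero => simp only [map_zero, TensorProduct.tmul_zero, mul_zero]
  | add w w' hw hw' => simp only [map_add, TensorProduct.tmul_add, mul_add, hw, hw']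
  | tmul x y' =>
    rw [TensorProduct.assoc_symm_tmul, LinearMap.rTensor_tmul, sigma_tmul, ← mul_assoc, ← h x]
    generalize Ξ (y ⊗ₜ x) = v
    induction v using TensorProduct.induction_on with
    | zero => simp only [map_zero, TensorProduct.zero_tmul, zero_mul]
    | add v v' hv hv' => simp only [map_add, TensorProduct.add_tmul, add_mul, hv, hv']
    | tmul a b =>
      rw [TensorProduct.assoc_tmul, LinearMap.lTensor_tmul, LinearMap.mul'_apply, sigma_tmul,
        sigma_tmul, map_mul, mul_assoc]

theorem sgn_smul_low_mul_up {j : Idx k} {i : Idx r} (hj : 0 < j.1) (hi : 0 < i.1) (b a : Idx n) :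
    sgn ((par j + par b) * (par i + par a)) •
      (iotaLow r k n (tgen j b) * iotaUp r k n (tgen i a)) =
    sigma r k n (∑ b', ∑ a', (sgn ((par i + par a') * (par b' + par b)) * Smat b' b a' a) •
        (tgen i a' ⊗ₜ[Kq] tgen j b')) := by
  rw [low_mul_up_tgen hj hi, Finset.smul_sum, map_sum]
  refine Finset.sum_congr rfl fun y _ => ?_
  rw [rightMat_tgen hi, map_sum, map_sum, Finset.sum_mul, Finset.smul_sum]
  refine Finset.sum_congr rfl fun x _ => ?_
  rw [map_smul, map_smul, smul_mul_assoc, smul_smul, sigma_tmul, Rmat]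
  congr 1
  by_cases h0 : Smat y b x a = 0
  · simp [h0]
  · have e := Smat_parity h0
    rw [← mul_assoc, ← sgn_add, par_of_pos hi, par_of_pos hj]
    congr 2
    revert e
    generalize par a = a; generalize par b = b; generalize par x = c; generalize par y = d
    clear * -
    revert a b c d; decide

/-- Injectivity of σ turns each axiom into an identity in A_{r+k,n}: the two multiplicativity axioms
are associativity, and the formula on generators is the exchange rule. -/
theorem isBraiding_braiding :
    IsBraiding r k n (coordAct r n).toLinearMap (coordAct k n).toLinearMap (braiding r k n) where
  supermoduleHom :=
    { even := fun d z hz => by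
        rw [sigma_mem_iff, sigma_braiding]
        exact mulMap_mem iotaLow_mem iotaUp_mem hz
      equivariant := fun u z => sigma_injective <| by
        rw [sigma_equivariant, sigma_braiding, sigma_braiding]
        exact mulMap_tensorAction (isCoordAction_coordAct (r + k) n).supermoduleSuperalgebra
          iotaLow_mem coordAct_iotaLow coordAct_iotaUp u z }
  mul_right := by
    refine LinearMap.ext fun z => sigma_injective ?_
    induction z using TensorProduct.induction_on with
    | zero => simp only [map_zero]
    | add z w hz hw => simp only [map_add, hz, hw]
    | tmul y z =>
      induction z using TensorProduct.induction_on with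
      | zero => simp only [map_zero, TensorProduct.tmul_zero]
      | add z w hz hw => simp only [map_add, TensorProduct.tmul_add, hz, hw]
      | tmul x x' =>
        have hw : braiding r k n (y ⊗ₜ x) ∈ Submodule.span Kq {z | ∃ x : Acoord r n,
            ∃ y ∈ (Set.univ : Set (Acoord k n)), z = x ⊗ₜ[Kq] y} := by
          generalize braiding r k n (y ⊗ₜ x) = w
          induction w using TensorProduct.induction_on with
          | zero => exact zero_mem _
          | add z w hz hw => exact add_mem hz hw
          | tmul a b => exact Submodule.subset_span ⟨a, b, trivial, rfl⟩
        refine Eq.trans ?_ (sigma_mul_right (x := x') (fun y _ => sigma_braiding r k n _) hw).symm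
        change sigma r k n (braiding r k n (y ⊗ₜ (x * x'))) = _
        rw [sigma_braiding, sigma_braiding, mulMap_tmul, mulMap_tmul, map_mul, mul_assoc]
  mul_left := by
    refine LinearMap.ext fun z => sigma_injective ?_
    induction z using TensorProduct.induction_on with
    | zero => simp only [map_zero]
    | add z w hz hw => simp only [map_add, hz, hw]
    | tmul z x =>
      induction z using TensorProduct.induction_on with
      | zero => simp only [map_zero, TensorProduct.zero_tmul]
      | add z w hz hw => simp only [map_add, TensorProduct.add_tmul, hz, hw]
      | tmul y y' =>
        refine Eq.trans ?_ (sigma_mul_left (y := y) (fun x => sigma_braiding r k n _)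
          (braiding r k n (y' ⊗ₜ x))).symm
        change sigma r k n (braiding r k n ((y * y') ⊗ₜ x)) = _
        rw [sigma_braiding, sigma_braiding, mulMap_tmul, mulMap_tmul, map_mul, mul_assoc]
  one_left x := sigma_injective <| by
    rw [sigma_braiding, mulMap_tmul, sigma_tmul, map_one (iotaLow r k n), one_mul, mul_one]
  one_right y := sigma_injective <| by
    rw [sigma_braiding, mulMap_tmul, sigma_tmul, map_one (iotaUp r k n), one_mul, mul_one]
  map_tgen j b i a hj hi := sigma_injective <| by
    rw [map_smul, sigma_braiding, mulMap_tmul, sgn_smul_low_mul_up hj hi]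

theorem IsBraiding.eq_braiding {Φr : Uq n →ₗ[Kq] Module.End Kq (Acoord r n)}
    {Φk : Uq n →ₗ[Kq] Module.End Kq (Acoord k n)}
    {Ξ : Acoord k n ⊗[Kq] Acoord r n →ₗ[Kq] Acoord r n ⊗[Kq] Acoord k n}
    (h : IsBraiding r k n Φr Φk Ξ) : Ξ = braiding r k n := by
  let f (y : Acoord k n) : Acoord r n →ₗ[Kq] Acoord (r + k) n :=
    sigma r k n ∘ₗ Ξ ∘ₗ TensorProduct.mk Kq (Acoord k n) (Acoord r n) y
  let g (y : Acoord k n) : Acoord r n →ₗ[Kq] Acoord (r + k) n :=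
    LinearMap.mulLeft Kq (iotaLow r k n y) ∘ₗ (iotaUp r k n).toLinearMap
  -- Agreement is shown first for y = t_{jb}, by induction on x using `mul_right`, for all columns b
  -- together because the exchange changes b. A second induction, on y using `mul_left`, then treats
  -- all x at once.
  have hgen : ∀ x : Acoord r n, x ∈ ⨅ j : {j : Idx k // 0 < j.1}, ⨅ b,
      LinearMap.eqLocus (f (tgen j.1 b)) (g (tgen j.1 b)) := by
    refine mem_of_tgen_mul_mem ?_ fun i a hi x hx => ?_
    · simp only [Submodule.mem_iInf]
      intro j b
      change sigma r k n (Ξ (tgen j.1 b ⊗ₜ 1)) = iotaLow r k n (tgen j.1 b) * iotaUp r k n 1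
      rw [h.one_right, sigma_tmul, map_one (iotaUp r k n), one_mul, mul_one]
    · simp only [Submodule.mem_iInf] at hx ⊢
      intro j b
      change sigma r k n (Ξ (tgen j.1 b ⊗ₜ (tgen i a * x))) =
        iotaLow r k n (tgen j.1 b) * iotaUp r k n (tgen i a * x)
      have ht := h.map_tgen j.1 b i a j.2 hi
      -- The prescribed value on two generators only involves tensors whose second factor is again a
      -- generator, so the induction hypothesis applies to each term.
      have hw : Ξ (tgen j.1 b ⊗ₜ tgen i a) ∈ Submodule.span Kq {z | ∃ x : Acoord r n,
          ∃ y ∈ {y : Acoord k n | ∃ (j : Idx k) (b : Idx n), 0 < j.1 ∧ y = tgen j b},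
            z = x ⊗ₜ[Kq] y} := by
        have hs : sgn ((par j.1 + par b) * (par i + par a)) ≠ 0 :=
          pow_ne_zero _ (neg_ne_zero.2 one_ne_zero)
        rw [← Submodule.smul_mem_iff _ hs, ht]
        exact Submodule.sum_mem _ fun b' _ => Submodule.sum_mem _ fun a' _ =>
          Submodule.smul_mem _ _ (Submodule.subset_span ⟨_, _, ⟨j.1, b', j.2, rfl⟩, rfl⟩)
      have e := LinearMap.congr_fun h.mul_right (tgen j.1 b ⊗ₜ (tgen i a ⊗ₜ x))
      refine (congrArg (sigma r k n) e).trans ((sigma_mul_right (x := x) ?_ hw).trans ?_)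
      · rintro _ ⟨j', b', hj', rfl⟩
        exact hx ⟨j', hj'⟩ b'
      · have e2 := congrArg (sigma r k n) ht
        rw [map_smul, ← sgn_smul_low_mul_up j.2 hi] at e2
        have e3 : sigma r k n (Ξ (tgen j.1 b ⊗ₜ tgen i a)) =
            iotaLow r k n (tgen j.1 b) * iotaUp r k n (tgen i a) := smul_sgn_cancel e2
        rw [e3, map_mul, mul_assoc]
  simp only [Submodule.mem_iInf] at hgen
  have key : ∀ y : Acoord k n, y ∈ ⨅ x : Acoord r n, LinearMap.eqLocus
      (sigma r k n ∘ₗ Ξ ∘ₗ (TensorProduct.mk Kq (Acoord k n) (Acoord r n)).flip x)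
      (mulMap (iotaLow r k n) (iotaUp r k n) ∘ₗ
        (TensorProduct.mk Kq (Acoord k n) (Acoord r n)).flip x) := by
    refine mem_of_tgen_mul_mem ?_ fun j b hj y hy => ?_
    · simp only [Submodule.mem_iInf]
      intro x
      change sigma r k n (Ξ (1 ⊗ₜ x)) = iotaLow r k n 1 * iotaUp r k n x
      rw [h.one_left, sigma_tmul, map_one (iotaLow r k n), one_mul, mul_one]
    · simp only [Submodule.mem_iInf] at hy ⊢
      intro x
      change sigma r k n (Ξ ((tgen j b * y) ⊗ₜ x)) = iotaLow r k n (tgen j b * y) * iotaUp r k n x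
      have hx : sigma r k n (Ξ (y ⊗ₜ x)) = iotaLow r k n y * iotaUp r k n x := hy x
      have e := LinearMap.congr_fun h.mul_left ((tgen j b ⊗ₜ y) ⊗ₜ x)
      refine (congrArg (sigma r k n) e).trans
        ((sigma_mul_left (fun x => hgen x ⟨j, hj⟩ b) (Ξ (y ⊗ₜ x))).trans ?_)
      rw [hx, map_mul, mul_assoc]
  refine TensorProduct.ext' fun y x => sigma_injective ?_
  have := key y
  simp only [Submodule.mem_iInf] at this
  rw [sigma_braiding]
  exact this x

theorem isBraiding_iff (Ξ : Acoord k n ⊗[Kq] Acoord r n →ₗ[Kq] Acoord r n ⊗[Kq] Acoord k n) :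
    IsBraiding r k n (coordAct r n).toLinearMap (coordAct k n).toLinearMap Ξ ↔
      Ξ = braiding r k n :=
  ⟨fun h => h.eq_braiding, fun h => h ▸ isBraiding_braiding⟩

/-- In ι_k(x) ι_0(y) ι_k(x') ι_0(y') the two middle factors are σ(Θ(y ⊗ x')), by the choice of Θ. -/
theorem sigma_braidedMul (z w : Acoord r n ⊗[Kq] Acoord k n) :
    sigma r k n (braidedMul (braiding r k n) (z ⊗ₜ w)) = sigma r k n z * sigma r k n w := by
  induction z using TensorProduct.induction_on with
  | zero => simp only [map_zero, TensorProduct.zero_tmul, zero_mul]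
  | add z z' hz hz' => simp only [map_add, TensorProduct.add_tmul, add_mul, hz, hz']
  | tmul x y =>
    induction w using TensorProduct.induction_on with
    | zero => simp only [map_zero, TensorProduct.tmul_zero, mul_zero]
    | add w w' hw hw' => simp only [map_add, TensorProduct.tmul_add, mul_add, hw, hw']
    | tmul x' y' =>
      have e : sigma r k n (x ⊗ₜ y) * sigma r k n (x' ⊗ₜ y') = iotaUp r k n x *
          sigma r k n (braiding r k n (y ⊗ₜ x')) * iotaLow r k n y' := by
        rw [sigma_braiding, mulMap_tmul, sigma_tmul, sigma_tmul]
        simp only [mul_assoc]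
      rw [e]
      change sigma r k n (TensorProduct.map (LinearMap.mul' Kq (Acoord r n))
        (LinearMap.mul' Kq (Acoord k n)) ((TensorProduct.tensorTensorTensorAssoc Kq (Acoord r n)
          (Acoord r n) (Acoord k n) (Acoord k n)).symm
            ((x ⊗ₜ braiding r k n (y ⊗ₜ x')) ⊗ₜ y'))) = _
      generalize braiding r k n (y ⊗ₜ x') = v
      induction v using TensorProduct.induction_on with
      | zero => simp only [map_zero, TensorProduct.zero_tmul, TensorProduct.tmul_zero, zero_mul,
          mul_zero]
      | add v v' hv hv' =>
        simp only [map_add, TensorProduct.add_tmul, TensorProduct.tmul_add, add_mul, mul_add, hv,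
          hv']
      | tmul a b =>
        rw [TensorProduct.tensorTensorTensorAssoc_symm_tmul, TensorProduct.map_tmul,
          LinearMap.mul'_apply, LinearMap.mul'_apply, sigma_tmul, sigma_tmul, map_mul, map_mul]
        simp only [mul_assoc]

theorem isSupermoduleSuperalgebraIso_sigma (r k n : ℕ) : IsSupermoduleSuperalgebraIso
    (tensorGrading (Agr r n) (Agr k n)) (1 ⊗ₜ[Kq] 1) (braidedMul (braiding r k n))
    (tensorAction (Agr r n) (coordAct r n).toLinearMap (coordAct k n).toLinearMap)
    (Agr (r + k) n) 1 (LinearMap.mul' Kq (Acoord (r + k) n)) (coordAct (r + k) n).toLinearMap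
    (sigma r k n) := by
  have hone : sigma r k n (1 ⊗ₜ[Kq] 1) = 1 := by
    rw [sigma_tmul, map_one, map_one, one_mul]
  have htarget := (isCoordAction_coordAct (r + k) n).supermoduleSuperalgebra
  exact
    { even := fun d x hx => sigma_mem r k n hx
      equivariant := sigma_equivariant r k n
      -- Associativity of the braided product and its compatibility with the action are inherited
      -- from A_{r+k,n}, with no separate verification.
      source := htarget.of_bijective (sigma_bijective r k n) (sigma_mem_iff r k n) hone
        sigma_braidedMul (sigma_equivariant r k n)
      target := htarget
      bijective := sigma_bijective r k n
      map_one := hone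
      map_mul := sigma_braidedMul }

end Braiding

end QueerBraided

theorem mainTheorem2 (n r k : ℕ) :
    ∃ Φ : ∀ m : ℕ, Uq n →ₗ[Kq] Module.End Kq (Acoord m n),
      (∀ m Ψ, IsCoordAction m n Ψ ↔ Ψ = Φ m) ∧
      ∃ Θ : Acoord k n ⊗[Kq] Acoord r n →ₗ[Kq] Acoord r n ⊗[Kq] Acoord k n,
        (∀ Ξ, IsBraiding r k n (Φ r) (Φ k) Ξ ↔ Ξ = Θ) ∧
        IsSupermoduleSuperalgebraIso
          (tensorGrading (Agr r n) (Agr k n)) (1 ⊗ₜ[Kq] 1) (braidedMul Θ)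
          (tensorAction (Agr r n) (Φ r) (Φ k))
          (Agr (r + k) n) 1 (LinearMap.mul' Kq (Acoord (r + k) n)) (Φ (r + k))
          (sigma r k n) := by
  exact ⟨fun m => (coordAct m n).toLinearMap, fun _ Ψ => isCoordAction_iff Ψ, braiding r k n,
    isBraiding_iff, isSupermoduleSuperalgebraIso_sigma r k n⟩
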